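/- **Setting.** A stream $x_1,x_2,\dots$ of elements of $\{1,\dots,u\}$ arrives one element at a time; the window $W$ at time $n\ge 1$ consists of the last $\min(n,N)$ elements, where $N\ge 2$. Let $n_i(W)$ be the number of occurrences of $i$ in $W$ and $L_2(W)=(\sum_i n_i(W)^2)^{1/2}$. A randomized streaming algorithm draws a uniformly random seed once and then updates its state on each arrival; its memory is the number of words (integers) that describe seed and state, and probabilities are over the seed. **Algorithm Freq$(\gamma,\epsilon,\delta)$** (with an absolute constant $\kappa$ in the sizes below). 1. It keeps a smooth histogram for $L_2$ with parameters $\alpha=\epsilon/2$, $\beta=\alpha^2/2$: a list $A_1,A_2,\dots$ of buckets, i.e. suffixes of the stream, the oldest first. Each bucket has its size and an AMS sketch for $L_2$: $\lceil\kappa\log(2N/\delta)\rceil$ rows, each averaging $\lceil\kappa/\epsilon^2\rceil$ squared sums of 4-wise independent random signs, with the same signs for all buckets; $L_2$ is estimated by the median of the rows. Every arrival is appended to all buckets and starts a new one. Then, for each remaining bucket $A$ in turn, the buckets strictly between $A$ and the last bucket $B$ that passes the test $\hat L_2(B)\ge(1-\beta)\hat L_2(A)$ (decided by the majority of the rows)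 are deleted, and $A_1$ is deleted as long as $A_2$ contains the window. Buckets with more than $4N^2$ elements, and the oldest of more than $\lceil\kappa\epsilon^{-2}\log N\rceil$ buckets, are dropped. 2. On each bucket it runs CountSketch of Charikar, Chen and Farach-Colton with $k=\lfloor\gamma^{-2}\rfloor+1$ candidates, $\lceil\kappa\log(2N/\delta)\rceil$ rows of pairwise independent hash functions and signs, and $b$ cells per row, $b$ being the least power of two that is at least $256/(\gamma^2\epsilon'^2)$ with $\epsilon'=\epsilon/4$. 3. When queried, it outputs every candidate $q$ of $A_1$ whose estimated frequency exceeds $\frac{1}{1+\epsilon}\gamma\hat L_2$, where $\hat L_2$ is the estimate of $L_2(A_1)$. **Theorem.** (a) There are absolute constants $\kappa,c_0,\epsilon_0,C>0$ and $d\in\mathbb N$ such that for all $u$, $N\ge2$, $\gamma,\delta\in(0,1)$ and $0<\epsilon<\epsilon_0$, on every stream and at every time $n\ge1$, with probability at least $1-\delta$ the output of Freq$(\gamma,\epsilon,\delta)$ contains every element with $n_i(W)\ge(1+c_0\epsilon)\gamma L_2(W)$ and no element with $n_i(W)<(1-c\epsilon)\gamma L_2(W)$, where $c=c_0/\gamma$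 depends only on $\gamma$. Always (for every seed, stream and time) its memory has at most $$C\Big(\frac1{\gamma^2\epsilon^4}\log N\log\frac N\delta+\frac1{\epsilon^4}\log N\log\frac1\epsilon\Big)$$ words, each of absolute value at most $(2Nu/(\gamma\epsilon))^d$. (b) There are a polynomial $p$ and $d\in\mathbb N$ such that for all $u$, $N\ge2$ and $\gamma,\epsilon,\delta\in(0,1)$ some randomized streaming algorithm has the following properties. On every stream and at every time $n\ge1$, with probability at least $1-\delta$ it outputs every element with $n_i(W)>\gamma L_2(W)$ and no element with $n_i(W)<(1-\epsilon)\gamma L_2(W)$. Always its memory has at most $p(1/\epsilon,1/\gamma,\log N,\log(1/\delta))$ words, each of absolute value at most $(2Nu/(\gamma\epsilon))^d$. -/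

import Mathlib

namespace SlidingWindow

/-! ### Streams, windows, frequencies -/

/-- Frequency of `i` in the segment of the stream made of the elements with index in `[a, n)`. -/
def freq {u : ℕ} (x : ℕ → Fin u) (a n : ℕ) (i : Fin u) : ℕ :=
  ((Finset.Ico a n).filter (fun j => x j = i)).card

/-- Frequency of `i` in the window, i.e. among the last `N` of the first `n` elements of the stream
(among all of them if `n < N`). -/
def winFreq {u : ℕ} (N : ℕ) (x : ℕ → Fin u) (n : ℕ) (i : Fin u) : ℕ :=
  freq x (n - N) n i

/-- The second frequency norm of the window. -/
noncomputable def winL2 {u : ℕ} (N : ℕ) (x : ℕ → Fin u) (n : ℕ) : ℝ :=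
  Real.sqrt (∑ i, (winFreq N x n i : ℝ) ^ 2)

/-! ### Randomized streaming algorithms -/

/-- A randomized one-pass algorithm over the universe `Fin u`. A uniformly random seed is drawn
before the stream starts and stays in memory; the memory content is the list of integers (words)
`seedWords ω ++ stateWords s`, which determines the seed and the state. -/
structure StreamAlgorithm (u : ℕ) where
  Seed : Type
  seedFintype : Fintype Seed
  seedNonempty : Nonempty Seed
  State : Type
  init : State
  step : Seed → State → Fin u → State
  report : Seed → State → Finset (Fin u)
  seedWords : Seed → List ℤ
  stateWords : State → List ℤ
  seedWords_injective : Function.Injective seedWords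
  stateWords_injective : Function.Injective stateWords

namespace StreamAlgorithm

variable {u : ℕ} (A : StreamAlgorithm u)

/-- State after the first `n` elements of the stream `x`, with seed `ω`. -/
def run (ω : A.Seed) (x : ℕ → Fin u) : ℕ → A.State
  | 0 => A.init
  | n + 1 => A.step ω (run ω x n) (x n)

/-- Output when queried after `n` elements. -/
def output (ω : A.Seed) (x : ℕ → Fin u) (n : ℕ) : Finset (Fin u) :=
  A.report ω (A.run ω x n)

/-- Memory content after `n` elements. -/
def memory (ω : A.Seed) (x : ℕ → Fin u) (n : ℕ) : List ℤ :=
  A.seedWords ω ++ A.stateWords (A.run ω x n)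

/-- Probability of an event over the uniformly random seed. -/
noncomputable def prob (p : A.Seed → Prop) : ℝ :=
  (Nat.card {ω : A.Seed // p ω} : ℝ) / (Nat.card A.Seed : ℝ)

/-- At every time (after at least one element), with probability at least `1 - δ`, the output
contains every element whose window frequency is at least `hi` times the window's `L₂` norm, and
no element whose window frequency is lower than `lo` times that norm. -/
def Separates (N : ℕ) (hi lo δ : ℝ) : Prop :=
  ∀ (x : ℕ → Fin u) (n : ℕ), 1 ≤ n →
    1 - δ ≤ A.prob (fun ω =>
      (∀ i, hi * winL2 N x n ≤ winFreq N x n i → i ∈ A.output ω x n) ∧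
      (∀ i, (winFreq N x n i : ℝ) < lo * winL2 N x n → i ∉ A.output ω x n))

/-- At every time, with probability at least `1 - δ`, the output is a `(γ, ε)`-approximation of the
`L₂`-frequent elements of the window: it contains every element with `n_i > γ L₂` and no element
with `n_i < (1 - ε) γ L₂`. -/
def ApproximatesFrequent (N : ℕ) (γ ε δ : ℝ) : Prop :=
  ∀ (x : ℕ → Fin u) (n : ℕ), 1 ≤ n →
    1 - δ ≤ A.prob (fun ω =>
      (∀ i, γ * winL2 N x n < winFreq N x n i → i ∈ A.output ω x n) ∧
      (∀ i, (winFreq N x n i : ℝ) < (1 - ε) * γ * winL2 N x n → i ∉ A.output ω x n))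

/-- Whatever the stream, the seed and the time, the memory has at most `M` words. -/
def UsesWords (M : ℝ) : Prop :=
  ∀ (ω : A.Seed) (x : ℕ → Fin u) (n : ℕ), ((A.memory ω x n).length : ℝ) ≤ M

/-- Whatever the stream, the seed and the time, every word in memory is at most `B` in absolute
value. -/
def WordsBoundedBy (B : ℝ) : Prop :=
  ∀ (ω : A.Seed) (x : ℕ → Fin u) (n : ℕ), ∀ w ∈ A.memory ω x n, |(w : ℝ)| ≤ B

end StreamAlgorithm

/-! ### Writing data as lists of words -/

/-- `c` is a prefix code: concatenations of code words can be decoded uniquely. -/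
def PrefixCode {α : Type*} (c : α → List ℤ) : Prop :=
  ∀ a b s s', c a ++ s = c b ++ s' → a = b ∧ s = s'

theorem PrefixCode.injective {α : Type*} {c : α → List ℤ} (h : PrefixCode c) :
    Function.Injective c := fun a b hab => (h a b [] [] (by simp [hab])).1

/-- Words of an array. -/
def arrayWords {α : Type*} (c : α → List ℤ) {n : ℕ} (f : Fin n → α) : List ℤ :=
  (List.ofFn fun i => c (f i)).flatten

theorem PrefixCode.array {α : Type*} {c : α → List ℤ} (h : PrefixCode c) (n : ℕ) :
    PrefixCode (arrayWords c (n := n)) := by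
  induction n with
  | zero =>
    intro a b s s' e
    exact ⟨Subsingleton.elim _ _, by simpa [arrayWords] using e⟩
  | succ n ih =>
    intro a b s s' e
    simp only [arrayWords, List.ofFn_succ, List.flatten_cons, List.append_assoc] at e
    obtain ⟨h0, e⟩ := h _ _ _ _ e
    obtain ⟨h1, e⟩ := ih (fun i => a i.succ) (fun i => b i.succ) _ _ e
    refine ⟨funext fun i => ?_, e⟩
    refine Fin.cases h0 (fun j => congrFun h1 j) i

theorem PrefixCode.prod {α β : Type*} {c : α → List ℤ} {d : β → List ℤ} (h : PrefixCode c)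
    (h' : PrefixCode d) : PrefixCode (fun p : α × β => c p.1 ++ d p.2) := by
  intro a b s s' e
  simp only [List.append_assoc] at e
  obtain ⟨h0, e⟩ := h _ _ _ _ e
  obtain ⟨h1, e⟩ := h' _ _ _ _ e
  exact ⟨Prod.ext h0 h1, e⟩

/-- Words of a list of variable length: its length, then its members. -/
def listWords {α : Type*} (c : α → List ℤ) (l : List α) : List ℤ :=
  (l.length : ℤ) :: l.flatMap c

theorem PrefixCode.list {α : Type*} {c : α → List ℤ} (h : PrefixCode c) :
    PrefixCode (listWords c) := by
  intro a b s s' e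
  simp only [listWords, List.cons_append, List.cons.injEq, Nat.cast_inj] at e
  obtain ⟨hl, e⟩ := e
  induction a generalizing b with
  | nil =>
    cases b with
    | nil => exact ⟨rfl, by simpa using e⟩
    | cons y b => simp at hl
  | cons x a ih =>
    cases b with
    | nil => simp at hl
    | cons y b =>
      simp only [List.flatMap_cons, List.append_assoc] at e
      obtain ⟨h0, e⟩ := h _ _ _ _ e
      obtain ⟨h1, e⟩ := ih b (by simpa using hl) e
      exact ⟨by rw [h0, h1], e⟩

theorem prefixCode_int : PrefixCode (fun z : ℤ => [z]) := by
  intro a b s s' e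
  simpa using e

theorem prefixCode_fin (n : ℕ) : PrefixCode (fun z : Fin n => [((z : ℕ) : ℤ)]) := by
  intro a b s s' e
  simpa [Fin.ext_iff] using e

/-! ### Hash functions -/

/-- `(m+1)`-bit words, read as the elements of the field with `2 ^ (m+1)` elements. -/
noncomputable def fieldEquiv (m : ℕ) : GaloisField 2 (m + 1) ≃ Fin (2 ^ (m + 1)) :=
  Finite.equivFinOfCardEq (GaloisField.card 2 (m + 1) (Nat.succ_ne_zero m))

/-- The polynomial with the `d` coefficients `a`, evaluated at the point `x < 2 ^ (m+1)`. For
uniformly random `a` this is a `d`-wise independent hash function. -/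
noncomputable def polyHash (m : ℕ) {d : ℕ} (a : Fin d → Fin (2 ^ (m + 1))) (x : ℕ) : ℕ :=
  fieldEquiv m (∑ j : Fin d, (fieldEquiv m).symm (a j) *
    ((fieldEquiv m).symm (Fin.ofNat (2 ^ (m + 1)) x)) ^ (j : ℕ))

/-- A hash function with values in `Fin (2 ^ e)` (used with `e ≤ m + 1`). -/
noncomputable def cellHash (m e : ℕ) {d : ℕ} (a : Fin d → Fin (2 ^ (m + 1))) (x : ℕ) :
    Fin (2 ^ e) :=
  Fin.ofNat (2 ^ e) (polyHash m a x)

/-- A hash function with values in `{1, -1}`. -/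
noncomputable def signHash (m : ℕ) {d : ℕ} (a : Fin d → Fin (2 ^ (m + 1))) (x : ℕ) : ℤ :=
  if polyHash m a x % 2 = 0 then 1 else -1

/-- Median of finitely many integers. -/
def median {r : ℕ} (f : Fin r → ℤ) : ℤ :=
  ((List.ofFn f).insertionSort (· ≤ ·)).getD (r / 2) 0

/-! ### Parameters -/

/-- Parameters of the algorithm: size `u` of the universe, window size `N`, the numbers `γ, ε, δ`,
and the absolute constant `κ` that multiplies the sizes given up to a constant factor. -/
structure Params where
  u : ℕ
  N : ℕ
  γ : ℝ
  ε : ℝ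
  δ : ℝ
  κ : ℝ

namespace Params

variable (P : Params)

/-- Number of independent repetitions for the failure probability `δ / 2`. -/
noncomputable def rows : ℕ := ⌈P.κ * Real.log (P.N / (P.δ / 2))⌉₊

/-- Precision `ε' = ε / 4` of CountSketch. -/
noncomputable def csEps : ℝ := P.ε / 4

/-- The number of cells `b` in a row of CountSketch is `2 ^ cellBits`, the least power of two that
is at least `256 / (γ² ε'²)`. -/
noncomputable def cellBits : ℕ := Nat.clog 2 ⌈256 / (P.γ ^ 2 * P.csEps ^ 2)⌉₊

/-- Length `k` of the list of candidates kept by CountSketch. -/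
noncomputable def listLen : ℕ := ⌊1 / P.γ ^ 2⌋₊ + 1

/-- Hash functions work with words of `hashBits + 1` bits. -/
noncomputable def hashBits : ℕ := max (Nat.clog 2 P.u) P.cellBits

/-- Number of averaged copies in the `L₂` sketch. -/
noncomputable def cols : ℕ := ⌈P.κ / P.ε ^ 2⌉₊

/-- The smooth histogram uses that `L₂` is `(α, α²/2)`-smooth, for `α = ε / 2`. -/
noncomputable def α : ℝ := P.ε / 2

noncomputable def β : ℝ := P.α ^ 2 / 2

/-- Maximal number of buckets of the histogram. -/
noncomputable def maxBuckets : ℕ := ⌈P.κ / P.ε ^ 2 * Real.log P.N⌉₊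

/-- Maximal size of a bucket: a bucket with `L₂` norm at most `2 L₂(W) ≤ 2 N` has at most `4 N²`
elements. -/
def maxSize : ℕ := 4 * P.N ^ 2

/-- A word of the seed. -/
abbrev Word : Type := Fin (2 ^ (P.hashBits + 1))

/-- Random choices: for each row of CountSketch a pairwise independent cell hash and a pairwise
independent sign hash; for each row and copy of the `L₂` sketch a 4-wise independent sign hash. -/
abbrev Seed : Type :=
  (Fin P.rows → (Fin 2 → P.Word) × (Fin 2 → P.Word)) ×
    (Fin P.rows → Fin P.cols → Fin 4 → P.Word)

end Params

/-! ### CountSketch (Charikar, Chen, Farach-Colton) -/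

/-- The table of counters of CountSketch. -/
abbrev CSTable (P : Params) : Type := Fin P.rows → Fin (2 ^ P.cellBits) → ℤ

/-- The list of candidates, each with its estimated frequency. -/
abbrev Candidates (P : Params) : Type := List (Fin P.u × ℤ)

noncomputable def csCell (P : Params) (ω : P.Seed) (r : Fin P.rows) (q : Fin P.u) :
    Fin (2 ^ P.cellBits) :=
  cellHash P.hashBits P.cellBits (ω.1 r).1 q

noncomputable def csSign (P : Params) (ω : P.Seed) (r : Fin P.rows) (q : Fin P.u) : ℤ :=
  signHash P.hashBits (ω.1 r).2 q

noncomputable def csAdd (P : Params) (ω : P.Seed) (T : CSTable P) (q : Fin P.u) : CSTable P :=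
  fun r c => if c = csCell P ω r q then T r c + csSign P ω r q else T r c

noncomputable def csEstimate (P : Params) (ω : P.Seed) (T : CSTable P) (q : Fin P.u) : ℤ :=
  median fun r => csSign P ω r q * T r (csCell P ω r q)

/-- Update of the candidates on arrival of `q`, whose frequency is currently estimated by `e`: if
`q` is a candidate its count is incremented; otherwise it is added if there is room, or replaces a
candidate of least count if that count is less than `e`. -/
noncomputable def candUpdate (P : Params) (H : Candidates P) (q : Fin P.u) (e : ℤ) :
    Candidates P :=
  if q ∈ H.map Prod.fst then H.map fun p => if p.1 = q then (p.1, p.2 + 1) else p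
  else if H.length < P.listLen then (q, e) :: H
  else match H.argmin Prod.snd with
    | none => H
    | some p => if p.2 < e then (q, e) :: H.erase p else H

/-! ### The `L₂` sketch (Alon, Matias, Szegedy) -/

/-- For every row and copy, the sum of the random signs of the elements. -/
abbrev L2Table (P : Params) : Type := Fin P.rows → Fin P.cols → ℤ

noncomputable def l2Add (P : Params) (ω : P.Seed) (Z : L2Table P) (q : Fin P.u) : L2Table P :=
  fun r c => Z r c + signHash P.hashBits (ω.2 r c) q

/-- Estimation of `L₂` by a single row. -/
noncomputable def l2Row (P : Params) (Z : L2Table P) (r : Fin P.rows) : ℝ :=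
  Real.sqrt (((∑ c, Z r c ^ 2 : ℤ) : ℝ) / P.cols)

/-- Estimation of `L₂`: the median of the rows. -/
noncomputable def l2Estimate (P : Params) (Z : L2Table P) : ℝ :=
  Real.sqrt ((median (fun r => ∑ c, Z r c ^ 2) : ℝ) / P.cols)

/-! ### The smooth histogram -/

/-- A bucket, i.e. a suffix of the stream. Only its size and its sketches are stored. -/
structure Bucket (P : Params) where
  size : ℕ
  cs : CSTable P
  cand : Candidates P
  l2 : L2Table P

/-- The empty bucket. -/
def Bucket.empty (P : Params) : Bucket P := ⟨0, fun _ _ => 0, [], fun _ _ => 0⟩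

/-- A new element is appended to the bucket. -/
noncomputable def Bucket.add {P : Params} (ω : P.Seed) (q : Fin P.u) (A : Bucket P) : Bucket P :=
  { size := A.size + 1
    cs := csAdd P ω A.cs q
    cand := candUpdate P A.cand q (csEstimate P ω (csAdd P ω A.cs q) q)
    l2 := l2Add P ω A.l2 q }

/-- The test `L₂(B) ≥ (1 - β) L₂(A)` of the histogram, decided by majority: each row compares its
own estimates for the two buckets. -/
def Close {P : Params} (A B : Bucket P) : Prop :=
  P.rows < 2 * Nat.card {r : Fin P.rows // (1 - P.β) * l2Row P A.l2 r ≤ l2Row P B.l2 r}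

open Classical in
/-- The part of the list from the last member with property `p` on (the whole list if there is no
such member). -/
noncomputable def skipTo {α : Type*} (p : α → Prop) : List α → List α
  | [] => []
  | y :: l => if ∃ z ∈ l, p z then skipTo p l else y :: l

theorem length_skipTo_le {α : Type*} (p : α → Prop) (l : List α) :
    (skipTo p l).length ≤ l.length := by
  induction l with
  | nil => simp [skipTo]
  | cons y l ih =>
    rw [skipTo]
    split_ifs
    · simp only [List.length_cons]; omega
    · exact le_rfl

/-- For every bucket `A` in turn (the oldest first), the buckets strictly between `A` and the last
bucket that is close to `A` are deleted. -/
noncomputable def prune {P : Params} : List (Bucket P) → List (Bucket P)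
  | [] => []
  | A :: l => A :: prune (skipTo (Close A) l)
termination_by l => l.length
decreasing_by
  have := length_skipTo_le (Close A) l
  simp only [List.length_cons]
  omega

/-- The first bucket is deleted as long as the second one still contains the window. -/
def expire {P : Params} : List (Bucket P) → List (Bucket P)
  | A :: B :: l => if P.N ≤ B.size then expire (B :: l) else A :: B :: l
  | l => l

/-- The buckets `A₁, A₂, …` are listed from the oldest to the newest. A new element is appended to
all of them and starts a new one; then close buckets are merged, expired ones are deleted, and the
oldest ones are dropped if they exceed the maximal size or the maximal number of buckets. -/
noncomputable def histStep (P : Params) (ω : P.Seed) (S : List (Bucket P)) (q : Fin P.u) :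
    List (Bucket P) :=
  let T := (expire (prune ((S ++ [Bucket.empty P]).map (Bucket.add ω q)))).filter
    fun A => A.size ≤ P.maxSize
  T.drop (T.length - P.maxBuckets)

open Classical in
/-- The candidates of the first bucket whose estimated frequency exceeds `γ L̂₂ / (1 + ε)`, where
`L̂₂` is the estimation of the `L₂` norm of the first bucket. -/
noncomputable def freqReport (P : Params) : List (Bucket P) → Finset (Fin P.u)
  | [] => ∅
  | A :: _ =>
    ((A.cand.filter fun p => 1 / (1 + P.ε) * P.γ * l2Estimate P A.l2 < (p.2 : ℝ)).map
      Prod.fst).toFinset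

/-! ### The algorithm as a `StreamAlgorithm` -/

/-- The words of a bucket: size, CountSketch table, candidates, `L₂` table. -/
noncomputable def bucketWords (P : Params) (A : Bucket P) : List ℤ :=
  [(A.size : ℤ)] ++ (arrayWords (arrayWords fun z => [z]) A.cs ++
    (listWords (fun p : Fin P.u × ℤ => [((p.1 : ℕ) : ℤ)] ++ [p.2]) A.cand ++
      arrayWords (arrayWords fun z => [z]) A.l2))

theorem prefixCode_bucket (P : Params) : PrefixCode (bucketWords P) := by
  intro A B s s' e
  obtain ⟨n, T, H, Z⟩ := A
  obtain ⟨n', T', H', Z'⟩ := B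
  have key := (prefixCode_int.prod (((prefixCode_int.array _).array _).prod
    (((prefixCode_fin P.u).prod prefixCode_int).list.prod
      ((prefixCode_int.array P.cols).array P.rows))))
    ((n : ℤ), T, H, Z) ((n' : ℤ), T', H', Z') s s' e
  simpa using key

/-- The words of a seed. -/
noncomputable def seedWords (P : Params) (ω : P.Seed) : List ℤ :=
  arrayWords (fun p : (Fin 2 → P.Word) × (Fin 2 → P.Word) =>
      arrayWords (fun z : P.Word => [((z : ℕ) : ℤ)]) p.1 ++
        arrayWords (fun z : P.Word => [((z : ℕ) : ℤ)]) p.2) ω.1 ++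
    arrayWords (arrayWords (arrayWords fun z : P.Word => [((z : ℕ) : ℤ)])) ω.2

theorem prefixCode_seed (P : Params) : PrefixCode (seedWords P) :=
  ((((prefixCode_fin _).array 2).prod ((prefixCode_fin _).array 2)).array P.rows).prod
    ((((prefixCode_fin _).array 4).array P.cols).array P.rows)

/-- The semi-smooth algorithm for frequent elements. -/
noncomputable def freqAlgorithm (P : Params) : StreamAlgorithm P.u where
  Seed := P.Seed
  seedFintype := inferInstance
  seedNonempty := inferInstance
  State := List (Bucket P)
  init := []
  step := histStep P
  report := fun _ => freqReport P
  seedWords := seedWords P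
  stateWords := listWords (bucketWords P)
  seedWords_injective := (prefixCode_seed P).injective
  stateWords_injective := (prefixCode_bucket P).list.injective

end SlidingWindow

namespace SlidingWindow

/-! ### Finite probability -/

section Probability

open Finset
open scoped BigOperators

variable {Ω Ω' : Type*} [Fintype Ω] [Fintype Ω']

open Classical in
/-- Probability of an event under the uniform distribution. -/
noncomputable def pr (p : Ω → Prop) : ℝ := 𝔼 ω, if p ω then (1 : ℝ) else 0

theorem pr_eq_card_div (p : Ω → Prop) :
    pr p = (Nat.card {ω // p ω} : ℝ) / (Nat.card Ω : ℝ) := by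
  classical
  rw [pr, Fintype.expect_eq_sum_div_card, Finset.sum_boole, Nat.card_eq_fintype_card,
    Nat.card_eq_fintype_card, Fintype.card_subtype]

theorem pr_mono {p q : Ω → Prop} (h : ∀ ω, p ω → q ω) : pr p ≤ pr q := by
  classical
  refine Finset.expect_le_expect fun ω _ => ?_
  by_cases hp : p ω
  · simp [hp, h ω hp]
  · simp only [hp, if_false]; split_ifs <;> norm_num

theorem pr_or_le (p q : Ω → Prop) : pr (fun ω => p ω ∨ q ω) ≤ pr p + pr q := by
  classical
  rw [pr, pr, pr, ← Finset.expect_add_distrib]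
  refine Finset.expect_le_expect fun ω _ => ?_
  by_cases hp : p ω <;> by_cases hq : q ω <;> simp [hp, hq]

theorem pr_nonneg (p : Ω → Prop) : 0 ≤ pr p := by
  classical
  refine Finset.expect_nonneg fun ω _ => ?_
  split_ifs <;> norm_num

theorem pr_exists_le {ι : Type*} (s : Finset ι) (p : ι → Ω → Prop) :
    pr (fun ω => ∃ i ∈ s, p i ω) ≤ ∑ i ∈ s, pr (p i) := by
  classical
  induction s using Finset.induction_on with
  | empty => simp [pr]
  | insert a s ha ih =>
    rw [Finset.sum_insert ha]
    refine le_trans (pr_mono (q := fun ω => p a ω ∨ ∃ i ∈ s, p i ω) ?_)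
      ((pr_or_le _ _).trans (by gcongr))
    rintro ω ⟨i, hi, h⟩
    rcases Finset.mem_insert.1 hi with rfl | hi
    · exact Or.inl h
    · exact Or.inr ⟨i, hi, h⟩

theorem pr_compl [Nonempty Ω] (p : Ω → Prop) : pr (fun ω => ¬ p ω) = 1 - pr p := by
  classical
  rw [eq_sub_iff_add_eq, pr, pr, ← Finset.expect_add_distrib]
  rw [Finset.expect_congr rfl (g := fun _ => (1 : ℝ)), Fintype.expect_const]
  intro ω _
  by_cases hp : p ω <;> simp [hp]

theorem pr_le_of_expect_le {f : Ω → ℝ} (hf : ∀ ω, 0 ≤ f ω) {T M : ℝ} (hT : 0 < T)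
    (hM : 𝔼 ω, f ω ≤ M) : pr (fun ω => T < f ω) ≤ M / T := by
  classical
  rw [le_div_iff₀ hT, pr, Finset.expect_mul]
  refine le_trans (Finset.expect_le_expect fun ω _ => ?_) hM
  split_ifs with h
  · simpa using h.le
  · simpa using hf ω

theorem expect_fst [Nonempty Ω'] (f : Ω → ℝ) : 𝔼 ω : Ω × Ω', f ω.1 = 𝔼 ω, f ω := by
  rw [← Finset.univ_product_univ, Finset.expect_product]
  exact Finset.expect_congr rfl fun ω _ => Fintype.expect_const (f ω)

theorem expect_snd [Nonempty Ω'] (f : Ω → ℝ) : 𝔼 ω : Ω' × Ω, f ω.2 = 𝔼 ω, f ω := by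
  rw [← Finset.univ_product_univ, Finset.expect_product]
  exact Fintype.expect_const (ι := Ω') (𝔼 ω, f ω)

theorem pr_fst [Nonempty Ω'] (p : Ω → Prop) : pr (fun ω : Ω × Ω' => p ω.1) = pr p := by
  classical
  exact expect_fst (fun ω => if p ω then (1 : ℝ) else 0)

theorem pr_snd [Nonempty Ω'] (p : Ω → Prop) : pr (fun ω : Ω' × Ω => p ω.2) = pr p := by
  classical
  exact expect_snd (fun ω => if p ω then (1 : ℝ) else 0)

theorem expect_pi_prod (r : ℕ) (f : Ω → ℝ) :
    𝔼 ω : Fin r → Ω, ∏ i, f (ω i) = (𝔼 ω, f ω) ^ r := by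
  classical
  rw [Fintype.expect_eq_sum_div_card, Fintype.expect_eq_sum_div_card, div_pow]
  congr 1
  · have := Finset.sum_prod_piFinset (ι := Fin r) (Finset.univ : Finset Ω) (fun _ => f)
    rw [Fintype.piFinset_univ] at this
    simpa using this
  · simp

/-- If each of `r` independent trials is bad with probability at most `1 / 15`, then at least half
of them are bad with probability at most `2⁻ʳ`. -/
theorem pr_majority_le (r : ℕ) (bad : Ω → Prop) [Nonempty Ω] (h : pr bad ≤ 1 / 15) :
    pr (fun ω : Fin r → Ω => r ≤ 2 * Nat.card {i // bad (ω i)}) ≤ (1 / 2) ^ r := by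
  classical
  have key : ∀ ω : Fin r → Ω, (if r ≤ 2 * Nat.card {i // bad (ω i)} then (1 : ℝ) else 0) ≤
      (1 / 4) ^ r * ∏ i, (1 + 15 * if bad (ω i) then (1 : ℝ) else 0) := by
    intro ω
    have hprod : ∏ i, (1 + 15 * if bad (ω i) then (1 : ℝ) else 0) =
        16 ^ Nat.card {i // bad (ω i)} := by
      rw [Nat.card_eq_fintype_card, Fintype.card_subtype, ← Finset.prod_const,
        Finset.prod_filter]
      refine Finset.prod_congr rfl fun i _ => ?_
      split_ifs <;> norm_num
    rw [hprod]
    split_ifs with hr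
    · have : (16 : ℝ) ^ Nat.card {i // bad (ω i)} = 4 ^ (2 * Nat.card {i // bad (ω i)}) := by
        rw [pow_mul]; norm_num
      rw [this]
      calc (1 : ℝ) = (1 / 4) ^ r * 4 ^ r := by rw [← mul_pow]; norm_num
        _ ≤ _ := by gcongr; norm_num
    · positivity
  calc pr (fun ω : Fin r → Ω => r ≤ 2 * Nat.card {i // bad (ω i)})
      ≤ 𝔼 ω : Fin r → Ω, (1 / 4) ^ r * ∏ i, (1 + 15 * if bad (ω i) then (1 : ℝ) else 0) :=
        by
          refine Finset.expect_le_expect fun ω _ => le_trans (le_of_eq ?_) (key ω)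
          congr
    _ = (1 / 4) ^ r * (1 + 15 * pr bad) ^ r := by
        rw [← Finset.mul_expect, expect_pi_prod r (fun ω => 1 + 15 * if bad ω then (1 : ℝ) else 0),
          Finset.expect_add_distrib, Fintype.expect_const, ← Finset.mul_expect]
        rfl
    _ ≤ (1 / 4) ^ r * 2 ^ r := by
        have := pr_nonneg bad
        gcongr
        linarith
    _ = (1 / 2) ^ r := by rw [← mul_pow]; norm_num

/-- Expectation over the first and the remaining coordinates. -/
theorem expect_pi_succ (m : ℕ) (F : (Fin (m + 1) → Ω) → ℝ) :
    𝔼 ω, F ω = 𝔼 a : Ω, 𝔼 ω : Fin m → Ω, F (Fin.cons a ω) := by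
  rw [← Finset.expect_product (Finset.univ) (Finset.univ)
    (fun p : Ω × (Fin m → Ω) => F (Fin.cons p.1 p.2)), Finset.univ_product_univ]
  exact (Fintype.expect_equiv (Fin.consEquiv fun _ => Ω) _ _ fun p => rfl).symm

theorem expect_pi_sum [Nonempty Ω] (m : ℕ) (h : Ω → ℝ) :
    𝔼 ω : Fin m → Ω, ∑ c, h (ω c) = m * 𝔼 ω, h ω := by
  induction m with
  | zero => simp
  | succ m ih =>
    rw [expect_pi_succ]
    simp only [Fin.sum_univ_succ, Fin.cons_zero, Fin.cons_succ, Finset.expect_add_distrib,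
      Fintype.expect_const, ih]
    push_cast
    ring

/-- The second moment of a sum of independent centred variables. -/
theorem expect_sq_pi_sum [Nonempty Ω] (m : ℕ) (h : Ω → ℝ) (h0 : 𝔼 ω, h ω = 0) :
    𝔼 ω : Fin m → Ω, (∑ c, h (ω c)) ^ 2 = m * 𝔼 ω, h ω ^ 2 := by
  induction m with
  | zero => simp
  | succ m ih =>
    rw [expect_pi_succ]
    simp only [Fin.sum_univ_succ, Fin.cons_zero, Fin.cons_succ, add_sq,
      Finset.expect_add_distrib, Fintype.expect_const, ih, ← Finset.mul_expect, expect_pi_sum, h0]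
    push_cast
    ring_nf
    simp

/-- Chebyshev's inequality for a sum of independent variables of mean `μ`. -/
theorem pr_sum_deviation_le [Nonempty Ω] (m : ℕ) (h : Ω → ℝ) {μ V T : ℝ} (hμ : 𝔼 ω, h ω = μ)
    (hV : 𝔼 ω, h ω ^ 2 ≤ V) (hT : 0 < T) :
    pr (fun ω : Fin m → Ω => T < |∑ c, h (ω c) - m * μ|) ≤ m * V / T ^ 2 := by
  have h0 : 𝔼 ω, (h ω - μ) = 0 := by
    rw [Finset.expect_sub_distrib, hμ, Fintype.expect_const, sub_self]
  have hvar : 𝔼 ω, (h ω - μ) ^ 2 ≤ V := by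
    have : 𝔼 ω, (h ω - μ) ^ 2 = 𝔼 ω, h ω ^ 2 - μ ^ 2 := by
      simp only [sub_sq, Finset.expect_add_distrib, Finset.expect_sub_distrib,
        Fintype.expect_const, mul_assoc, ← Finset.mul_expect, ← Finset.expect_mul, hμ]
      ring
    nlinarith [sq_nonneg μ]
  refine le_trans (pr_mono (q := fun ω : Fin m → Ω => T ^ 2 < (∑ c, (h (ω c) - μ)) ^ 2) ?_)
    (pr_le_of_expect_le (fun _ => sq_nonneg _) (by positivity) ?_)
  · intro ω hω
    rw [Finset.sum_sub_distrib, Finset.sum_const, Finset.card_univ, Fintype.card_fin,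
      nsmul_eq_mul, ← sq_abs (_ - _)]
    gcongr
  · rw [expect_sq_pi_sum m _ h0]
    gcongr

end Probability

/-! ### Independence of the hash functions -/

section Hash

open Finset
open scoped BigOperators

theorem expect_comp_surjective {V W : Type*} [AddGroup V] [AddGroup W] [Fintype V] [Fintype W]
    (φ : V →+ W) (hφ : Function.Surjective φ) (H : W → ℝ) :
    𝔼 v, H (φ v) = 𝔼 w, H w := by
  classical
  have hfib : ∀ w : W, #{v | φ v = w} = #{v | φ v = 0} := fun w =>
    AddMonoidHom.card_fiber_eq_of_mem_range φ (hφ w) (hφ 0)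
  set K := #{v | φ v = 0} with hK
  have hsum : ∀ F : W → ℝ, ∑ v, F (φ v) = K * ∑ w, F w := by
    intro F
    rw [Finset.sum_comp, Finset.image_univ_of_surjective hφ, Finset.mul_sum]
    exact Finset.sum_congr rfl fun w _ => by rw [hfib w, nsmul_eq_mul]
  have hcard := hsum fun _ => 1
  simp only [Finset.sum_const, Finset.card_univ, nsmul_eq_mul, mul_one] at hcard
  have hK0 : (K : ℝ) ≠ 0 := by
    have : 0 < K := Finset.card_pos.2 ⟨0, by simp⟩
    positivity
  rw [Fintype.expect_eq_sum_div_card, Fintype.expect_eq_sum_div_card, hsum, hcard,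
    mul_div_mul_left _ _ hK0]

/-- Evaluation of the polynomials with `d` coefficients at the points `x`. -/
def polyEval {F : Type*} [Field F] {d t : ℕ} (x : Fin t → F) : (Fin d → F) →+ (Fin t → F) where
  toFun a k := ∑ j, a j * x k ^ (j : ℕ)
  map_zero' := by ext; simp
  map_add' a b := by ext; simp [add_mul, Finset.sum_add_distrib]

theorem polyEval_surjective {F : Type*} [Field F] {d t : ℕ} (hd : 0 < d) (htd : t ≤ d)
    (x : Fin t → F) (hx : Function.Injective x) :
    Function.Surjective (polyEval x : (Fin d → F) →+ (Fin t → F)) := by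
  classical
  intro y
  set p := Lagrange.interpolate Finset.univ x y with hp
  have hdeg : p.natDegree < d := by
    by_cases h0 : p = 0
    · simpa [h0] using hd
    · rw [Polynomial.natDegree_lt_iff_degree_lt h0]
      refine lt_of_lt_of_le (Lagrange.degree_interpolate_lt _ hx.injOn) ?_
      simpa using htd
  refine ⟨fun j => p.coeff j, funext fun k => ?_⟩
  have h1 := Lagrange.eval_interpolate_at_node (s := Finset.univ) y hx.injOn (Finset.mem_univ k)
  rw [← hp, Polynomial.eval_eq_sum_range' hdeg] at h1
  rw [← h1]
  exact Fin.sum_univ_eq_sum_range (fun j => p.coeff j * x k ^ j) d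

/-- `polyHash` with `d` random coefficients is `d`-wise independent. -/
theorem expect_polyHash (m : ℕ) {d t : ℕ} (hd : 0 < d) (htd : t ≤ d) (x : Fin t → ℕ)
    (hx : Function.Injective x) (hlt : ∀ k, x k < 2 ^ (m + 1)) (G : (Fin t → ℕ) → ℝ) :
    𝔼 a : Fin d → Fin (2 ^ (m + 1)), G (fun k => polyHash m a (x k)) =
      𝔼 y : Fin t → Fin (2 ^ (m + 1)), G (fun k => y k) := by
  classical
  have : Fintype (GaloisField 2 (m + 1)) := Fintype.ofFinite _
  let e := fieldEquiv m
  let z : Fin t → GaloisField 2 (m + 1) := fun k => e.symm (Fin.ofNat (2 ^ (m + 1)) (x k))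
  have hz : Function.Injective z := by
    intro k l h
    have h := Fin.ext_iff.1 (e.symm.injective h)
    simp only [Fin.ofNat, Nat.mod_eq_of_lt (hlt _)] at h
    exact hx h
  let H : (Fin t → GaloisField 2 (m + 1)) → ℝ := fun y => G fun k => (e (y k) : ℕ)
  calc 𝔼 a : Fin d → Fin (2 ^ (m + 1)), G (fun k => polyHash m a (x k))
      = 𝔼 b : Fin d → GaloisField 2 (m + 1), H (polyEval z b) :=
        Fintype.expect_equiv (Equiv.arrowCongr (Equiv.refl _) e.symm) _ _ fun a => rfl
    _ = 𝔼 y, H y := expect_comp_surjective _ (polyEval_surjective hd htd z hz) H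
    _ = _ := Fintype.expect_equiv (Equiv.arrowCongr (Equiv.refl _) e) _ _ fun a => rfl

/-- The sign of a hash value. -/
def paritySign (y : ℕ) : ℝ := if y % 2 = 0 then 1 else -1

theorem paritySign_mul_self (y : ℕ) : paritySign y * paritySign y = 1 := by
  unfold paritySign; split_ifs <;> norm_num

theorem signHash_cast (m : ℕ) {d : ℕ} (a : Fin d → Fin (2 ^ (m + 1))) (x : ℕ) :
    ((signHash m a x : ℤ) : ℝ) = paritySign (polyHash m a x) := by
  unfold signHash paritySign; split_ifs <;> norm_num

theorem sum_range_paritySign (k : ℕ) : ∑ y ∈ Finset.range (2 * k), paritySign y = 0 := by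
  induction k with
  | zero => simp
  | succ k ih =>
    rw [show 2 * (k + 1) = 2 * k + 1 + 1 by ring, Finset.sum_range_succ, Finset.sum_range_succ, ih]
    have h1 : (2 * k) % 2 = 0 := by omega
    simp [paritySign, h1]

theorem expect_prod_paritySign (m : ℕ) {t : ℕ} (ht : 0 < t) :
    𝔼 y : Fin t → Fin (2 ^ (m + 1)), ∏ k, paritySign (y k) = 0 := by
  rw [expect_pi_prod t (fun y : Fin (2 ^ (m + 1)) => paritySign y),
    Fintype.expect_eq_sum_div_card, Fin.sum_univ_eq_sum_range (fun y => paritySign y), pow_succ',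
    sum_range_paritySign, zero_div, zero_pow ht.ne']

/-- The random signs at at most `d` distinct points are uncorrelated. -/
theorem expect_prod_signHash (m : ℕ) {d t : ℕ} (ht : 0 < t) (htd : t ≤ d) (x : Fin t → ℕ)
    (hx : Function.Injective x) (hlt : ∀ k, x k < 2 ^ (m + 1)) :
    𝔼 a : Fin d → Fin (2 ^ (m + 1)), ∏ k, ((signHash m a (x k) : ℤ) : ℝ) = 0 := by
  simp only [signHash_cast]
  rw [expect_polyHash m (ht.trans_le htd) htd x hx hlt fun y => ∏ k, paritySign (y k)]
  exact expect_prod_paritySign m ht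

theorem signHash_mul_self (m : ℕ) {d : ℕ} (a : Fin d → Fin (2 ^ (m + 1))) (x : ℕ) :
    ((signHash m a x : ℤ) : ℝ) * ((signHash m a x : ℤ) : ℝ) = 1 := by
  rw [signHash_cast, paritySign_mul_self]

theorem expect_signHash_mul (m : ℕ) {d : ℕ} (hd : 2 ≤ d) {x y : ℕ} (hxy : x ≠ y)
    (hx : x < 2 ^ (m + 1)) (hy : y < 2 ^ (m + 1)) :
    𝔼 a : Fin d → Fin (2 ^ (m + 1)),
      ((signHash m a x : ℤ) : ℝ) * ((signHash m a y : ℤ) : ℝ) = 0 := by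
  have := expect_prod_signHash m (d := d) (t := 2) (by norm_num) hd ![x, y]
    (by intro i j; fin_cases i <;> fin_cases j <;> simp [hxy, hxy.symm])
    (by intro k; fin_cases k <;> simp [hx, hy])
  simpa [Fin.prod_univ_two] using this

theorem expect_signHash_mul_four (m : ℕ) {d : ℕ} (hd : 4 ≤ d) {x y z w : ℕ} (hxy : x ≠ y)
    (hxz : x ≠ z) (hxw : x ≠ w) (hyz : y ≠ z) (hyw : y ≠ w) (hzw : z ≠ w)
    (hx : x < 2 ^ (m + 1)) (hy : y < 2 ^ (m + 1)) (hz : z < 2 ^ (m + 1)) (hw : w < 2 ^ (m + 1)) :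
    𝔼 a : Fin d → Fin (2 ^ (m + 1)), ((signHash m a x : ℤ) : ℝ) * ((signHash m a y : ℤ) : ℝ) *
      ((signHash m a z : ℤ) : ℝ) * ((signHash m a w : ℤ) : ℝ) = 0 := by
  have := expect_prod_signHash m (d := d) (t := 4) (by norm_num) hd ![x, y, z, w]
    (by intro i j; fin_cases i <;> fin_cases j <;>
          simp [hxy, hxz, hxw, hyz, hyw, hzw, hxy.symm, hxz.symm, hxw.symm, hyz.symm, hyw.symm,
            hzw.symm])
    (by intro k; fin_cases k <;> simp [hx, hy, hz, hw])
  simpa [Fin.prod_univ_four] using this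

theorem card_mod_eq (e k c : ℕ) (hc : c < 2 ^ e) :
    #{y ∈ Finset.range (2 ^ e * k) | y % 2 ^ e = c} = k := by
  have h : Finset.filter (fun y => y % 2 ^ e = c) (Finset.range (2 ^ e * k)) =
      (Finset.range k).image fun j => 2 ^ e * j + c := by
    ext y
    simp only [Finset.mem_filter, Finset.mem_range, Finset.mem_image]
    constructor
    · rintro ⟨h1, h2⟩
      exact ⟨y / 2 ^ e, Nat.div_lt_of_lt_mul h1, by rw [← h2]; exact Nat.div_add_mod y _⟩
    · rintro ⟨j, hj, rfl⟩
      refine ⟨?_, by rw [Nat.mul_add_mod, Nat.mod_eq_of_lt hc]⟩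
      calc 2 ^ e * j + c < 2 ^ e * (j + 1) := by rw [mul_add]; omega
        _ ≤ 2 ^ e * k := Nat.mul_le_mul_left _ hj
  rw [h, Finset.card_image_of_injective, Finset.card_range]
  intro i j hij
  simpa using hij

/-- Two distinct points collide with probability `2⁻ᵉ`. -/
theorem expect_cellHash_eq (m e : ℕ) (he : e ≤ m + 1) {d : ℕ} (hd : 2 ≤ d) {x y : ℕ} (hxy : x ≠ y)
    (hx : x < 2 ^ (m + 1)) (hy : y < 2 ^ (m + 1)) :
    𝔼 a : Fin d → Fin (2 ^ (m + 1)), (if cellHash m e a x = cellHash m e a y then (1 : ℝ) else 0) =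
      1 / 2 ^ e := by
  have h := expect_polyHash m (d := d) (t := 2) (by omega) hd ![x, y]
    (by intro i j; fin_cases i <;> fin_cases j <;> simp [hxy, hxy.symm])
    (by intro k; fin_cases k <;> simp [hx, hy])
    (fun v => if v 0 % 2 ^ e = v 1 % 2 ^ e then (1 : ℝ) else 0)
  simp only [Matrix.cons_val_zero, Matrix.cons_val_one] at h
  refine (Finset.expect_congr rfl fun a _ => if_congr ?_ rfl rfl).trans (h.trans ?_)
  · simp only [cellHash, Fin.ofNat, Fin.mk.injEq]
  rw [← Fintype.expect_equiv (finTwoArrowEquiv (Fin (2 ^ (m + 1)))).symm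
    (fun p => if (p.1 : ℕ) % 2 ^ e = (p.2 : ℕ) % 2 ^ e then (1 : ℝ) else 0) _ (fun p => by simp),
    ← Finset.univ_product_univ, Finset.expect_product]
  have hin : ∀ p : Fin (2 ^ (m + 1)), 𝔼 q : Fin (2 ^ (m + 1)),
      (if (p : ℕ) % 2 ^ e = (q : ℕ) % 2 ^ e then (1 : ℝ) else 0) = 1 / 2 ^ e := by
    intro p
    rw [Fintype.expect_eq_sum_div_card,
      Fin.sum_univ_eq_sum_range (fun q => if (p : ℕ) % 2 ^ e = q % 2 ^ e then (1 : ℝ) else 0),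
      Finset.sum_boole]
    obtain ⟨k, hk⟩ : ∃ k, m + 1 = e + k := ⟨m + 1 - e, by omega⟩
    have := card_mod_eq e (2 ^ k) ((p : ℕ) % 2 ^ e) (Nat.mod_lt _ (by positivity))
    rw [← pow_add, ← hk] at this
    simp only [eq_comm (a := (p : ℕ) % 2 ^ e)]
    rw [this, Fintype.card_fin, hk]
    push_cast
    rw [pow_add]
    field_simp
  simp only [hin]
  exact Fintype.expect_const _

end Hash

/-! ### Moments of the sketches -/

section Moments

open Finset
open scoped BigOperators

/-- The sum of the random signs, weighted by `f`. -/
noncomputable def signedSum (m : ℕ) {u d : ℕ} (a : Fin d → Fin (2 ^ (m + 1))) (f : Fin u → ℝ) :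
    ℝ := ∑ i, f i * ((signHash m a (i : ℕ) : ℤ) : ℝ)

variable {m u d : ℕ}

theorem expect_sign_mul (hu : u ≤ 2 ^ (m + 1)) (hd : 2 ≤ d) (i j : Fin u) :
    𝔼 a : Fin d → Fin (2 ^ (m + 1)), ((signHash m a (i : ℕ) : ℤ) : ℝ) *
      ((signHash m a (j : ℕ) : ℤ) : ℝ) = if i = j then 1 else 0 := by
  split_ifs with h
  · subst h
    simp only [signHash_mul_self]
    exact Fintype.expect_const _
  · exact expect_signHash_mul m hd (fun e => h (Fin.ext e)) (by omega) (by omega)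

theorem expect_sign_mul_four_le (hu : u ≤ 2 ^ (m + 1)) (hd : 4 ≤ d) (i j k l : Fin u) :
    𝔼 a : Fin d → Fin (2 ^ (m + 1)), ((signHash m a (i : ℕ) : ℤ) : ℝ) *
      ((signHash m a (j : ℕ) : ℤ) : ℝ) * ((signHash m a (k : ℕ) : ℤ) : ℝ) *
      ((signHash m a (l : ℕ) : ℤ) : ℝ) ≤
      (if i = j then if k = l then 1 else 0 else 0) + (if i = k then if j = l then 1 else 0 else 0)
        + (if i = l then if j = k then 1 else 0 else 0) := by
  have h2 := fun i j => expect_sign_mul (m := m) (u := u) (d := d) hu (by omega) i j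
  have sq := fun (a : Fin d → Fin (2 ^ (m + 1))) (i : Fin u) => signHash_mul_self m a (i : ℕ)
  by_cases hij : i = j
  · subst hij
    simp only [sq, one_mul, h2]
    split_ifs <;> norm_num
  by_cases hik : i = k
  · subst hik
    have : ∀ a : Fin d → Fin (2 ^ (m + 1)), ((signHash m a (i : ℕ) : ℤ) : ℝ) *
      ((signHash m a (j : ℕ) : ℤ) : ℝ) * ((signHash m a (i : ℕ) : ℤ) : ℝ) *
      ((signHash m a (l : ℕ) : ℤ) : ℝ) = ((signHash m a (j : ℕ) : ℤ) : ℝ) *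
      ((signHash m a (l : ℕ) : ℤ) : ℝ) := fun a => by
        linear_combination ((signHash m a (j : ℕ) : ℤ) : ℝ) * ((signHash m a (l : ℕ) : ℤ) : ℝ) *
          sq a i
    simp only [this, h2]
    split_ifs <;> norm_num
  by_cases hil : i = l
  · subst hil
    have : ∀ a : Fin d → Fin (2 ^ (m + 1)), ((signHash m a (i : ℕ) : ℤ) : ℝ) *
      ((signHash m a (j : ℕ) : ℤ) : ℝ) * ((signHash m a (k : ℕ) : ℤ) : ℝ) *
      ((signHash m a (i : ℕ) : ℤ) : ℝ) = ((signHash m a (j : ℕ) : ℤ) : ℝ) *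
      ((signHash m a (k : ℕ) : ℤ) : ℝ) := fun a => by
        linear_combination ((signHash m a (j : ℕ) : ℤ) : ℝ) * ((signHash m a (k : ℕ) : ℤ) : ℝ) *
          sq a i
    simp only [this, h2]
    split_ifs <;> norm_num
  simp only [hij, hik, hil, if_false, add_zero]
  refine le_of_eq ?_
  by_cases hjk : j = k
  · subst hjk
    simp only [mul_assoc]
    simp only [← mul_assoc (((signHash m _ (j : ℕ) : ℤ) : ℝ)) (((signHash m _ (j : ℕ) : ℤ) : ℝ)),
      sq, one_mul, h2, hil, if_false]
  by_cases hjl : j = l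
  · subst hjl
    have : ∀ a : Fin d → Fin (2 ^ (m + 1)), ((signHash m a (i : ℕ) : ℤ) : ℝ) *
      ((signHash m a (j : ℕ) : ℤ) : ℝ) * ((signHash m a (k : ℕ) : ℤ) : ℝ) *
      ((signHash m a (j : ℕ) : ℤ) : ℝ) = ((signHash m a (i : ℕ) : ℤ) : ℝ) *
      ((signHash m a (k : ℕ) : ℤ) : ℝ) := fun a => by
        linear_combination ((signHash m a (i : ℕ) : ℤ) : ℝ) * ((signHash m a (k : ℕ) : ℤ) : ℝ) *
          sq a j
    simp only [this, h2, hik, if_false]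
  by_cases hkl : k = l
  · subst hkl
    have : ∀ a : Fin d → Fin (2 ^ (m + 1)), ((signHash m a (i : ℕ) : ℤ) : ℝ) *
      ((signHash m a (j : ℕ) : ℤ) : ℝ) * ((signHash m a (k : ℕ) : ℤ) : ℝ) *
      ((signHash m a (k : ℕ) : ℤ) : ℝ) = ((signHash m a (i : ℕ) : ℤ) : ℝ) *
      ((signHash m a (j : ℕ) : ℤ) : ℝ) := fun a => by
        linear_combination ((signHash m a (i : ℕ) : ℤ) : ℝ) * ((signHash m a (j : ℕ) : ℤ) : ℝ) *
          sq a k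
    simp only [this, h2, hij, if_false]
  exact expect_signHash_mul_four m hd (fun e => hij (Fin.ext e)) (fun e => hik (Fin.ext e))
    (fun e => hil (Fin.ext e)) (fun e => hjk (Fin.ext e)) (fun e => hjl (Fin.ext e))
    (fun e => hkl (Fin.ext e)) (by omega) (by omega) (by omega) (by omega)

theorem expect_signedSum_mul (hu : u ≤ 2 ^ (m + 1)) (hd : 2 ≤ d) (f g : Fin u → ℝ) :
    𝔼 a : Fin d → Fin (2 ^ (m + 1)), signedSum m a f * signedSum m a g = ∑ i, f i * g i := by
  simp only [signedSum, Finset.sum_mul_sum, Finset.expect_sum_comm]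
  refine Finset.sum_congr rfl fun i _ => ?_
  have : ∀ j, 𝔼 a : Fin d → Fin (2 ^ (m + 1)), (f i * ((signHash m a (i : ℕ) : ℤ) : ℝ)) *
      (g j * ((signHash m a (j : ℕ) : ℤ) : ℝ)) = f i * g j * if i = j then 1 else 0 := by
    intro j
    rw [← expect_sign_mul (d := d) hu hd, Finset.mul_expect]
    exact Finset.expect_congr rfl fun a _ => by ring
  simp [this]

theorem expect_sq_signedSum_mul_le (hu : u ≤ 2 ^ (m + 1)) (hd : 4 ≤ d) {f g : Fin u → ℝ}
    (hf : ∀ i, 0 ≤ f i) (hg : ∀ i, 0 ≤ g i) :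
    𝔼 a : Fin d → Fin (2 ^ (m + 1)), (signedSum m a f * signedSum m a g) ^ 2 ≤
      3 * ((∑ i, f i ^ 2) * ∑ i, g i ^ 2) := by
  have hexp : ∀ a : Fin d → Fin (2 ^ (m + 1)), (signedSum m a f * signedSum m a g) ^ 2 =
      ∑ i, ∑ j, ∑ k, ∑ l, f i * f j * g k * g l * (((signHash m a (i : ℕ) : ℤ) : ℝ) *
      ((signHash m a (j : ℕ) : ℤ) : ℝ) * ((signHash m a (k : ℕ) : ℤ) : ℝ) *
      ((signHash m a (l : ℕ) : ℤ) : ℝ)) := by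
    intro a
    rw [mul_pow, sq, sq, signedSum, signedSum, Finset.sum_mul_sum, Finset.sum_mul_sum]
    simp only [Finset.sum_mul]
    simp only [Finset.mul_sum]
    refine Finset.sum_congr rfl fun i _ => Finset.sum_congr rfl fun j _ =>
      Finset.sum_congr rfl fun k _ => Finset.sum_congr rfl fun l _ => by ring
  simp only [hexp, Finset.expect_sum_comm, ← Finset.mul_expect]
  have hcs : (∑ i, f i * g i) ^ 2 ≤ (∑ i, f i ^ 2) * ∑ i, g i ^ 2 :=
    Finset.sum_mul_sq_le_sq_mul_sq _ _ _
  calc _ ≤ ∑ i, ∑ j, ∑ k, ∑ l, f i * f j * g k * g l *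
        ((if i = j then if k = l then 1 else 0 else 0) +
          (if i = k then if j = l then 1 else 0 else 0)
        + (if i = l then if j = k then 1 else 0 else 0)) := by
        gcongr with i _ j _ k _ l _
        · exact mul_nonneg (mul_nonneg (mul_nonneg (hf i) (hf j)) (hg k)) (hg l)
        · exact expect_sign_mul_four_le hu hd i j k l
    _ = (∑ i, f i ^ 2) * (∑ i, g i ^ 2) + 2 * (∑ i, f i * g i) ^ 2 := by
        simp only [mul_add, Finset.sum_add_distrib]
        rw [two_mul, ← add_assoc]
        congr 1
        · congr 1
          · simp only [mul_ite, mul_zero, mul_one, Finset.sum_ite_irrel, Finset.sum_const_zero,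
              Finset.sum_ite_eq, Finset.mem_univ, if_true, Finset.sum_mul_sum]
            exact Finset.sum_congr rfl fun i _ => Finset.sum_congr rfl fun j _ => by ring
          · simp only [mul_ite, mul_zero, mul_one, Finset.sum_ite_irrel, Finset.sum_const_zero,
              Finset.sum_ite_eq, Finset.mem_univ, if_true, sq, Finset.sum_mul_sum]
            exact Finset.sum_congr rfl fun i _ => Finset.sum_congr rfl fun j _ => by ring
        · simp only [mul_ite, mul_zero, mul_one, Finset.sum_ite_eq, Finset.mem_univ, if_true, sq,
            Finset.sum_mul_sum]
          exact Finset.sum_congr rfl fun i _ => Finset.sum_congr rfl fun j _ => by ring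
    _ ≤ _ := by linarith

/-- The estimate of `n q` by a single row of CountSketch, for the frequency vector `n`. -/
noncomputable def rowEstimate (m e : ℕ) {u d : ℕ}
    (ab : (Fin d → Fin (2 ^ (m + 1))) × (Fin d → Fin (2 ^ (m + 1)))) (n : Fin u → ℝ) (q : Fin u) :
    ℝ :=
  ((signHash m ab.2 (q : ℕ) : ℤ) : ℝ) * signedSum m ab.2 fun j =>
    if cellHash m e ab.1 (j : ℕ) = cellHash m e ab.1 (q : ℕ) then n j else 0

theorem expect_sq_rowEstimate_sub_le {e : ℕ} (he : e ≤ m + 1) (hu : u ≤ 2 ^ (m + 1)) (hd : 2 ≤ d)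
    (n : Fin u → ℝ) (q : Fin u) :
    𝔼 ab : (Fin d → Fin (2 ^ (m + 1))) × (Fin d → Fin (2 ^ (m + 1))),
      (rowEstimate m e ab n q - n q) ^ 2 ≤ (∑ i, n i ^ 2) / 2 ^ e := by
  let c : (Fin d → Fin (2 ^ (m + 1))) → Fin u → ℝ := fun a j =>
    if cellHash m e a (j : ℕ) = cellHash m e a (q : ℕ) then 1 else 0
  let w : (Fin d → Fin (2 ^ (m + 1))) → Fin u → ℝ := fun a j => if j = q then 0 else n j * c a j
  have key : ∀ a b, (rowEstimate m e (a, b) n q - n q) ^ 2 =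
      signedSum m b (w a) * signedSum m b (w a) := by
    intro a b
    have h1 : rowEstimate m e (a, b) n q =
        ((signHash m b (q : ℕ) : ℤ) : ℝ) * signedSum m b (w a) + n q := by
      have h2 : signedSum m b (fun j =>
          if cellHash m e a (j : ℕ) = cellHash m e a (q : ℕ) then n j else 0) =
          signedSum m b (w a) + n q * ((signHash m b (q : ℕ) : ℤ) : ℝ) := by
        simp only [signedSum]
        rw [← Finset.add_sum_erase _ _ (Finset.mem_univ q),
          ← Finset.add_sum_erase (f := fun i => w a i * _) _ (Finset.mem_univ q)]
        simp only [w, if_true, zero_mul, zero_add]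
        rw [add_comm]
        congr 1
        refine Finset.sum_congr rfl fun j hj => ?_
        simp [Finset.ne_of_mem_erase hj, c]
      rw [rowEstimate, h2]
      linear_combination n q * signHash_mul_self m b (q : ℕ)
    rw [h1, add_sub_cancel_right]
    linear_combination (signedSum m b (w a)) ^ 2 * signHash_mul_self m b (q : ℕ)
  rw [← Finset.univ_product_univ, Finset.expect_product]
  simp only [key, expect_signedSum_mul hu hd, Finset.expect_sum_comm, Finset.sum_div]
  refine Finset.sum_le_sum fun j _ => ?_
  by_cases hj : j = q
  · simp only [w, hj, if_true, mul_zero, Finset.expect_const_zero]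
    positivity
  · have h3 : ∀ a, w a j * w a j = n j ^ 2 * c a j := by
      intro a
      simp only [w, hj, if_false, c]
      split_ifs <;> ring
    simp only [h3, ← Finset.mul_expect, c]
    rw [expect_cellHash_eq m e he hd (fun e => hj (Fin.ext e)) (by omega) (by omega)]
    exact le_of_eq (by ring)

end Moments

/-! ### Medians -/

section Median

theorem countP_ofFn_eq_card {r : ℕ} (f : Fin r → ℤ) (p : ℤ → Prop) [DecidablePred p] :
    (List.ofFn f).countP p = Nat.card {i // p (f i)} := by
  rw [Nat.card_eq_fintype_card, Fintype.card_subtype, List.ofFn_eq_map, List.countP_map]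
  simp only [Finset.card_def, Finset.filter_val, Fin.univ_def,
    Multiset.filter_coe, Multiset.coe_card, List.countP_eq_length_filter]
  rfl

theorem median_eq_getElem {r : ℕ} (f : Fin r → ℤ) (hr : 0 < r) :
    median f = ((List.ofFn f).insertionSort (· ≤ ·))[r / 2]'(by simp; omega) := by
  rw [median, List.getD_eq_getElem]

theorem countP_insertionSort_eq_card {r : ℕ} (f : Fin r → ℤ) (p : ℤ → Prop) [DecidablePred p] :
    ((List.ofFn f).insertionSort (· ≤ ·)).countP p = Nat.card {i // p (f i)} := by
  rw [(List.perm_insertionSort (· ≤ ·) (List.ofFn f)).countP_eq, countP_ofFn_eq_card]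

/-- If less than half of the values are outside an interval, the median is inside. -/
theorem median_mem_Icc {r : ℕ} (f : Fin r → ℤ) {lo hi : ℝ}
    (h : 2 * Nat.card {i // ¬ (lo ≤ (f i : ℝ) ∧ (f i : ℝ) ≤ hi)} < r) :
    lo ≤ (median f : ℝ) ∧ (median f : ℝ) ≤ hi := by
  classical
  have hr : 0 < r := by omega
  set s := (List.ofFn f).insertionSort (· ≤ ·) with hs
  have hlen : s.length = r := by simp [hs]
  have hsort : s.Pairwise (· ≤ ·) := List.pairwise_insertionSort _ _
  have hk : r / 2 < s.length := by omega
  have hmono : ∀ i (hi : i < s.length) j (hj : j < s.length), i ≤ j → s[i] ≤ s[j] := by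
    intro i hi j hj hij
    rcases hij.eq_or_lt with rfl | hlt
    · exact le_rfl
    · exact List.pairwise_iff_getElem.1 hsort i j hi hj hlt
  have hcount := countP_insertionSort_eq_card f fun z : ℤ => ¬ (lo ≤ (z : ℝ) ∧ (z : ℝ) ≤ hi)
  rw [← hs] at hcount
  rw [median_eq_getElem f hr]
  by_contra hcon
  rw [not_and_or, not_le, not_le] at hcon
  rcases hcon with hcon | hcon
  · have h1 : (s.take (r / 2 + 1)).countP (fun z : ℤ => ¬ (lo ≤ (z : ℝ) ∧ (z : ℝ) ≤ hi)) =
        (s.take (r / 2 + 1)).length := by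
      rw [List.countP_eq_length]
      intro z hz
      obtain ⟨i, hi, rfl⟩ := List.mem_take_iff_getElem.1 hz
      have : s[i] ≤ s[r / 2] := hmono _ _ _ _ (by omega)
      have : ((s[i] : ℤ) : ℝ) ≤ s[r / 2] := by exact_mod_cast this
      simp only [decide_eq_true_eq, not_and_or, not_le]
      exact Or.inl (this.trans_lt hcon)
    have h2 := (List.take_sublist (r / 2 + 1) s).countP_le
      (p := fun z : ℤ => decide (¬ (lo ≤ (z : ℝ) ∧ (z : ℝ) ≤ hi)))
    rw [h1, List.length_take] at h2
    omega
  · have h1 : (s.drop (r / 2)).countP (fun z : ℤ => ¬ (lo ≤ (z : ℝ) ∧ (z : ℝ) ≤ hi)) =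
        (s.drop (r / 2)).length := by
      rw [List.countP_eq_length]
      intro z hz
      obtain ⟨i, hi, rfl⟩ := List.mem_drop_iff_getElem.1 hz
      have : s[r / 2] ≤ s[i + r / 2] := hmono _ _ _ _ (by omega)
      have : ((s[r / 2] : ℤ) : ℝ) ≤ s[i + r / 2] := by exact_mod_cast this
      simp only [decide_eq_true_eq, not_and_or, not_le]
      exact Or.inr (lt_of_lt_of_le hcon (by simpa [add_comm] using this))
    have h2 := (List.drop_sublist (r / 2) s).countP_le
      (p := fun z : ℤ => decide (¬ (lo ≤ (z : ℝ) ∧ (z : ℝ) ≤ hi)))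
    rw [h1, List.length_drop] at h2
    omega

theorem abs_median_le {r : ℕ} (f : Fin r → ℤ) {B : ℤ} (hB : 0 ≤ B) (h : ∀ i, |f i| ≤ B) :
    |median f| ≤ B := by
  rw [median]
  by_cases hlt : r / 2 < ((List.ofFn f).insertionSort (· ≤ ·)).length
  · rw [List.getD_eq_getElem _ _ hlt]
    have := List.getElem_mem hlt
    rw [List.mem_insertionSort, List.mem_ofFn] at this
    obtain ⟨i, hi⟩ := this
    rw [← hi]
    exact h i
  · rw [List.getD_eq_default _ _ (by omega)]
    simpa using hB

end Median

/-! ### Segments of the stream -/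

section Segments

variable {u : ℕ} (x : ℕ → Fin u)

theorem freq_succ {a t : ℕ} (h : a ≤ t) (i : Fin u) :
    freq x a (t + 1) i = freq x a t i + if i = x t then 1 else 0 := by
  have : Finset.Ico a (t + 1) = insert t (Finset.Ico a t) := by
    ext j; simp only [Finset.mem_Ico, Finset.mem_insert]; omega
  rw [freq, freq, this, Finset.filter_insert]
  by_cases hi : i = x t
  · rw [if_pos hi.symm, if_pos hi, Finset.card_insert_of_notMem (by simp)]
  · rw [if_neg (Ne.symm hi), if_neg hi, add_zero]

theorem freq_of_le {a t : ℕ} (h : t ≤ a) (i : Fin u) : freq x a t i = 0 := by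
  simp [freq, Finset.Ico_eq_empty_of_le h]

theorem freq_add {a b t : ℕ} (hab : a ≤ b) (hbt : b ≤ t) (i : Fin u) :
    freq x a t i = freq x a b i + freq x b t i := by
  rw [freq, freq, freq, ← Finset.Ico_union_Ico_eq_Ico hab hbt, Finset.filter_union,
    Finset.card_union_of_disjoint]
  exact Finset.disjoint_filter_filter (Finset.Ico_disjoint_Ico_consecutive a b t)

theorem sum_freq (a t : ℕ) : ∑ i, freq x a t i = t - a := by
  have := Finset.card_eq_sum_card_fiberwise (f := x) (s := Finset.Ico a t) (t := Finset.univ)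
    (fun _ _ => Finset.mem_univ _)
  rw [Nat.card_Ico] at this
  exact this.symm

/-- The frequency vector of a segment. -/
def freqVec (a t : ℕ) (i : Fin u) : ℝ := freq x a t i

/-- The square of the second frequency norm of a segment. -/
noncomputable def segF2 (a t : ℕ) : ℝ := ∑ i, freqVec x a t i ^ 2

theorem freqVec_nonneg (a t : ℕ) (i : Fin u) : 0 ≤ freqVec x a t i := Nat.cast_nonneg _

theorem freqVec_add {a b t : ℕ} (hab : a ≤ b) (hbt : b ≤ t) (i : Fin u) :
    freqVec x a t i = freqVec x a b i + freqVec x b t i := by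
  simp only [freqVec, freq_add x hab hbt, Nat.cast_add]

theorem segF2_nonneg (a t : ℕ) : 0 ≤ segF2 x a t := Finset.sum_nonneg fun _ _ => sq_nonneg _

theorem length_le_segF2 (a t : ℕ) : ((t - a : ℕ) : ℝ) ≤ segF2 x a t := by
  rw [← sum_freq x, Nat.cast_sum]
  refine Finset.sum_le_sum fun i _ => ?_
  have : freq x a t i ≤ freq x a t i ^ 2 := Nat.le_self_pow (by norm_num) _
  rw [freqVec]
  exact_mod_cast this

theorem segF2_pos {a t : ℕ} (h : a < t) : 0 < segF2 x a t := by
  refine lt_of_lt_of_le ?_ (length_le_segF2 x a t)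
  exact_mod_cast Nat.sub_pos_of_lt h

theorem segF2_le_length_sq (a t : ℕ) : segF2 x a t ≤ ((t - a : ℕ) : ℝ) ^ 2 := by
  have h : ((t - a : ℕ) : ℝ) = ∑ i, freqVec x a t i := by
    rw [← sum_freq x, Nat.cast_sum]; rfl
  rw [h]
  exact Finset.sum_sq_le_sq_sum_of_nonneg fun i _ => freqVec_nonneg x a t i

theorem segF2_add_le {a b t : ℕ} (hab : a ≤ b) (hbt : b ≤ t) :
    segF2 x a b + segF2 x b t ≤ segF2 x a t := by
  rw [segF2, segF2, segF2, ← Finset.sum_add_distrib]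
  refine Finset.sum_le_sum fun i _ => ?_
  rw [freqVec_add x hab hbt]
  nlinarith [mul_nonneg (freqVec_nonneg x a b i) (freqVec_nonneg x b t i)]

theorem segF2_mono_right {a b t : ℕ} (hab : a ≤ b) (hbt : b ≤ t) : segF2 x a b ≤ segF2 x a t := by
  linarith [segF2_add_le x hab hbt, segF2_nonneg x b t]

theorem segF2_mono_left {a b t : ℕ} (hab : a ≤ b) (hbt : b ≤ t) : segF2 x b t ≤ segF2 x a t := by
  linarith [segF2_add_le x hab hbt, segF2_nonneg x a b]

/-- Triangle inequality for the second frequency norm. -/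
theorem sqrt_segF2_le_add {a b t : ℕ} (hab : a ≤ b) (hbt : b ≤ t) :
    √(segF2 x a t) ≤ √(segF2 x a b) + √(segF2 x b t) := by
  have h1 := segF2_nonneg x a b
  have h2 := segF2_nonneg x b t
  have hcs : ∑ i, freqVec x a b i * freqVec x b t i ≤ √(segF2 x a b) * √(segF2 x b t) := by
    rw [← Real.sqrt_mul h1]
    exact Real.le_sqrt_of_sq_le (Finset.sum_mul_sq_le_sq_mul_sq _ _ _)
  have hexp : segF2 x a t = segF2 x a b + segF2 x b t +
      2 * ∑ i, freqVec x a b i * freqVec x b t i := by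
    rw [segF2, segF2, segF2, Finset.mul_sum, ← Finset.sum_add_distrib, ← Finset.sum_add_distrib]
    exact Finset.sum_congr rfl fun i _ => by rw [freqVec_add x hab hbt]; ring
  rw [Real.sqrt_le_left (by positivity), hexp]
  nlinarith [Real.sq_sqrt h1, Real.sq_sqrt h2]

theorem freqVec_le_sqrt_segF2 (a t : ℕ) (i : Fin u) : freqVec x a t i ≤ √(segF2 x a t) :=
  Real.le_sqrt_of_sq_le
    (Finset.single_le_sum (f := fun i => freqVec x a t i ^ 2) (fun _ _ => sq_nonneg _)
      (Finset.mem_univ i))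

end Segments

/-! ### The bucket of a segment -/

section BucketAt

variable {P : Params} (ω : P.Seed) (x : ℕ → Fin P.u)

/-- The bucket of the segment of the stream made of the elements with index in `[a, t)`. -/
noncomputable def bucketAt (a : ℕ) : ℕ → Bucket P
  | 0 => Bucket.empty P
  | t + 1 => if a ≤ t then Bucket.add ω (x t) (bucketAt a t) else Bucket.empty P

theorem bucketAt_succ {a t : ℕ} (h : a ≤ t) :
    bucketAt ω x a (t + 1) = Bucket.add ω (x t) (bucketAt ω x a t) := by
  rw [bucketAt, if_pos h]

theorem bucketAt_of_le {a t : ℕ} (h : t ≤ a) : bucketAt ω x a t = Bucket.empty P := by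
  cases t with
  | zero => rfl
  | succ t => rw [bucketAt, if_neg (by omega)]

/-- A property of the empty bucket that is preserved by arrivals holds for all segments. -/
theorem bucketAt_induction (a : ℕ) (p : ℕ → Bucket P → Prop) (h0 : p a (Bucket.empty P))
    (hs : ∀ t, a ≤ t → p t (bucketAt ω x a t) → p (t + 1) (Bucket.add ω (x t) (bucketAt ω x a t)))
    {t : ℕ} (h : a ≤ t) : p t (bucketAt ω x a t) := by
  induction t, h using Nat.le_induction with
  | base => rwa [bucketAt_of_le ω x le_rfl]
  | succ t h ih => rw [bucketAt_succ ω x h]; exact hs t h ih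

theorem bucketAt_size (a t : ℕ) : (bucketAt ω x a t).size = t - a := by
  rcases le_total t a with h | h
  · rw [bucketAt_of_le ω x h]; simp [Bucket.empty]; omega
  · refine bucketAt_induction ω x a (fun t A => A.size = t - a) (by simp [Bucket.empty]) ?_ h
    intro t ht ih
    simp only [Bucket.add, ih]
    omega

theorem bucketAt_l2 {a t : ℕ} (h : a ≤ t) (r : Fin P.rows) (c : Fin P.cols) :
    (((bucketAt ω x a t).l2 r c : ℤ) : ℝ) = signedSum P.hashBits (ω.2 r c) (freqVec x a t) := by
  refine bucketAt_induction ω x a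
    (fun t A => ((A.l2 r c : ℤ) : ℝ) = signedSum P.hashBits (ω.2 r c) (freqVec x a t)) ?_ ?_ h
  · simp [Bucket.empty, signedSum, freqVec, freq_of_le]
  · intro t ht ih
    simp only [Bucket.add, l2Add, Int.cast_add, ih, signedSum, freqVec, freq_succ x ht]
    simp [add_mul, Finset.sum_add_distrib]

theorem bucketAt_cs {a t : ℕ} (h : a ≤ t) (r : Fin P.rows) (c : Fin (2 ^ P.cellBits)) :
    (((bucketAt ω x a t).cs r c : ℤ) : ℝ) = signedSum P.hashBits (ω.1 r).2
      fun j => if csCell P ω r j = c then freqVec x a t j else 0 := by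
  refine bucketAt_induction ω x a
    (fun t A => ((A.cs r c : ℤ) : ℝ) = signedSum P.hashBits (ω.1 r).2
      fun j => if csCell P ω r j = c then freqVec x a t j else 0) ?_ ?_ h
  · simp [Bucket.empty, signedSum, freqVec, freq_of_le]
  · intro t ht ih
    have : ∀ j, (if csCell P ω r j = c then freqVec x a (t + 1) j else 0) =
        (if csCell P ω r j = c then freqVec x a t j else 0) +
          if j = x t then (if csCell P ω r (x t) = c then 1 else 0) else 0 := by
      intro j
      simp only [freqVec, freq_succ x ht]
      by_cases hj : j = x t
      · subst hj; split_ifs <;> simp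
      · simp [hj]
    simp only [signedSum] at ih
    simp only [Bucket.add, csAdd, signedSum, this, add_mul, Finset.sum_add_distrib, ← ih]
    by_cases hc : c = csCell P ω r (x t)
    · simp [hc, csSign]
    · simp [hc, Ne.symm hc]

theorem csSign_mul_bucketAt_cs {a t : ℕ} (h : a ≤ t) (r : Fin P.rows) (q : Fin P.u) :
    ((csSign P ω r q * (bucketAt ω x a t).cs r (csCell P ω r q) : ℤ) : ℝ) =
      rowEstimate P.hashBits P.cellBits (ω.1 r) (freqVec x a t) q := by
  rw [Int.cast_mul, bucketAt_cs ω x h]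
  rfl

end BucketAt

/-! ### The candidates of CountSketch -/

section Candidates

variable {P : Params}

/-- Relation between the list of candidates and the true frequencies `n`, up to the error `η`: the
counts are accurate, and if an element is missing then the list is full and no count is much less
than the frequency of that element. -/
structure CandInv (P : Params) (H : Candidates P) (n : Fin P.u → ℕ) (η : ℝ) : Prop where
  nodup : (H.map Prod.fst).Nodup
  length_le : H.length ≤ P.listLen
  accurate : ∀ p ∈ H, |(p.2 : ℝ) - n p.1| ≤ η
  missing : ∀ q, q ∉ H.map Prod.fst → 0 < n q →
    H.length = P.listLen ∧ ∀ p ∈ H, (n q : ℝ) - η ≤ p.2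

theorem CandInv.nil (η : ℝ) : CandInv P [] (fun _ => 0) η :=
  ⟨by simp, by simp, by simp, by simp⟩

theorem length_candUpdate_le {H : Candidates P} (h : H.length ≤ P.listLen) (q : Fin P.u) (e : ℤ) :
    (candUpdate P H q e).length ≤ P.listLen := by
  rw [candUpdate]
  split_ifs with h1 h2
  · simpa using h
  · simpa using h2
  · split
    · exact h
    · rename_i p hp
      split_ifs
      · have hmem := List.argmin_mem hp
        have := List.length_pos_of_mem hmem
        simp only [List.length_cons, List.length_erase_of_mem hmem]
        omega
      · exact h

theorem CandInv.update {H : Candidates P} {n n' : Fin P.u → ℕ} {η : ℝ} (h : CandInv P H n η)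
    (q : Fin P.u) (e : ℤ) (hn : ∀ i, n' i = n i + if i = q then 1 else 0)
    (he : |(e : ℝ) - n' q| ≤ η) : CandInv P (candUpdate P H q e) n' η := by
  have hne : ∀ {i}, i ≠ q → n' i = n i := fun {i} hi => by rw [hn, if_neg hi, add_zero]
  have hmap : ∀ {p} {L : Candidates P}, p ∈ L → p.1 ∈ L.map Prod.fst := fun hp =>
    List.mem_map_of_mem hp
  suffices key : ((candUpdate P H q e).map Prod.fst).Nodup ∧
      (∀ p ∈ candUpdate P H q e, |(p.2 : ℝ) - n' p.1| ≤ η) ∧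
      ∀ q', q' ∉ (candUpdate P H q e).map Prod.fst → 0 < n' q' →
        (candUpdate P H q e).length = P.listLen ∧
          ∀ p ∈ candUpdate P H q e, (n' q' : ℝ) - η ≤ p.2 from
    ⟨key.1, length_candUpdate_le h.length_le q e, key.2.1, key.2.2⟩
  rw [candUpdate]
  split_ifs with h1 h2
  · have hfst : (H.map fun p => if p.1 = q then (p.1, p.2 + 1) else p).map Prod.fst =
        H.map Prod.fst := by
      rw [List.map_map]
      refine List.map_congr_left fun p _ => ?_
      simp only [Function.comp_apply]
      split_ifs <;> rfl
    refine ⟨by rw [hfst]; exact h.nodup, ?_, ?_⟩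
    · intro p hp
      obtain ⟨p', hp', rfl⟩ := List.mem_map.1 hp
      have := h.accurate p' hp'
      by_cases hq : p'.1 = q
      · simp only [hq, if_true, hn]
        rw [hq] at this
        push_cast
        rwa [add_sub_add_right_eq_sub]
      · simpa only [hq, if_false, hne hq] using this
    · intro q' hq' hpos
      rw [hfst] at hq'
      have hqq : q' ≠ q := fun e => hq' (e ▸ h1)
      rw [hne hqq] at hpos ⊢
      obtain ⟨hl, hall⟩ := h.missing q' hq' hpos
      refine ⟨by simpa using hl, fun p hp => ?_⟩
      obtain ⟨p', hp', rfl⟩ := List.mem_map.1 hp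
      refine (hall p' hp').trans ?_
      split_ifs <;> simp
  · refine ⟨by simpa using ⟨by simpa using h1, h.nodup⟩, ?_, ?_⟩
    · intro p hp
      rcases List.mem_cons.1 hp with rfl | hp
      · exact he
      · rw [hne fun e => h1 (e ▸ hmap hp)]
        exact h.accurate p hp
    · intro q' hq' hpos
      simp only [List.map_cons, List.mem_cons, not_or] at hq'
      rw [hne hq'.1] at hpos
      have := (h.missing q' hq'.2 hpos).1
      omega
  · have hfull : H.length = P.listLen := le_antisymm h.length_le (not_lt.1 h2)
    have hk : 0 < P.listLen := Nat.succ_pos _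
    split
    · rename_i hnone
      rw [List.argmin_eq_none] at hnone
      simp [hnone] at hfull
      omega
    · rename_i p hp
      have hpm : p ∈ H := List.argmin_mem hp
      have hmin : ∀ p' ∈ H, p.2 ≤ p'.2 := fun p' hp' => List.le_of_mem_argmin hp' hp
      have hnq : ∀ p' ∈ H, n' p'.1 = n p'.1 := fun p' hp' => hne fun e => h1 (e ▸ hmap hp')
      split_ifs with h3
      · have hsub : ∀ p' ∈ H.erase p, p' ∈ H := fun p' hp' => List.mem_of_mem_erase hp'
        refine ⟨?_, ?_, ?_⟩
        · rw [List.map_cons, List.nodup_cons]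
          refine ⟨fun hm => ?_, h.nodup.sublist (List.erase_sublist.map _)⟩
          obtain ⟨p', hp', rfl⟩ := List.mem_map.1 hm
          exact h1 (hmap (hsub p' hp'))
        · intro p' hp'
          rcases List.mem_cons.1 hp' with rfl | hp'
          · exact he
          · rw [hnq p' (hsub p' hp')]
            exact h.accurate p' (hsub p' hp')
        · intro q' hq' hpos
          simp only [List.map_cons, List.mem_cons, not_or] at hq'
          rw [hne hq'.1] at hpos ⊢
          refine ⟨?_, ?_⟩
          · have := List.length_pos_of_mem hpm
            simp only [List.length_cons, List.length_erase_of_mem hpm]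
            omega
          · have hlow : (n q' : ℝ) - η ≤ p.2 := by
              by_cases hq : q' ∈ H.map Prod.fst
              · obtain ⟨p', hp', rfl⟩ := List.mem_map.1 hq
                have : p' = p := by
                  by_contra hpp
                  exact hq'.2 (hmap ((List.mem_erase_of_ne hpp).2 hp'))
                rw [this]
                have := (abs_le.1 (h.accurate p hpm)).1
                linarith
              · exact (h.missing q' hq hpos).2 p hpm
            intro p' hp'
            refine hlow.trans ?_
            rcases List.mem_cons.1 hp' with rfl | hp'
            · exact_mod_cast h3.le
            · exact_mod_cast hmin p' (hsub p' hp')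
      · refine ⟨h.nodup, fun p' hp' => by rw [hnq p' hp']; exact h.accurate p' hp', ?_⟩
        intro q' hq' hpos
        refine ⟨hfull, fun p' hp' => ?_⟩
        by_cases hqq : q' = q
        · subst hqq
          have h4 : e ≤ p'.2 := (not_lt.1 h3).trans (hmin p' hp')
          have h5 : (e : ℝ) ≤ p'.2 := by exact_mod_cast h4
          linarith [(abs_le.1 he).1]
        · rw [hne hqq] at hpos ⊢
          exact (h.missing q' hq' hpos).2 p' hp'

theorem bucketAt_candInv (ω : P.Seed) (x : ℕ → Fin P.u) {a t : ℕ} (hat : a ≤ t) {η : ℝ}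
    (he : ∀ s, a ≤ s → s < t →
      |(csEstimate P ω (bucketAt ω x a (s + 1)).cs (x s) : ℝ) - freq x a (s + 1) (x s)| ≤ η) :
    CandInv P (bucketAt ω x a t).cand (freq x a t) η := by
  refine bucketAt_induction ω x a (fun s A => s ≤ t → CandInv P A.cand (freq x a s) η)
    (fun _ => ?_) ?_ hat le_rfl
  · have : freq x a a = fun _ => 0 := funext fun i => freq_of_le x le_rfl i
    rw [this]
    exact CandInv.nil η
  · intro s hs ih hst
    refine (ih (by omega)).update (x s) _ (fun i => freq_succ x hs i) ?_
    have := he s hs (by omega)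
    rwa [bucketAt_succ ω x hs] at this

/-- With accurate estimates, the elements of large frequency are candidates. -/
theorem CandInv.mem_of_le {H : Candidates P} {n : Fin P.u → ℕ} {η L : ℝ} (h : CandInv P H n η)
    (hγ : 0 < P.γ) (hL : 0 < L) (hsum : ∑ i, (n i : ℝ) ^ 2 = L ^ 2) {q : Fin P.u}
    (hη : 0 ≤ η) (hq : P.γ * L + 2 * η ≤ n q) : q ∈ H.map Prod.fst := by
  classical
  by_contra hmem
  have hpos : 0 < n q := by
    have : (0 : ℝ) < n q := by nlinarith [mul_pos hγ hL]
    exact_mod_cast this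
  obtain ⟨hlen, hall⟩ := h.missing q hmem hpos
  have hcard : (H.map Prod.fst).toFinset.card = P.listLen := by
    rw [List.toFinset_card_of_nodup h.nodup, List.length_map, hlen]
  have hlow : ∀ i ∈ (H.map Prod.fst).toFinset, (P.γ * L) ^ 2 ≤ (n i : ℝ) ^ 2 := by
    intro i hi
    obtain ⟨p, hp, rfl⟩ := List.mem_map.1 (List.mem_toFinset.1 hi)
    have h1 := hall p hp
    have h2 := (abs_le.1 (h.accurate p hp)).2
    have := mul_pos hγ hL
    gcongr
    linarith
  have h3 : (P.listLen : ℝ) * (P.γ * L) ^ 2 ≤ L ^ 2 := by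
    rw [← hsum, ← hcard, ← nsmul_eq_mul]
    exact (Finset.card_nsmul_le_sum _ _ _ hlow).trans
      (Finset.sum_le_univ_sum_of_nonneg fun i => sq_nonneg _)
  have h4 : 1 / P.γ ^ 2 < P.listLen := by
    rw [Params.listLen]; push_cast; exact Nat.lt_floor_add_one _
  rw [div_lt_iff₀ (by positivity)] at h4
  have : 0 < L ^ 2 := by positivity
  nlinarith

end Candidates

/-! ### List surgery of the histogram -/

section Surgery

theorem skipTo_suffix {α : Type*} (p : α → Prop) (l : List α) : skipTo p l <:+ l := by
  induction l with
  | nil => simp [skipTo]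
  | cons y l ih =>
    rw [skipTo]
    split_ifs
    · exact ih.trans (List.suffix_cons y l)
    · exact List.suffix_rfl

theorem skipTo_map {α β : Type*} (f : α → β) (p : β → Prop) (l : List α) :
    skipTo p (l.map f) = (skipTo (fun a => p (f a)) l).map f := by
  induction l with
  | nil => simp [skipTo]
  | cons y l ih =>
    have hiff : (∃ z ∈ l.map f, p z) ↔ ∃ a ∈ l, p (f a) := by simp
    rw [List.map_cons, skipTo, skipTo]
    by_cases h : ∃ a ∈ l, p (f a)
    · rw [if_pos (hiff.2 h), if_pos h, ih]
    · rw [if_neg (mt hiff.1 h), if_neg h, List.map_cons]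

theorem skipTo_head_of_exists {α : Type*} (p : α → Prop) (l : List α) (h : ∃ z ∈ l, p z) :
    ∀ y ∈ (skipTo p l).head?, p y := by
  induction l with
  | nil => simp at h
  | cons z l ih =>
    rw [skipTo]
    split_ifs with h1
    · exact ih h1
    · intro y hy
      obtain rfl : z = y := by simpa using hy
      obtain ⟨w, hw, hp⟩ := h
      rcases List.mem_cons.1 hw with rfl | hw
      · exact hp
      · exact absurd ⟨w, hw, hp⟩ h1

theorem skipTo_head {α : Type*} (p : α → Prop) (l : List α) :
    ∀ y ∈ (skipTo p l).head?, y ∈ l.head? ∨ p y := by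
  intro y hy
  by_cases h : ∃ z ∈ l, p z
  · exact Or.inr (skipTo_head_of_exists p l h y hy)
  · cases l with
    | nil => simp [skipTo] at hy
    | cons z l =>
      rw [skipTo, if_neg fun ⟨w, hw, hp⟩ => h ⟨w, List.mem_cons_of_mem _ hw, hp⟩] at hy
      exact Or.inl hy

theorem skipTo_tail {α : Type*} (p : α → Prop) (l : List α) :
    ∀ z ∈ (skipTo p l).tail, ¬ p z := by
  induction l with
  | nil => simp [skipTo]
  | cons y l ih =>
    rw [skipTo]
    split_ifs with h
    · exact ih
    · intro z hz hp
      exact h ⟨z, hz, hp⟩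

theorem skipTo_ne_nil {α : Type*} (p : α → Prop) {l : List α} (h : l ≠ []) :
    skipTo p l ≠ [] := by
  induction l with
  | nil => exact absurd rfl h
  | cons y l ih =>
    rw [skipTo]
    split_ifs with h1
    · obtain ⟨z, hz, _⟩ := h1
      exact ih (List.ne_nil_of_mem hz)
    · simp

theorem getLast?_of_suffix {α : Type*} {l l' : List α} (h : l' <:+ l) (hne : l' ≠ []) :
    l'.getLast? = l.getLast? := by
  obtain ⟨s, rfl⟩ := h
  rw [List.getLast?_append_of_ne_nil _ hne]

variable {P : Params}

/-- No member of the list is close to a later one, except possibly the next one. -/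
def FarList {ι : Type*} (f : ι → Bucket P) (l : List ι) : Prop :=
  ∀ i j (hij : i + 2 ≤ j) (hj : j < l.length), ¬ Close (f (l[i]'(by omega))) (f l[j])

theorem FarList.drop {ι : Type*} {f : ι → Bucket P} {l : List ι} (h : FarList f l) (k : ℕ) :
    FarList f (l.drop k) := by
  intro i j hij hj
  rw [List.length_drop] at hj
  simp only [List.getElem_drop]
  exact h (k + i) (k + j) (by omega) (by omega)

theorem prune_map {ι : Type*} (f : ι → Bucket P) (m : ℕ) : ∀ l : List ι, l.length ≤ m →
    ∃ l', prune (l.map f) = l'.map f ∧ l'.Sublist l ∧ l'.head? = l.head? ∧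
      l'.getLast? = l.getLast? ∧
      (∀ R : ι → ι → Prop, l.IsChain R → l'.IsChain fun a b => R a b ∨ Close (f a) (f b)) ∧
      FarList f l' := by
  induction m with
  | zero =>
    intro l hl
    obtain rfl : l = [] := by simpa using hl
    exact ⟨[], by simp [prune], by simp, rfl, rfl, by simp, by simp [FarList]⟩
  | succ m ih =>
    intro l hl
    cases l with
    | nil => exact ⟨[], by simp [prune], by simp, rfl, rfl, by simp, by simp [FarList]⟩
    | cons a l =>
      set s := skipTo (fun b => Close (f a) (f b)) l with hs
      have hsuf : s <:+ l := skipTo_suffix _ _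
      obtain ⟨m', h1, h2, h3, h4, h5, h6⟩ := ih s (by
        have := hsuf.length_le
        simp only [List.length_cons] at hl
        omega)
      refine ⟨a :: m', ?_, ?_, rfl, ?_, ?_, ?_⟩
      · rw [List.map_cons, prune, skipTo_map, ← hs, h1, List.map_cons]
      · exact (h2.trans hsuf.sublist).cons_cons a
      · rw [List.getLast?_cons, List.getLast?_cons, h4]
        by_cases hl0 : l = []
        · subst hl0; simp [hs, skipTo]
        · rw [getLast?_of_suffix hsuf (skipTo_ne_nil _ hl0)]
      · intro R hR
        rw [List.isChain_cons] at hR ⊢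
        refine ⟨fun y hy => ?_, h5 R (hR.2.suffix hsuf)⟩
        rw [h3] at hy
        exact (skipTo_head _ _ y hy).imp (hR.1 y) id
      · intro i j hij hj
        obtain ⟨j, rfl⟩ : ∃ j', j = j' + 1 := ⟨j - 1, by omega⟩
        cases i with
        | zero =>
          simp only [List.getElem_cons_zero, List.getElem_cons_succ]
          refine skipTo_tail (fun b => Close (f a) (f b)) l _ (h2.tail.subset ?_)
          obtain ⟨j, rfl⟩ : ∃ j', j = j' + 1 := ⟨j - 1, by omega⟩
          simp only [List.length_cons] at hj
          rw [List.mem_iff_getElem]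
          exact ⟨j, by simp; omega, by simp⟩
        | succ i =>
          simp only [List.getElem_cons_succ]
          exact h6 i j (by omega) (by simpa using hj)

theorem expire_spec (L : List (Bucket P)) : ∃ k, expire L = L.drop k ∧
    (L ≠ [] → expire L ≠ []) ∧ (k = 0 ∨ ∀ A ∈ (L.drop k).head?, P.N ≤ A.size) ∧
    ∀ B ∈ (expire L).tail.head?, B.size < P.N := by
  induction L with
  | nil => exact ⟨0, by simp [expire], by simp, Or.inl rfl, by simp [expire]⟩
  | cons A L ih =>
    cases L with
    | nil => exact ⟨0, by simp [expire], by simp [expire], Or.inl rfl, by simp [expire]⟩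
    | cons B L =>
      rw [expire]
      split_ifs with h
      · obtain ⟨k, h1, h2, h3, h4⟩ := ih
        refine ⟨k + 1, by simpa using h1, fun _ => h2 (by simp), Or.inr ?_, h4⟩
        rw [List.drop_succ_cons]
        rcases h3 with rfl | h3
        · simpa using h
        · exact h3
      · exact ⟨0, by simp, by simp, Or.inl rfl, by simpa using h⟩

theorem filter_eq_drop {l : List ℕ} (h : l.Pairwise (· < ·)) (t M : ℕ) :
    ∃ k, l.filter (fun a => t - a ≤ M) = l.drop k := by
  induction l with
  | nil => exact ⟨0, by simp⟩
  | cons a l ih =>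
    rw [List.pairwise_cons] at h
    by_cases ha : t - a ≤ M
    · refine ⟨0, ?_⟩
      rw [List.drop_zero, List.filter_eq_self]
      intro b hb
      rcases List.mem_cons.1 hb with rfl | hb
      · simpa using ha
      · have := h.1 b hb
        simp only [decide_eq_true_eq]
        omega
    · obtain ⟨k, hk⟩ := ih h.2
      exact ⟨k + 1, by rw [List.filter_cons_of_neg (by simpa using ha), hk, List.drop_succ_cons]⟩

end Surgery

/-! ### Invariants of the histogram -/

section Histogram

variable {P : Params} (ω : P.Seed) (x : ℕ → Fin P.u)

/-- Either no bucket has been deleted between the buckets that start at `a` and `b`, or at some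
time up to `t` the two passed the test. -/
def Link (t a b : ℕ) : Prop :=
  b = a + 1 ∨ ∃ s ≤ t, b < s ∧ Close (bucketAt ω x a s) (bucketAt ω x b s)

/-- The list `l` of the starts of the buckets at time `t`, of size at most `M`. -/
structure HistInv (t M : ℕ) (l : List ℕ) : Prop where
  sorted : l.Pairwise (· < ·)
  linked : l.IsChain (Link ω x t)
  last : ∀ a ∈ l.getLast?, a + 1 = t
  ne_nil : 0 < t → l ≠ []
  lt : ∀ a ∈ l, a < t
  size_le : ∀ a ∈ l, t - a ≤ M
  tail_lt : ∀ b ∈ l.tail, t - b < P.N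

variable {ω x}

theorem HistInv.drop {t M : ℕ} {l : List ℕ} (h : HistInv ω x t M l) {k : ℕ}
    (hne : l.drop k ≠ []) : HistInv ω x t M (l.drop k) where
  sorted := h.sorted.sublist (List.drop_sublist k l)
  linked := h.linked.drop k
  last := by rw [getLast?_of_suffix (List.drop_suffix k l) hne]; exact h.last
  ne_nil := fun _ => hne
  lt := fun a ha => h.lt a (List.mem_of_mem_drop ha)
  size_le := fun a ha => h.size_le a (List.mem_of_mem_drop ha)
  tail_lt := fun b hb => h.tail_lt b ((List.drop_sublist k l).tail.subset hb)

theorem HistInv.nil : HistInv ω x 0 P.maxSize [] :=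
  ⟨by simp, by simp, by simp, by simp, by simp, by simp, by simp⟩

theorem HistInv.arrival {t : ℕ} {l : List ℕ} (h : HistInv ω x t P.maxSize l) :
    (l.map (bucketAt ω x · t) ++ [Bucket.empty P]).map (Bucket.add ω (x t)) =
      (l ++ [t]).map (bucketAt ω x · (t + 1)) := by
  rw [List.map_append, List.map_append, List.map_map]
  congr 1
  · refine List.map_congr_left fun a ha => ?_
    rw [Function.comp_apply, bucketAt_succ ω x (h.lt a ha).le]
  · simp [bucketAt_succ ω x le_rfl, bucketAt_of_le ω x le_rfl]

/-- The buckets after an arrival and before the oldest ones are dropped. -/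
theorem HistInv.step {t : ℕ} {l : List ℕ} (h : HistInv ω x t P.maxSize l) :
    ∃ e : List ℕ, expire (prune ((l.map (bucketAt ω x · t) ++ [Bucket.empty P]).map
        (Bucket.add ω (x t)))) = e.map (bucketAt ω x · (t + 1)) ∧
      HistInv ω x (t + 1) (P.maxSize + 1) e ∧ FarList (bucketAt ω x · (t + 1)) e ∧
      ∀ a ∈ e.head?, a ∈ (l ++ [t]).head? ∨ P.N ≤ t + 1 - a := by
  rw [h.arrival]
  obtain ⟨l', h1, h2, h3, h4, h5, h6⟩ := prune_map (bucketAt ω x · (t + 1)) _ (l ++ [t]) le_rfl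
  rw [h1]
  obtain ⟨k, e1, e2, e3, e4⟩ := expire_spec (l'.map (bucketAt ω x · (t + 1)))
  have hl' : l' ≠ [] := by
    rintro rfl
    simp at h4
  rw [← List.map_drop] at e1
  have hmem : ∀ a ∈ l', a ∈ l ∨ a = t := fun a ha => by simpa using h2.subset ha
  have hsorted : (l ++ [t]).Pairwise (· < ·) := by
    rw [List.pairwise_append]
    exact ⟨h.sorted, by simp, fun a ha b hb => by
      obtain rfl : b = t := by simpa using hb
      exact h.lt a ha⟩
  have hne : l'.drop k ≠ [] := by
    have := e2 (by simpa using hl')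
    rw [e1] at this
    simpa using this
  have hs' : (l'.drop k).Pairwise (· < ·) :=
    (hsorted.sublist h2).sublist (List.drop_sublist k l')
  refine ⟨l'.drop k, e1, ⟨hs', ?_, ?_, fun _ => hne, ?_, ?_, ?_⟩, h6.drop k, ?_⟩
  · refine List.IsChain.drop ?_ k
    refine List.IsChain.imp_of_mem_imp ?_ (h5 (Link ω x t) ?_)
    · rintro a b ha hb (hR | hC)
      · rcases hR with hR | ⟨s, hs, hbs, hc⟩
        · exact Or.inl hR
        · exact Or.inr ⟨s, by omega, hbs, hc⟩
      · refine Or.inr ⟨t + 1, le_rfl, ?_, hC⟩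
        rcases hmem b hb with hb | rfl
        · exact (h.lt b hb).trans (Nat.lt_succ_self t)
        · exact Nat.lt_succ_self _
    · rw [List.isChain_append]
      refine ⟨h.linked, by simp, fun a ha b hb => Or.inl ?_⟩
      obtain rfl : t = b := by simpa using hb
      exact (h.last a ha).symm
  · rw [getLast?_of_suffix (List.drop_suffix k l') hne, h4]
    simp
  · intro a ha
    rcases hmem a (List.mem_of_mem_drop ha) with ha | rfl
    · exact (h.lt a ha).trans (Nat.lt_succ_self t)
    · exact Nat.lt_succ_self _
  · intro a ha
    rcases hmem a (List.mem_of_mem_drop ha) with ha | rfl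
    · have := h.size_le a ha
      omega
    · omega
  · rw [e1] at e4
    generalize l'.drop k = m at hs' e4
    intro b hb
    rcases m with _ | ⟨a, _ | ⟨b', m⟩⟩
    · simp at hb
    · simp at hb
    · have h7 : t + 1 - b' < P.N := by
        have := e4 (bucketAt ω x b' (t + 1)) (by simp)
        rwa [bucketAt_size] at this
      rw [List.pairwise_cons, List.pairwise_cons] at hs'
      rcases List.mem_cons.1 hb with rfl | hb
      · exact h7
      · have := hs'.2.1 b hb
        omega
  · intro a ha
    rcases e3 with rfl | e3
    · left
      rw [List.drop_zero, h3] at ha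
      exact ha
    · right
      rw [← List.map_drop, List.head?_map] at e3
      have := e3 (bucketAt ω x a (t + 1)) (by
        rw [Option.mem_map]; exact ⟨a, ha, rfl⟩)
      rwa [bucketAt_size] at this

theorem histStep_eq {t : ℕ} {l e : List ℕ}
    (he : expire (prune ((l.map (bucketAt ω x · t) ++ [Bucket.empty P]).map
        (Bucket.add ω (x t)))) = e.map (bucketAt ω x · (t + 1))) :
    histStep P ω (l.map (bucketAt ω x · t)) (x t) =
      (let T := e.filter (fun a => t + 1 - a ≤ P.maxSize)
       T.drop (T.length - P.maxBuckets)).map (bucketAt ω x · (t + 1)) := by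
  have : (e.map (bucketAt ω x · (t + 1))).filter (fun A => A.size ≤ P.maxSize) =
      (e.filter (fun a => t + 1 - a ≤ P.maxSize)).map (bucketAt ω x · (t + 1)) := by
    rw [List.filter_map]
    congr 2
    funext a
    simp [bucketAt_size]
  simp only [histStep, he, this, List.length_map, List.map_drop]

theorem one_le_maxSize (hN : 2 ≤ P.N) : 1 ≤ P.maxSize := by
  have : 0 < P.N := by omega
  exact Nat.succ_le_of_lt (by simp only [Params.maxSize]; positivity)

/-- The invariant is preserved when the oldest buckets are dropped. -/
theorem HistInv.cut (hN : 2 ≤ P.N) (hB : 1 ≤ P.maxBuckets) {t : ℕ} {e : List ℕ}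
    (h : HistInv ω x (t + 1) (P.maxSize + 1) e) :
    HistInv ω x (t + 1) P.maxSize
      (let T := e.filter (fun a => t + 1 - a ≤ P.maxSize)
       T.drop (T.length - P.maxBuckets)) := by
  have h1 := one_le_maxSize hN
  obtain ⟨k, hk⟩ := filter_eq_drop h.sorted (t + 1) P.maxSize
  have hne := h.ne_nil (Nat.succ_pos t)
  have hT : e.filter (fun a => t + 1 - a ≤ P.maxSize) ≠ [] := by
    have hlast := h.last _ (List.getLast?_eq_some_getLast hne)
    refine List.ne_nil_of_mem (a := e.getLast hne) ?_
    rw [List.mem_filter]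
    exact ⟨List.getLast_mem hne, by simp only [decide_eq_true_eq]; omega⟩
  have hlen := List.length_pos_iff.2 hT
  have hmem : ∀ a ∈ e.filter (fun a => t + 1 - a ≤ P.maxSize), t + 1 - a ≤ P.maxSize :=
    fun a ha => by simpa using (List.mem_filter.1 ha).2
  simp only
  rw [hk] at hT hlen hmem ⊢
  have hD : (e.drop k).drop ((e.drop k).length - P.maxBuckets) ≠ [] := by
    rw [← List.length_pos_iff, List.length_drop (l := e.drop k)]
    omega
  have := (h.drop hT).drop hD
  exact ⟨this.sorted, this.linked, this.last, this.ne_nil, this.lt,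
    fun a ha => hmem a (List.mem_of_mem_drop ha), this.tail_lt⟩

theorem exists_histInv (hN : 2 ≤ P.N) (hB : 1 ≤ P.maxBuckets) (t : ℕ) :
    ∃ l, (freqAlgorithm P).run ω x t = l.map (bucketAt ω x · t) ∧
      HistInv ω x t P.maxSize l := by
  induction t with
  | zero => exact ⟨[], rfl, HistInv.nil⟩
  | succ t ih =>
    obtain ⟨l, hl, hinv⟩ := ih
    obtain ⟨e, he, hinv', -, -⟩ := hinv.step
    refine ⟨_, ?_, hinv'.cut hN hB⟩
    rw [← histStep_eq he, ← hl]
    rfl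

end Histogram

/-! ### Correctness when the sketches are accurate -/

section Correctness

/-- The admissible parameters. -/
structure Params.Valid (P : Params) : Prop where
  two_le_N : 2 ≤ P.N
  γ_pos : 0 < P.γ
  γ_lt : P.γ < 1
  ε_pos : 0 < P.ε
  ε_lt : P.ε < 1 / 8
  δ_pos : 0 < P.δ
  δ_lt : P.δ < 1
  κ_eq : P.κ = 100000

variable {P : Params}

/-- All sketches of segments that matter at time `n` are accurate. -/
structure Accurate (ω : P.Seed) (x : ℕ → Fin P.u) (n : ℕ) : Prop where
  close_of : ∀ a b t, a < b → b < t → t ≤ n → n ≤ a + 8 * P.N ^ 2 →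
    segF2 x a t - segF2 x b t ≤ P.β / 2 * segF2 x a t →
      Close (bucketAt ω x a t) (bucketAt ω x b t)
  of_close : ∀ a b t, a < b → b < t → t ≤ n → n ≤ a + 8 * P.N ^ 2 →
    Close (bucketAt ω x a t) (bucketAt ω x b t) →
      segF2 x a t - segF2 x b t ≤ 4 * P.β * segF2 x a t
  l2 : ∀ a, a < n → n ≤ a + 8 * P.N ^ 2 →
    (1 - P.ε) * √(segF2 x a n) ≤ l2Estimate P (bucketAt ω x a n).l2 ∧
      l2Estimate P (bucketAt ω x a n).l2 ≤ (1 + P.ε) * √(segF2 x a n)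
  cs : ∀ a s, a ≤ s → s < n → n ≤ a + 8 * P.N ^ 2 →
    |(csEstimate P ω (bucketAt ω x a (s + 1)).cs (x s) : ℝ) - freq x a (s + 1) (x s)| ≤
      P.γ * P.ε / 8 * √(segF2 x a (s + 1))

variable {ω : P.Seed} {x : ℕ → Fin P.u} {n : ℕ}

theorem β_eq (P : Params) : P.β = P.ε ^ 2 / 8 := by
  rw [Params.β, Params.α]; ring

theorem one_le_maxBuckets (hP : P.Valid) : 1 ≤ P.maxBuckets := by
  have h1 := hP.ε_pos
  have h2 : 0 < Real.log P.N := Real.log_pos (by exact_mod_cast hP.two_le_N)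
  rw [Params.maxBuckets, hP.κ_eq]
  exact Nat.one_le_iff_ne_zero.2 (Nat.ceil_pos.2 (by positivity)).ne'

/-- The part of the first bucket that precedes the window has a small norm. -/
theorem HistInv.segF2_expired_le (hP : P.Valid) {t M : ℕ} {l : List ℕ} {a : ℕ}
    (h : HistInv ω x t M l) (hA : Accurate ω x n) (htn : t ≤ n) (ha : a ∈ l.head?)
    (haN : a ≤ t - P.N) (hna : n ≤ a + 8 * P.N ^ 2) :
    segF2 x a (t - P.N) ≤ 4 * P.β * segF2 x a t := by
  have hN := hP.two_le_N
  have hβ : 0 ≤ P.β := by rw [β_eq]; positivity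
  have hzero : ∀ b, segF2 x b b = 0 := fun b => by simp [segF2, freqVec, freq_of_le]
  rcases haN.eq_or_lt with heq | hlt
  · rw [← heq, hzero]
    exact mul_nonneg (by positivity) (segF2_nonneg x _ _)
  · rcases l with _ | ⟨a', _ | ⟨b, l⟩⟩
    · simp at ha
    · obtain rfl : a' = a := by simpa using ha
      have := h.last a' (by simp)
      omega
    · obtain rfl : a' = a := by simpa using ha
      have hb := h.tail_lt b (by simp)
      have hbt := h.lt b (by simp)
      have hlink := h.linked
      rw [List.isChain_cons_cons] at hlink
      rcases hlink.1 with rfl | ⟨s, hst, hbs, hc⟩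
      · omega
      · have hab : a' < b := by omega
        calc segF2 x a' (t - P.N) ≤ segF2 x a' b := segF2_mono_right x haN (by omega)
          _ ≤ segF2 x a' s - segF2 x b s := by linarith [segF2_add_le x hab.le hbs.le]
          _ ≤ 4 * P.β * segF2 x a' s := hA.of_close a' b s hab hbs (hst.trans htn) hna hc
          _ ≤ _ := by
            gcongr
            exact segF2_mono_right x (by omega) hst

theorem sqrt_expired_le (hε : 0 < P.ε) {a w t : ℕ}
    (h : segF2 x a w ≤ 4 * P.β * segF2 x a t) :
    √(segF2 x a w) ≤ 3 / 4 * P.ε * √(segF2 x a t) := by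
  rw [Real.sqrt_le_left (by positivity), mul_pow, Real.sq_sqrt (segF2_nonneg x _ _)]
  refine h.trans ?_
  rw [β_eq]
  have := mul_nonneg (sq_nonneg P.ε) (segF2_nonneg x a t)
  nlinarith

theorem maxBuckets_ge (hP : P.Valid) {j m : ℕ} (hm : m ≤ 2 * j + 2)
    (h : (1 : ℝ) ≤ (1 - P.β / 2) ^ j * (P.maxSize + 1 : ℝ) ^ 2) : m ≤ P.maxBuckets := by
  have hN : (2 : ℝ) ≤ P.N := by exact_mod_cast hP.two_le_N
  have hε := hP.ε_pos
  have hε1 : P.ε ^ 2 < 1 := by nlinarith [hP.ε_lt]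
  have hlog : 0.69 < Real.log P.N :=
    (by linarith [Real.log_two_gt_d9] : 0.69 < Real.log 2).trans_le
      (Real.log_le_log (by norm_num) hN)
  have hsize : (P.maxSize + 1 : ℝ) ≤ (P.N : ℝ) ^ 5 := by
    rw [Params.maxSize]
    push_cast
    have h3 : (8 : ℝ) ≤ (P.N : ℝ) ^ 3 := by
      calc (8 : ℝ) = 2 ^ 3 := by norm_num
        _ ≤ _ := by gcongr
    have h2 : (4 : ℝ) ≤ (P.N : ℝ) ^ 2 := by
      calc (4 : ℝ) = 2 ^ 2 := by norm_num
        _ ≤ _ := by gcongr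
    calc (4 * (P.N : ℝ) ^ 2 + 1) ≤ 8 * (P.N : ℝ) ^ 2 := by linarith
      _ ≤ (P.N : ℝ) ^ 3 * (P.N : ℝ) ^ 2 := by gcongr
      _ = (P.N : ℝ) ^ 5 := by ring
  have hexp : (1 - P.β / 2) ^ j ≤ Real.exp (-(P.β / 2 * j)) := by
    have h0 : 0 ≤ 1 - P.β / 2 := by rw [β_eq]; linarith
    calc (1 - P.β / 2) ^ j ≤ Real.exp (-(P.β / 2)) ^ j := by
          gcongr
          linarith [Real.add_one_le_exp (-(P.β / 2))]
      _ = _ := by rw [← Real.exp_nat_mul]; ring_nf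
  have hj : P.β / 2 * j ≤ 10 * Real.log P.N := by
    have h1 : (1 : ℝ) ≤ Real.exp (-(P.β / 2 * j)) * ((P.N : ℝ) ^ 5) ^ 2 := by
      refine h.trans ?_
      gcongr
    rw [← pow_mul, ← Real.exp_log (show (0 : ℝ) < P.N by linarith), ← Real.exp_nat_mul,
      ← Real.exp_add, Real.one_le_exp_iff] at h1
    push_cast at h1
    linarith
  rw [β_eq] at hj
  have hj2 : (j : ℝ) ≤ 160 / P.ε ^ 2 * Real.log P.N := by
    rw [div_mul_eq_mul_div, le_div_iff₀ (by positivity)]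
    linarith
  have h2 : (2 : ℝ) ≤ 4 / P.ε ^ 2 * Real.log P.N := by
    rw [div_mul_eq_mul_div, le_div_iff₀ (by positivity)]
    linarith
  have hfin : (m : ℝ) ≤ P.κ / P.ε ^ 2 * Real.log P.N := by
    have hm' : (m : ℝ) ≤ 2 * j + 2 := by exact_mod_cast hm
    have hpos : 0 < 1 / P.ε ^ 2 * Real.log P.N := by positivity
    rw [hP.κ_eq]
    have e1 : 160 / P.ε ^ 2 * Real.log P.N = 160 * (1 / P.ε ^ 2 * Real.log P.N) := by ring
    have e2 : 4 / P.ε ^ 2 * Real.log P.N = 4 * (1 / P.ε ^ 2 * Real.log P.N) := by ring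
    have e3 : 100000 / P.ε ^ 2 * Real.log P.N = 100000 * (1 / P.ε ^ 2 * Real.log P.N) := by ring
    rw [e1] at hj2
    rw [e2] at h2
    rw [e3]
    linarith
  exact_mod_cast hfin.trans (Nat.le_ceil _)

/-- Buckets two apart are not close, so there are few buckets. -/
theorem HistInv.length_le (hP : P.Valid) {t : ℕ} {e : List ℕ}
    (h : HistInv ω x (t + 1) (P.maxSize + 1) e) (hfar : FarList (bucketAt ω x · (t + 1)) e)
    (hA : Accurate ω x n) (htn : t + 1 ≤ n) (hnt : n ≤ t + P.N) : e.length ≤ P.maxBuckets := by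
  have hN := hP.two_le_N
  have hN2 : 2 * P.N ≤ P.N ^ 2 := by nlinarith
  rcases Nat.eq_zero_or_pos e.length with h0 | hpos
  · omega
  have hsz : ∀ a ∈ e, n ≤ a + 8 * P.N ^ 2 := by
    intro a ha
    have h1 := h.size_le a ha
    have h2 := h.lt a ha
    simp only [Params.maxSize] at h1
    omega
  have hβ0 : 0 ≤ P.β := by rw [β_eq]; positivity
  have hβ1 : P.β / 2 ≤ 1 := by
    rw [β_eq]; nlinarith [hP.ε_lt, hP.ε_pos]
  have hdecay : ∀ j (hj : 2 * j < e.length),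
      segF2 x e[2 * j] (t + 1) ≤ (1 - P.β / 2 : ℝ) ^ j * segF2 x e[0] (t + 1) := by
    intro j
    induction j with
    | zero => intro _; simp
    | succ j ih =>
      intro hj
      have hlt : e[2 * j] < e[2 * (j + 1)] :=
        List.pairwise_iff_getElem.1 h.sorted _ _ _ _ (by omega)
      have hnc := hfar (2 * j) (2 * (j + 1)) (by omega) hj
      have h1 : P.β / 2 * segF2 x e[2 * j] (t + 1) <
          segF2 x e[2 * j] (t + 1) - segF2 x e[2 * (j + 1)] (t + 1) := by
        by_contra hcon
        exact hnc (hA.close_of _ _ (t + 1) hlt (h.lt _ (List.getElem_mem _)) htn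
          (hsz _ (List.getElem_mem _)) (not_lt.1 hcon))
      have h2 := ih (by omega)
      rw [pow_succ]
      nlinarith
  set j := (e.length - 1) / 2 with hj
  have hjlt : 2 * j < e.length := by omega
  refine maxBuckets_ge hP (j := j) (by omega) ?_
  have hlow : (1 : ℝ) ≤ segF2 x e[2 * j] (t + 1) := by
    refine le_trans ?_ (length_le_segF2 x _ _)
    have := h.lt _ (List.getElem_mem hjlt)
    exact_mod_cast (by omega : 1 ≤ t + 1 - e[2 * j])
  refine hlow.trans ((hdecay j hjlt).trans ?_)
  have hp : 0 ≤ (1 - P.β / 2) ^ j := pow_nonneg (by linarith) j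
  refine mul_le_mul_of_nonneg_left ((segF2_le_length_sq x _ _).trans ?_) hp
  have := h.size_le _ (List.getElem_mem hpos)
  gcongr
  exact_mod_cast this

/-- The first bucket is not too large. -/
theorem HistInv.size_le_of_accurate (hP : P.Valid) {t : ℕ} {e : List ℕ}
    (h : HistInv ω x (t + 1) (P.maxSize + 1) e)
    (hA : Accurate ω x n) (htn : t + 1 ≤ n) (hnt : n ≤ t + P.N) :
    ∀ a ∈ e, t + 1 - a ≤ P.maxSize := by
  have hN := hP.two_le_N
  have hN2 : 2 * P.N ≤ P.N ^ 2 := by nlinarith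
  have hM : P.maxSize = 4 * P.N ^ 2 := rfl
  intro a ha
  by_contra hcon
  have hhead : a ∈ e.head? := by
    cases e with
    | nil => simp at ha
    | cons b e =>
      rcases List.mem_cons.1 ha with rfl | ha
      · simp
      · have := h.tail_lt a ha
        omega
  have h1 := h.size_le a ha
  have hlt := h.lt a ha
  have hexp := sqrt_expired_le hP.ε_pos
    (h.segF2_expired_le hP hA htn hhead (by omega) (by omega))
  have htri := sqrt_segF2_le_add x (show a ≤ t + 1 - P.N by omega) (Nat.sub_le _ _)
  have hW : √(segF2 x (t + 1 - P.N) (t + 1)) ≤ P.N := by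
    rw [Real.sqrt_le_left (by positivity)]
    refine (segF2_le_length_sq x _ _).trans ?_
    gcongr
    omega
  have hs := Real.sqrt_nonneg (segF2 x a (t + 1))
  have hle : √(segF2 x a (t + 1)) ≤ 2 * P.N := by nlinarith [hP.ε_lt, hP.ε_pos]
  have hF : segF2 x a (t + 1) ≤ 4 * (P.N : ℝ) ^ 2 := by
    rw [Real.sqrt_le_left (by positivity)] at hle
    linarith
  have := (length_le_segF2 x a (t + 1)).trans hF
  have : t + 1 - a ≤ 4 * P.N ^ 2 := by exact_mod_cast this
  omega

/-- At time `n` the first bucket contains the window. -/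
theorem exists_histInv_head_le (hP : P.Valid) (hA : Accurate ω x n) (t : ℕ) (ht : n - P.N + 1 ≤ t)
    (htn : t ≤ n) :
    ∃ l, (freqAlgorithm P).run ω x t = l.map (bucketAt ω x · t) ∧
      HistInv ω x t P.maxSize l ∧ ∀ a ∈ l.head?, a ≤ n - P.N := by
  have hN := hP.two_le_N
  have hB := one_le_maxBuckets hP
  induction t, ht using Nat.le_induction with
  | base =>
    obtain ⟨l, hl, hinv⟩ := exists_histInv (ω := ω) (x := x) hN hB (n - P.N + 1)
    refine ⟨l, hl, hinv, fun a ha => ?_⟩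
    have := hinv.lt a (List.mem_of_mem_head? ha)
    omega
  | succ t ht ih =>
    obtain ⟨l, hl, hinv, hhead⟩ := ih (by omega)
    obtain ⟨e, he, hinv', hfar, hhead'⟩ := hinv.step
    have hsize := hinv'.size_le_of_accurate hP hA htn (by omega)
    have hlen := hinv'.length_le hP hfar hA htn (by omega)
    have hfilter : e.filter (fun a => t + 1 - a ≤ P.maxSize) = e := by
      rw [List.filter_eq_self]
      intro a ha
      simpa using hsize a ha
    have hstep := histStep_eq he
    have hcut := hinv'.cut hN hB
    simp only [hfilter, Nat.sub_eq_zero_of_le hlen, List.drop_zero] at hstep hcut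
    refine ⟨e, ?_, hcut, fun a ha => ?_⟩
    · rw [← hstep, ← hl]
      rfl
    · rcases hhead' a ha with h1 | h1
      · cases l with
        | nil => exact absurd rfl (hinv.ne_nil (by omega))
        | cons b l => exact hhead a (by simpa using h1)
      · omega

end Correctness

section Output

variable {P : Params} {ω : P.Seed} {x : ℕ → Fin P.u} {n : ℕ}

theorem mem_freqReport {A : Bucket P} {L : List (Bucket P)} {i : Fin P.u} :
    i ∈ freqReport P (A :: L) ↔
      ∃ v, (i, v) ∈ A.cand ∧ 1 / (1 + P.ε) * P.γ * l2Estimate P A.l2 < (v : ℝ) := by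
  simp [freqReport]

theorem output_correct (hP : P.Valid) (hn : 1 ≤ n) (hA : Accurate ω x n) :
    (∀ i, (1 + 4 * P.ε) * P.γ * winL2 P.N x n ≤ winFreq P.N x n i →
      i ∈ (freqAlgorithm P).output ω x n) ∧
    (∀ i, (winFreq P.N x n i : ℝ) < (1 - 4 / P.γ * P.ε) * P.γ * winL2 P.N x n →
      i ∉ (freqAlgorithm P).output ω x n) := by
  have hN := hP.two_le_N
  have hγ := hP.γ_pos
  have hγ1 := hP.γ_lt
  have hε := hP.ε_pos
  have hε1 := hP.ε_lt
  obtain ⟨l, hl, hinv, hhead⟩ := exists_histInv_head_le hP hA n (by omega) le_rfl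
  obtain ⟨a, l, rfl⟩ := List.exists_cons_of_ne_nil (hinv.ne_nil hn)
  have haw : a ≤ n - P.N := hhead a (by simp)
  have hwn : n - P.N ≤ n := Nat.sub_le _ _
  have han : a < n := hinv.lt a (by simp)
  have hna : n ≤ a + 8 * P.N ^ 2 := by
    have := hinv.size_le a (by simp)
    simp only [Params.maxSize] at this
    omega
  have hout : (freqAlgorithm P).output ω x n =
      freqReport P (bucketAt ω x a n :: l.map (bucketAt ω x · n)) := by
    change freqReport P ((freqAlgorithm P).run ω x n) = _
    rw [hl]
    rfl
  have hW : winL2 P.N x n = √(segF2 x (n - P.N) n) := rfl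
  have hwf : ∀ i, (winFreq P.N x n i : ℝ) = freqVec x (n - P.N) n i := fun _ => rfl
  have hE := sqrt_expired_le hε (hinv.segF2_expired_le hP hA le_rfl (by simp) haw hna)
  have htri := sqrt_segF2_le_add x haw hwn
  have hWA := Real.sqrt_le_sqrt (segF2_mono_left x haw hwn)
  obtain ⟨hL1, hL2⟩ := hA.l2 a han hna
  have hApos : 0 < √(segF2 x a n) := Real.sqrt_pos.2 (segF2_pos x han)
  have hApow : ∑ i, (freq x a n i : ℝ) ^ 2 = √(segF2 x a n) ^ 2 :=
    (Real.sq_sqrt (segF2_nonneg x a n)).symm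
  have hcand : CandInv P (bucketAt ω x a n).cand (freq x a n)
      (P.γ * P.ε / 8 * √(segF2 x a n)) := by
    refine bucketAt_candInv ω x han.le fun s has hsn => (hA.cs a s has hsn hna).trans ?_
    gcongr
    exact segF2_mono_right x (by omega) hsn
  rw [hout]
  simp only [hwf, hW, mem_freqReport]
  set A := √(segF2 x a n)
  set W := √(segF2 x (n - P.N) n)
  set L := l2Estimate P (bucketAt ω x a n).l2
  have hγA : 0 < P.γ * A := mul_pos hγ hApos
  have hWA' : (1 - 3 / 4 * P.ε) * A ≤ W := by linarith
  have hW0 : 0 ≤ W := Real.sqrt_nonneg _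
  constructor
  · intro i hi
    have h1 : (1 + 2 * P.ε) * (P.γ * A) ≤ freqVec x a n i := by
      have h2 : freqVec x (n - P.N) n i ≤ freqVec x a n i := by
        rw [freqVec_add x haw hwn]
        linarith [freqVec_nonneg x a (n - P.N) i]
      have h3 : (1 + 4 * P.ε) * P.γ * ((1 - 3 / 4 * P.ε) * A) ≤ (1 + 4 * P.ε) * P.γ * W := by
        gcongr
      have h4 : 1 + 2 * P.ε ≤ (1 + 4 * P.ε) * (1 - 3 / 4 * P.ε) := by nlinarith
      have h5 := mul_le_mul_of_nonneg_right h4 hγA.le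
      linarith
    have hmem := hcand.mem_of_le hγ hApos hApow (by positivity) (q := i) (by
      have : (freq x a n i : ℝ) = freqVec x a n i := rfl
      rw [this]
      nlinarith)
    obtain ⟨⟨j, v⟩, hv, rfl⟩ := List.mem_map.1 hmem
    refine ⟨v, hv, ?_⟩
    have hacc := (abs_le.1 (hcand.accurate _ hv)).1
    have h6 : (freq x a n j : ℝ) = freqVec x a n j := rfl
    simp only [h6] at hacc
    have h7 : 1 / (1 + P.ε) * P.γ * L ≤ P.γ * A := by
      calc 1 / (1 + P.ε) * P.γ * L ≤ 1 / (1 + P.ε) * P.γ * ((1 + P.ε) * A) := by gcongr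
        _ = P.γ * A := by field_simp
    simp only at h1 ⊢
    nlinarith
  · rintro i hi ⟨v, hv, hlt⟩
    have hacc := (abs_le.1 (hcand.accurate _ hv)).2
    have h6 : (freq x a n i : ℝ) = freqVec x a n i := rfl
    simp only [h6, freqVec_add x haw hwn] at hacc
    have h7 : (1 - 2 * P.ε) * (P.γ * A) ≤ 1 / (1 + P.ε) * P.γ * L := by
      calc (1 - 2 * P.ε) * (P.γ * A) ≤ (1 / (1 + P.ε) * (1 - P.ε)) * (P.γ * A) := by
            gcongr
            rw [one_div_mul_eq_div, le_div_iff₀ (by linarith)]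
            nlinarith
        _ = 1 / (1 + P.ε) * P.γ * ((1 - P.ε) * A) := by ring
        _ ≤ _ := by gcongr
    have h8 := (freqVec_le_sqrt_segF2 x a (n - P.N) i).trans hE
    have h9 : (1 - 4 / P.γ * P.ε) * P.γ * W = (P.γ - 4 * P.ε) * W := by field_simp
    rw [h9] at hi
    have h10 : P.ε * (P.γ * A) ≤ P.ε * A := by
      gcongr
      nlinarith
    have h0 := freqVec_nonneg x (n - P.N) n i
    have h11 : 0 < P.γ - 4 * P.ε := by
      by_contra hcon
      nlinarith
    have h12 : (P.γ - 4 * P.ε) * W ≤ (P.γ - 4 * P.ε) * A := by gcongr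
    have h13 : 0 < P.ε * A := mul_pos hε hApos
    linarith

end Output

/-! ### Accuracy of a single row -/

section Rows

open scoped BigOperators

variable {P : Params}

theorem u_le_two_pow (P : Params) : P.u ≤ 2 ^ (P.hashBits + 1) := by
  calc P.u ≤ 2 ^ Nat.clog 2 P.u := Nat.le_pow_clog (by norm_num) _
    _ ≤ 2 ^ (P.hashBits + 1) := Nat.pow_le_pow_right (by norm_num)
        ((le_max_left _ _).trans (Nat.le_succ _))

theorem cellBits_le (P : Params) : P.cellBits ≤ P.hashBits + 1 :=
  (le_max_right _ _).trans (Nat.le_succ _)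

theorem le_two_pow_cellBits (P : Params) :
    256 / (P.γ ^ 2 * P.csEps ^ 2) ≤ (2 : ℝ) ^ P.cellBits := by
  refine (Nat.le_ceil _).trans ?_
  have h : ⌈256 / (P.γ ^ 2 * P.csEps ^ 2)⌉₊ ≤ 2 ^ P.cellBits := Nat.le_pow_clog (by norm_num) _
  exact_mod_cast h

theorem le_cols (P : Params) : P.κ / P.ε ^ 2 ≤ P.cols := Nat.le_ceil _

theorem cols_pos (hP : P.Valid) : (0 : ℝ) < P.cols := by
  refine lt_of_lt_of_le ?_ (le_cols P)
  rw [hP.κ_eq]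
  have := hP.ε_pos
  positivity

/-- Random choices of a row of the `L₂` sketch. -/
abbrev L2Seed (P : Params) : Type := Fin P.cols → Fin 4 → P.Word

/-- The unnormalized estimate of the inner product of `f` and `g` by a row of the `L₂` sketch. -/
noncomputable def rowInner (ρ : L2Seed P) (f g : Fin P.u → ℝ) : ℝ :=
  ∑ c, signedSum P.hashBits (ρ c) f * signedSum P.hashBits (ρ c) g

/-- The row fails to estimate the inner product of `f` and `g`. -/
def RowFails (ρ : L2Seed P) (f g : Fin P.u → ℝ) : Prop :=
  P.cols * (P.ε / 32) * √((∑ i, f i ^ 2) * ∑ i, g i ^ 2) <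
    |rowInner ρ f g - P.cols * ∑ i, f i * g i|

theorem pr_rowFails_le (hP : P.Valid) {f g : Fin P.u → ℝ} (hf : ∀ i, 0 ≤ f i) (hg : ∀ i, 0 ≤ g i)
    (hf0 : 0 < ∑ i, f i ^ 2) (hg0 : 0 < ∑ i, g i ^ 2) :
    pr (fun ρ : L2Seed P => RowFails ρ f g) ≤ 1 / 32 := by
  have hc := cols_pos hP
  have hε := hP.ε_pos
  have hFG : 0 < (∑ i, f i ^ 2) * ∑ i, g i ^ 2 := mul_pos hf0 hg0
  have h := pr_sum_deviation_le P.cols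
    (fun a : Fin 4 → P.Word => signedSum P.hashBits a f * signedSum P.hashBits a g)
    (expect_signedSum_mul (u_le_two_pow P) (by norm_num) f g)
    (expect_sq_signedSum_mul_le (u_le_two_pow P) le_rfl hf hg)
    (T := P.cols * (P.ε / 32) * √((∑ i, f i ^ 2) * ∑ i, g i ^ 2)) (by positivity)
  refine h.trans ?_
  rw [mul_pow, Real.sq_sqrt hFG.le, div_le_iff₀ (by positivity)]
  have hk := le_cols P
  rw [hP.κ_eq, div_le_iff₀ (by positivity)] at hk
  have := mul_le_mul_of_nonneg_left hk (mul_pos hc hFG).le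
  nlinarith

variable (ω : P.Seed) (x : ℕ → Fin P.u)

theorem cast_sum_sq_l2 {a t : ℕ} (h : a ≤ t) (r : Fin P.rows) :
    ((∑ c, (bucketAt ω x a t).l2 r c ^ 2 : ℤ) : ℝ) =
      rowInner (ω.2 r) (freqVec x a t) (freqVec x a t) := by
  push_cast
  refine Finset.sum_congr rfl fun c _ => ?_
  rw [bucketAt_l2 ω x h, sq]

theorem rowInner_self_nonneg (ρ : L2Seed P) (f : Fin P.u → ℝ) : 0 ≤ rowInner ρ f f :=
  Finset.sum_nonneg fun _ _ => mul_self_nonneg _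

theorem rowInner_sub {a b t : ℕ} (hab : a ≤ b) (hbt : b ≤ t) (ρ : L2Seed P) :
    rowInner ρ (freqVec x a b) (fun i => freqVec x a t i + freqVec x b t i) =
      rowInner ρ (freqVec x a t) (freqVec x a t) - rowInner ρ (freqVec x b t) (freqVec x b t) := by
  rw [rowInner, rowInner, rowInner, ← Finset.sum_sub_distrib]
  refine Finset.sum_congr rfl fun c _ => ?_
  have h1 : signedSum P.hashBits (ρ c) (fun i => freqVec x a t i + freqVec x b t i) =
      signedSum P.hashBits (ρ c) (freqVec x a t) + signedSum P.hashBits (ρ c) (freqVec x b t) := by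
    simp only [signedSum, add_mul, Finset.sum_add_distrib]
  have h2 : signedSum P.hashBits (ρ c) (freqVec x a t) =
      signedSum P.hashBits (ρ c) (freqVec x a b) + signedSum P.hashBits (ρ c) (freqVec x b t) := by
    simp only [signedSum, freqVec_add x hab hbt, add_mul, Finset.sum_add_distrib]
  rw [h1, h2]
  ring

theorem sum_freqVec_mul_add {a b t : ℕ} (hab : a ≤ b) (hbt : b ≤ t) :
    ∑ i, freqVec x a b i * (freqVec x a t i + freqVec x b t i) =
      segF2 x a t - segF2 x b t := by
  rw [segF2, segF2, ← Finset.sum_sub_distrib]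
  refine Finset.sum_congr rfl fun i _ => ?_
  rw [freqVec_add x hab hbt]
  ring

/-- The row fails to compare the segments `[a, t)` and `[b, t)`. -/
def TestFails (ρ : L2Seed P) (a b t : ℕ) : Prop :=
  RowFails ρ (freqVec x a t) (freqVec x a t) ∨
    RowFails ρ (freqVec x a b) (fun i => freqVec x a t i + freqVec x b t i)

theorem pr_testFails_le (hP : P.Valid) {a b t : ℕ} (hab : a < b) (hbt : b < t) :
    pr (fun ρ : L2Seed P => TestFails x ρ a b t) ≤ 1 / 15 := by
  have hA : 0 < ∑ i, freqVec x a t i ^ 2 := segF2_pos x (hab.trans hbt)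
  have h1 := pr_rowFails_le hP (freqVec_nonneg x a t) (freqVec_nonneg x a t) hA hA
  have h2 := pr_rowFails_le hP (freqVec_nonneg x a b)
    (g := fun i => freqVec x a t i + freqVec x b t i)
    (fun i => add_nonneg (freqVec_nonneg x a t i) (freqVec_nonneg x b t i)) (segF2_pos x hab)
    (hA.trans_le (Finset.sum_le_sum fun i _ => by
      have := freqVec_nonneg x b t i
      have := freqVec_nonneg x a t i
      gcongr
      linarith))
  refine (pr_or_le _ _).trans ((add_le_add h1 h2).trans (by norm_num))

theorem not_rowFails_self {a t : ℕ} {ρ : L2Seed P}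
    (h : ¬ RowFails ρ (freqVec x a t) (freqVec x a t)) :
    |rowInner ρ (freqVec x a t) (freqVec x a t) - P.cols * segF2 x a t| ≤
      P.cols * (P.ε / 32) * segF2 x a t := by
  have h := not_lt.1 h
  have e1 : ∑ i, freqVec x a t i ^ 2 = segF2 x a t := rfl
  have e2 : ∑ i, freqVec x a t i * freqVec x a t i = segF2 x a t :=
    Finset.sum_congr rfl fun i _ => (sq _).symm
  rwa [e1, e2, Real.sqrt_mul_self (segF2_nonneg x a t)] at h

theorem not_testFails_diff (hP : P.Valid) {a b t : ℕ} (hab : a ≤ b) (hbt : b ≤ t) {ρ : L2Seed P}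
    (h : ¬ RowFails ρ (freqVec x a b) (fun i => freqVec x a t i + freqVec x b t i)) :
    (rowInner ρ (freqVec x a t) (freqVec x a t) - rowInner ρ (freqVec x b t) (freqVec x b t) -
      P.cols * (segF2 x a t - segF2 x b t)) ^ 2 ≤
      P.cols ^ 2 * (P.β / 32 * (segF2 x a t - segF2 x b t) * segF2 x a t) := by
  have hε := hP.ε_pos
  have h := not_lt.1 h
  rw [rowInner_sub x hab hbt, sum_freqVec_mul_add x hab hbt] at h
  rw [← sq_abs]
  have hP0 : 0 ≤ ∑ i, freqVec x a b i ^ 2 := segF2_nonneg x a b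
  have hg0 : 0 ≤ ∑ i, (freqVec x a t i + freqVec x b t i) ^ 2 :=
    Finset.sum_nonneg fun _ _ => sq_nonneg _
  have hP1 : ∑ i, freqVec x a b i ^ 2 ≤ segF2 x a t - segF2 x b t := by
    have := segF2_add_le x hab hbt
    simp only [segF2] at this ⊢
    linarith
  have hg1 : ∑ i, (freqVec x a t i + freqVec x b t i) ^ 2 ≤ 4 * segF2 x a t := by
    rw [segF2, Finset.mul_sum]
    refine Finset.sum_le_sum fun i _ => ?_
    have h1 := freqVec_nonneg x a b i
    have h2 := freqVec_nonneg x b t i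
    rw [freqVec_add x hab hbt]
    nlinarith
  calc _ ≤ (P.cols * (P.ε / 32) * √((∑ i, freqVec x a b i ^ 2) *
        ∑ i, (freqVec x a t i + freqVec x b t i) ^ 2)) ^ 2 := by gcongr
    _ = (P.cols * (P.ε / 32)) ^ 2 * ((∑ i, freqVec x a b i ^ 2) *
        ∑ i, (freqVec x a t i + freqVec x b t i) ^ 2) := by
      rw [mul_pow _ (√_), Real.sq_sqrt (mul_nonneg hP0 hg0)]
    _ ≤ (P.cols * (P.ε / 32)) ^ 2 * ((segF2 x a t - segF2 x b t) * (4 * segF2 x a t)) := by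
      gcongr
      exact hP0.trans hP1
    _ = _ := by rw [β_eq]; ring

/-- The test of the histogram as performed by a single row. -/
theorem row_test_iff (hP : P.Valid) {a b t : ℕ} (hab : a ≤ b) (hbt : b ≤ t) (r : Fin P.rows) :
    (1 - P.β) * l2Row P (bucketAt ω x a t).l2 r ≤ l2Row P (bucketAt ω x b t).l2 r ↔
      (1 - P.β) ^ 2 * rowInner (ω.2 r) (freqVec x a t) (freqVec x a t) ≤
        rowInner (ω.2 r) (freqVec x b t) (freqVec x b t) := by
  have hc := cols_pos hP
  have hβ : 0 ≤ 1 - P.β := by rw [β_eq]; nlinarith [hP.ε_pos, hP.ε_lt]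
  rw [l2Row, l2Row, cast_sum_sq_l2 ω x (hab.trans hbt), cast_sum_sq_l2 ω x hbt,
    ← Real.sqrt_sq hβ, ← Real.sqrt_mul (sq_nonneg _), Real.sqrt_sq hβ, Real.sqrt_le_sqrt_iff
      (div_nonneg (rowInner_self_nonneg _ _) hc.le), mul_div_assoc', div_le_div_iff_of_pos_right hc]

theorem row_close_of (hP : P.Valid) {a b t : ℕ} (hab : a < b) (hbt : b < t) (r : Fin P.rows)
    (h : ¬ TestFails x (ω.2 r) a b t)
    (hD : segF2 x a t - segF2 x b t ≤ P.β / 2 * segF2 x a t) :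
    (1 - P.β) * l2Row P (bucketAt ω x a t).l2 r ≤ l2Row P (bucketAt ω x b t).l2 r := by
  rw [row_test_iff ω x hP hab.le hbt.le]
  rw [TestFails, not_or] at h
  have h1 := not_rowFails_self x h.1
  have h2 := not_testFails_diff x hP hab.le hbt.le h.2
  have hc := cols_pos hP
  have hε := hP.ε_pos
  have hε1 := hP.ε_lt
  have hβ : 0 < P.β := by rw [β_eq]; positivity
  have hβ1 : P.β < 1 / 8 := by rw [β_eq]; nlinarith
  have hF := segF2_pos x (hab.trans hbt)
  generalize rowInner (ω.2 r) (freqVec x a t) (freqVec x a t) = SA at *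
  generalize rowInner (ω.2 r) (freqVec x b t) (freqVec x b t) = SB at *
  generalize hDD : segF2 x a t - segF2 x b t = D at *
  generalize segF2 x a t = F at *
  have hβF : 0 < P.β * F := mul_pos hβ hF
  have h3 : |SA - SB - P.cols * D| ≤ P.cols * (P.β * F / 8) := by
    refine abs_le_of_sq_le_sq (h2.trans ?_) (by positivity)
    have : P.β / 32 * D * F ≤ (P.β * F / 8) ^ 2 := by nlinarith
    rw [mul_pow]
    gcongr
  have h4 := (abs_le.1 h3).2
  have h5 := (abs_le.1 h1).1
  have h6 : P.cols * D ≤ P.cols * (P.β / 2 * F) := by gcongr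
  have hcF : 0 < P.cols * F := mul_pos hc hF
  have h7 : 3 / 4 * (P.cols * F) ≤ SA := by nlinarith
  have h8 : SA - SB ≤ 5 / 8 * P.β * (P.cols * F) := by nlinarith
  have h9 : P.β * (3 / 4 * (P.cols * F)) ≤ P.β * SA := by gcongr
  have h10 : 0 ≤ (1 - P.β) * (P.β * SA) := by
    have : 0 ≤ SA := by linarith
    have : 0 ≤ 1 - P.β := by linarith
    positivity
  have h11 : 0 < P.β * (P.cols * F) := mul_pos hβ hcF
  nlinarith

theorem row_not_close_of (hP : P.Valid) {a b t : ℕ} (hab : a < b) (hbt : b < t) (r : Fin P.rows)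
    (h : ¬ TestFails x (ω.2 r) a b t)
    (hD : 4 * P.β * segF2 x a t < segF2 x a t - segF2 x b t) :
    ¬ (1 - P.β) * l2Row P (bucketAt ω x a t).l2 r ≤ l2Row P (bucketAt ω x b t).l2 r := by
  rw [row_test_iff ω x hP hab.le hbt.le, not_le]
  rw [TestFails, not_or] at h
  have h1 := not_rowFails_self x h.1
  have h2 := not_testFails_diff x hP hab.le hbt.le h.2
  have hc := cols_pos hP
  have hε := hP.ε_pos
  have hε1 := hP.ε_lt
  have hβ : 0 < P.β := by rw [β_eq]; positivity
  have hF := segF2_pos x (hab.trans hbt)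
  have hS := rowInner_self_nonneg (ω.2 r) (freqVec x a t)
  generalize rowInner (ω.2 r) (freqVec x a t) (freqVec x a t) = SA at *
  generalize rowInner (ω.2 r) (freqVec x b t) (freqVec x b t) = SB at *
  generalize hDD : segF2 x a t - segF2 x b t = D at *
  generalize segF2 x a t = F at *
  have hβF : 0 < P.β * F := mul_pos hβ hF
  have hDpos : 0 < D := by linarith
  have h3 : |SA - SB - P.cols * D| ≤ P.cols * (D / 8) := by
    refine abs_le_of_sq_le_sq (h2.trans ?_) (by positivity)
    have : P.β / 32 * D * F ≤ (D / 8) ^ 2 := by nlinarith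
    rw [mul_pow]
    gcongr
  have h4 := (abs_le.1 h3).1
  have h5 := (abs_le.1 h1).2
  have hcF : 0 < P.cols * F := mul_pos hc hF
  have h6 : P.cols * (4 * P.β * F) < P.cols * D := by gcongr
  have h7 : SA ≤ 5 / 4 * (P.cols * F) := by nlinarith
  have h9 : P.β * SA ≤ P.β * (5 / 4 * (P.cols * F)) := by gcongr
  have h11 : 0 < P.β * (P.cols * F) := mul_pos hβ hcF
  nlinarith [mul_nonneg (sq_nonneg P.β) hS]

/-! ### Accuracy of the majority of the rows -/

theorem natCard_subtype_mono {r : ℕ} {p q : Fin r → Prop} (hpq : ∀ i, p i → q i) :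
    Nat.card {i // p i} ≤ Nat.card {i // q i} :=
  Nat.card_le_card_of_injective (Subtype.map id hpq)
    (Subtype.map_injective hpq Function.injective_id)

/-- If the test fails in less than half of the rows, it has the right outcome. -/
theorem close_of_majority (hP : P.Valid) {a b t : ℕ} (hab : a < b) (hbt : b < t)
    (h : 2 * Nat.card {r // TestFails x (ω.2 r) a b t} < P.rows) :
    (segF2 x a t - segF2 x b t ≤ P.β / 2 * segF2 x a t →
      Close (bucketAt ω x a t) (bucketAt ω x b t)) ∧
    (Close (bucketAt ω x a t) (bucketAt ω x b t) →
      segF2 x a t - segF2 x b t ≤ 4 * P.β * segF2 x a t) := by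
  classical
  have hcompl : ∀ p : Fin P.rows → Prop,
      Nat.card {r // p r} + Nat.card {r // ¬ p r} = P.rows := by
    intro p
    rw [Nat.card_eq_fintype_card, Nat.card_eq_fintype_card, Fintype.card_subtype_compl,
      Fintype.card_fin]
    have := Fintype.card_subtype_le p
    rw [Fintype.card_fin] at this
    omega
  constructor
  · intro hD
    have h1 := natCard_subtype_mono fun r hr => row_close_of ω x hP hab hbt r hr hD
    have h2 := hcompl fun r => TestFails x (ω.2 r) a b t
    rw [Close]
    omega
  · intro hC
    by_contra hD
    have h1 := natCard_subtype_mono fun r hr => row_not_close_of ω x hP hab hbt r hr (not_le.1 hD)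
    have h2 := hcompl fun r => TestFails x (ω.2 r) a b t
    have h3 := hcompl fun r =>
      (1 - P.β) * l2Row P (bucketAt ω x a t).l2 r ≤ l2Row P (bucketAt ω x b t).l2 r
    rw [Close] at hC
    omega

theorem l2Estimate_of_majority (hP : P.Valid) {a t : ℕ} (hat : a < t)
    (h : 2 * Nat.card {r // RowFails (ω.2 r) (freqVec x a t) (freqVec x a t)} < P.rows) :
    (1 - P.ε) * √(segF2 x a t) ≤ l2Estimate P (bucketAt ω x a t).l2 ∧
      l2Estimate P (bucketAt ω x a t).l2 ≤ (1 + P.ε) * √(segF2 x a t) := by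
  have hc := cols_pos hP
  have hε := hP.ε_pos
  have hε1 := hP.ε_lt
  have hF := segF2_pos x hat
  have hcF : 0 < P.cols * segF2 x a t := mul_pos hc hF
  have hmed := median_mem_Icc (fun r => ∑ c, (bucketAt ω x a t).l2 r c ^ 2)
    (lo := (1 - P.ε) * (P.cols * segF2 x a t)) (hi := (1 + P.ε) * (P.cols * segF2 x a t)) (by
      refine lt_of_le_of_lt (Nat.mul_le_mul_left 2 (natCard_subtype_mono fun r hr => ?_)) h
      contrapose! hr
      have h1 := abs_le.1 (not_rowFails_self x hr)
      rw [cast_sum_sq_l2 ω x hat.le]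
      constructor <;> nlinarith)
  rw [l2Estimate]
  have hdiv1 : (1 - P.ε) ^ 2 * segF2 x a t ≤
      (median (fun r => ∑ c, (bucketAt ω x a t).l2 r c ^ 2) : ℝ) / P.cols := by
    rw [le_div_iff₀ hc]
    refine le_trans ?_ hmed.1
    nlinarith [mul_pos hε hcF]
  have hdiv2 : (median (fun r => ∑ c, (bucketAt ω x a t).l2 r c ^ 2) : ℝ) / P.cols ≤
      (1 + P.ε) ^ 2 * segF2 x a t := by
    rw [div_le_iff₀ hc]
    refine hmed.2.trans ?_
    nlinarith [mul_pos hε hcF]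
  have hs1 := Real.sqrt_le_sqrt hdiv1
  have hs2 := Real.sqrt_le_sqrt hdiv2
  rw [Real.sqrt_mul (sq_nonneg _), Real.sqrt_sq (by linarith)] at hs1 hs2
  exact ⟨hs1, hs2⟩

/-- A row of CountSketch fails to estimate the frequency of `q` in `[a, t)`. -/
def CSFails (ab : (Fin 2 → P.Word) × (Fin 2 → P.Word)) (a t : ℕ) (q : Fin P.u) : Prop :=
  P.γ * P.ε / 8 * √(segF2 x a t) <
    |rowEstimate P.hashBits P.cellBits ab (freqVec x a t) q - freqVec x a t q|

theorem pr_csFails_le (hP : P.Valid) {a t : ℕ} (hat : a < t) (q : Fin P.u) :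
    pr (fun ab : (Fin 2 → P.Word) × (Fin 2 → P.Word) => CSFails x ab a t q) ≤ 1 / 15 := by
  have hε := hP.ε_pos
  have hγ := hP.γ_pos
  have hF := segF2_pos x hat
  have h := pr_le_of_expect_le (fun _ => sq_nonneg _)
    (T := (P.γ * P.ε / 8 * √(segF2 x a t)) ^ 2) (by positivity)
    (expect_sq_rowEstimate_sub_le (cellBits_le P) (u_le_two_pow P) (le_refl 2) (freqVec x a t) q)
  refine (pr_mono fun ab hab => ?_).trans (h.trans ?_)
  · rw [← sq_abs (_ - _)]
    have hab : P.γ * P.ε / 8 * √(segF2 x a t) < _ := hab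
    gcongr
  · have hb := le_two_pow_cellBits P
    rw [Params.csEps, div_le_iff₀ (by positivity)] at hb
    have e1 : ∑ i, freqVec x a t i ^ 2 = segF2 x a t := rfl
    rw [e1, mul_pow, Real.sq_sqrt hF.le, div_div, div_le_iff₀ (by positivity)]
    nlinarith [mul_le_mul_of_nonneg_left hb hF.le]

theorem csEstimate_of_majority {a t : ℕ} (hat : a ≤ t) (q : Fin P.u)
    (h : 2 * Nat.card {r // CSFails x (ω.1 r) a t q} < P.rows) :
    |(csEstimate P ω (bucketAt ω x a t).cs q : ℝ) - freq x a t q| ≤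
      P.γ * P.ε / 8 * √(segF2 x a t) := by
  have hmed := median_mem_Icc
    (fun r => csSign P ω r q * (bucketAt ω x a t).cs r (csCell P ω r q))
    (lo := freq x a t q - P.γ * P.ε / 8 * √(segF2 x a t))
    (hi := freq x a t q + P.γ * P.ε / 8 * √(segF2 x a t)) (by
      refine lt_of_le_of_lt (Nat.mul_le_mul_left 2 (natCard_subtype_mono fun r hr => ?_)) h
      contrapose! hr
      have h1 := abs_le.1 (not_lt.1 hr)
      have e1 : (freq x a t q : ℝ) = freqVec x a t q := rfl
      rw [csSign_mul_bucketAt_cs ω x hat, e1]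
      constructor <;> linarith)
  rw [abs_le, csEstimate]
  constructor <;> linarith [hmed.1, hmed.2]

end Rows

/-! ### The sketches are accurate with high probability -/

section UnionBound

variable {P : Params}

theorem half_pow_rows_le (hP : P.Valid) :
    ((8 * (P.N : ℝ) ^ 2 + 1) ^ 3 + (8 * (P.N : ℝ) ^ 2 + 1) ^ 2 + (8 * (P.N : ℝ) ^ 2 + 1)) *
      (1 / 2) ^ P.rows ≤ P.δ := by
  have hN : (2 : ℝ) ≤ P.N := by exact_mod_cast hP.two_le_N
  have hδ := hP.δ_pos
  have hδ1 := hP.δ_lt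
  set y : ℝ := P.N / (P.δ / 2) with hy
  have hyN : y = 2 * P.N / P.δ := by rw [hy]; field_simp
  have hy4 : 2 * (P.N : ℝ) ≤ y := by
    rw [hyN, le_div_iff₀ hδ]
    nlinarith
  have hypos : 0 < y := by linarith
  have hlogy : 0 < Real.log y := Real.log_pos (by linarith)
  have hrows : P.κ * Real.log y ≤ P.rows := Nat.le_ceil _
  rw [hP.κ_eq] at hrows
  have hpow : (1 / 2 : ℝ) ^ P.rows ≤ 1 / y ^ 14 := by
    rw [one_div_pow]
    gcongr
    have h14 : Real.log (y ^ 14) ≤ Real.log (2 ^ P.rows) := by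
      rw [Real.log_pow, Real.log_pow]
      push_cast
      nlinarith [Real.log_two_gt_d9]
    exact (Real.log_le_log_iff (by positivity) (by positivity)).1 h14
  set M : ℝ := 8 * (P.N : ℝ) ^ 2 + 1 with hM
  have hM1 : 1 ≤ M := by
    have := sq_nonneg (P.N : ℝ)
    linarith
  have hMN : M ≤ (2 * (P.N : ℝ)) ^ 4 := by
    have h2 : (4 : ℝ) ≤ (P.N : ℝ) ^ 2 := by nlinarith
    rw [hM]
    nlinarith
  have hsum : M ^ 3 + M ^ 2 + M ≤ (2 * (P.N : ℝ)) ^ 14 := by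
    have h1 : M ^ 2 ≤ M ^ 3 := pow_le_pow_right₀ hM1 (by norm_num)
    have h2 : M ≤ M ^ 3 := le_self_pow₀ hM1 (by norm_num)
    have h3 : M ^ 3 ≤ (2 * (P.N : ℝ)) ^ 12 := by
      calc M ^ 3 ≤ ((2 * (P.N : ℝ)) ^ 4) ^ 3 := by gcongr
        _ = _ := by rw [← pow_mul]
    have h4 : (3 : ℝ) ≤ (2 * (P.N : ℝ)) ^ 2 := by nlinarith
    calc M ^ 3 + M ^ 2 + M ≤ 3 * (2 * (P.N : ℝ)) ^ 12 := by linarith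
      _ ≤ (2 * (P.N : ℝ)) ^ 2 * (2 * (P.N : ℝ)) ^ 12 := by gcongr
      _ = _ := by rw [← pow_add]
  calc (M ^ 3 + M ^ 2 + M) * (1 / 2) ^ P.rows ≤ (2 * (P.N : ℝ)) ^ 14 * (1 / y ^ 14) := by
        gcongr
    _ = P.δ ^ 14 := by
        rw [hyN, div_pow]
        field_simp
    _ ≤ P.δ := pow_le_of_le_one hδ.le hδ1.le (by norm_num)

variable (x : ℕ → Fin P.u)

theorem pr_snd_majority_le {Ω Ω' : Type*} [Fintype Ω] [Fintype Ω'] [Nonempty Ω] [Nonempty Ω']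
    (r : ℕ) (bad : Ω → Prop) (h : pr bad ≤ 1 / 15) :
    pr (fun ω : Ω' × (Fin r → Ω) => r ≤ 2 * Nat.card {i // bad (ω.2 i)}) ≤ (1 / 2) ^ r := by
  rw [pr_snd fun ω : Fin r → Ω => r ≤ 2 * Nat.card {i // bad (ω i)}]
  exact pr_majority_le r bad h

theorem pr_fst_majority_le {Ω Ω' : Type*} [Fintype Ω] [Fintype Ω'] [Nonempty Ω] [Nonempty Ω']
    (r : ℕ) (bad : Ω → Prop) (h : pr bad ≤ 1 / 15) :
    pr (fun ω : (Fin r → Ω) × Ω' => r ≤ 2 * Nat.card {i // bad (ω.1 i)}) ≤ (1 / 2) ^ r := by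
  rw [pr_fst fun ω : Fin r → Ω => r ≤ 2 * Nat.card {i // bad (ω i)}]
  exact pr_majority_le r bad h

theorem pr_test_majority_le (hP : P.Valid) {a b t : ℕ} (hab : a < b) (hbt : b < t) :
    pr (fun ω : P.Seed => P.rows ≤ 2 * Nat.card {r // TestFails x (ω.2 r) a b t}) ≤
      (1 / 2) ^ P.rows :=
  pr_snd_majority_le P.rows (fun ρ : L2Seed P => TestFails x ρ a b t)
    (pr_testFails_le x hP hab hbt)

theorem pr_l2_majority_le (hP : P.Valid) {a t : ℕ} (hat : a < t) :
    pr (fun ω : P.Seed =>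
      P.rows ≤ 2 * Nat.card {r // RowFails (ω.2 r) (freqVec x a t) (freqVec x a t)}) ≤
      (1 / 2) ^ P.rows := by
  have hA : 0 < ∑ i, freqVec x a t i ^ 2 := segF2_pos x hat
  exact pr_snd_majority_le P.rows
    (fun ρ : L2Seed P => RowFails ρ (freqVec x a t) (freqVec x a t))
    ((pr_rowFails_le hP (freqVec_nonneg x a t) (freqVec_nonneg x a t) hA hA).trans (by norm_num))

theorem pr_cs_majority_le (hP : P.Valid) {a t : ℕ} (hat : a < t) (q : Fin P.u) :
    pr (fun ω : P.Seed => P.rows ≤ 2 * Nat.card {r // CSFails x (ω.1 r) a t q}) ≤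
      (1 / 2) ^ P.rows :=
  pr_fst_majority_le P.rows
    (fun ab : (Fin 2 → P.Word) × (Fin 2 → P.Word) => CSFails x ab a t q) (pr_csFails_le x hP hat q)

theorem pr_and_le_of_imp {Ω : Type*} [Fintype Ω] {c : Prop} {p : Ω → Prop} {B : ℝ} (hB : 0 ≤ B)
    (h : c → pr p ≤ B) : pr (fun ω => c ∧ p ω) ≤ B := by
  by_cases hc : c
  · exact (pr_mono fun ω hω => hω.2).trans (h hc)
  · refine le_trans (le_of_eq ?_) hB
    simp [pr, hc]

theorem pr_exists_le_card_mul {Ω ι : Type*} [Fintype Ω] (s : Finset ι) (p : ι → Ω → Prop) {B : ℝ}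
    (h : ∀ i, pr (p i) ≤ B) : pr (fun ω => ∃ i ∈ s, p i ω) ≤ s.card * B := by
  refine (pr_exists_le s p).trans ?_
  rw [← nsmul_eq_mul]
  exact Finset.sum_le_card_nsmul _ _ _ fun i _ => h i

theorem pr_not_accurate_le (hP : P.Valid) (n : ℕ) :
    pr (fun ω : P.Seed => ¬ Accurate ω x n) ≤ P.δ := by
  set I := Finset.Icc (n - 8 * P.N ^ 2) n with hI
  set B : ℝ := (1 / 2) ^ P.rows with hB
  have hB0 : 0 ≤ B := by positivity
  have hcard : (I.card : ℝ) ≤ 8 * (P.N : ℝ) ^ 2 + 1 := by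
    have : I.card ≤ 8 * P.N ^ 2 + 1 := by rw [hI, Nat.card_Icc]; omega
    exact_mod_cast this
  have h1 := pr_exists_le_card_mul (Ω := P.Seed) (I ×ˢ I ×ˢ I)
    (fun p ω => (p.1 < p.2.1 ∧ p.2.1 < p.2.2) ∧
      P.rows ≤ 2 * Nat.card {r // TestFails x (ω.2 r) p.1 p.2.1 p.2.2})
    (fun p => pr_and_le_of_imp hB0 fun h => pr_test_majority_le x hP h.1 h.2)
  have h2 := pr_exists_le_card_mul (Ω := P.Seed) (I ×ˢ I)
    (fun p ω => p.1 ≤ p.2 ∧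
      P.rows ≤ 2 * Nat.card {r // CSFails x (ω.1 r) p.1 (p.2 + 1) (x p.2)})
    (fun p => pr_and_le_of_imp hB0 fun h => pr_cs_majority_le x hP (Nat.lt_succ_of_le h) _)
  have h3 := pr_exists_le_card_mul (Ω := P.Seed) I
    (fun a ω => a < n ∧
      P.rows ≤ 2 * Nat.card {r // RowFails (ω.2 r) (freqVec x a n) (freqVec x a n)})
    (fun a => pr_and_le_of_imp hB0 fun h => pr_l2_majority_le x hP h)
  refine le_trans (pr_mono fun ω hω => ?_) (((pr_or_le _ _).trans (add_le_add
    ((pr_or_le _ _).trans (add_le_add h1 h2)) h3)).trans ?_)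
  · by_contra hcon
    simp only [not_or, not_exists, not_and, not_le, Prod.forall, Finset.mem_product] at hcon
    obtain ⟨⟨c1, c2⟩, c3⟩ := hcon
    have hmem : ∀ {a}, n ≤ a + 8 * P.N ^ 2 → a ≤ n → a ∈ I := fun h h' =>
      Finset.mem_Icc.2 ⟨by omega, h'⟩
    have htest : ∀ a b t, a < b → b < t → t ≤ n → n ≤ a + 8 * P.N ^ 2 → _ :=
      fun a b t hab hbt htn hna => close_of_majority ω x hP hab hbt
        (c1 a b t ⟨hmem hna (by omega), hmem (by omega) (by omega), hmem (by omega) htn⟩ ⟨hab, hbt⟩)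
    exact hω ⟨fun a b t hab hbt htn hna => (htest a b t hab hbt htn hna).1,
      fun a b t hab hbt htn hna => (htest a b t hab hbt htn hna).2,
      fun a han hna => l2Estimate_of_majority ω x hP han (c3 a (hmem hna han.le) han),
      fun a s has hsn hna => csEstimate_of_majority ω x (by omega) _
        (c2 a s ⟨hmem hna (by omega), hmem (by omega) hsn.le⟩ has)⟩
  · refine le_trans ?_ (half_pow_rows_le hP)
    simp only [Finset.card_product, Nat.cast_mul]
    rw [← hB]
    calc _ = ((I.card : ℝ) ^ 3 + (I.card : ℝ) ^ 2 + I.card) * B := by ring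
      _ ≤ _ := by gcongr

theorem freqAlgorithm_separates (hP : P.Valid) :
    (freqAlgorithm P).Separates P.N ((1 + 4 * P.ε) * P.γ) ((1 - 4 / P.γ * P.ε) * P.γ) P.δ := by
  intro x n hn
  have h1 : pr (fun ω : P.Seed => Accurate ω x n) =
      1 - pr (fun ω : P.Seed => ¬ Accurate ω x n) := by
    rw [pr_compl]; ring
  have h2 := pr_not_accurate_le x hP n
  refine le_trans (by linarith : 1 - P.δ ≤ pr (fun ω : P.Seed => Accurate ω x n)) ?_
  refine (pr_mono fun ω hω => output_correct hP hn hω).trans (le_of_eq ?_)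
  exact pr_eq_card_div _

end UnionBound

/-! ### Memory -/

section Memory

theorem length_arrayWords {α : Type*} {c : α → List ℤ} {L : ℕ} (h : ∀ a, (c a).length = L) {n : ℕ}
    (f : Fin n → α) : (arrayWords c f).length = n * L := by
  rw [arrayWords, List.length_flatten, List.map_ofFn, List.sum_ofFn]
  simp [h]

theorem mem_arrayWords {α : Type*} {c : α → List ℤ} {n : ℕ} {f : Fin n → α} {w : ℤ} :
    w ∈ arrayWords c f ↔ ∃ i, w ∈ c (f i) := by
  simp [arrayWords, List.mem_flatten]

theorem length_listWords_le {α : Type*} {c : α → List ℤ} {L : ℕ} {l : List α}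
    (h : ∀ a ∈ l, (c a).length ≤ L) : (listWords c l).length ≤ 1 + l.length * L := by
  rw [listWords, List.length_cons, List.length_flatMap, add_comm]
  have := List.sum_le_card_nsmul (l.map fun a => (c a).length) L (by simpa using h)
  simpa using this

theorem mem_listWords {α : Type*} {c : α → List ℤ} {l : List α} {w : ℤ} :
    w ∈ listWords c l ↔ w = l.length ∨ ∃ a ∈ l, w ∈ c a := by
  simp [listWords]

variable {P : Params}

/-- The words of the bucket are at most its size in absolute value. -/
structure Bucket.Small (A : Bucket P) : Prop where
  cs : ∀ r c, |A.cs r c| ≤ A.size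
  l2 : ∀ r c, |A.l2 r c| ≤ A.size
  cand : ∀ p ∈ A.cand, |p.2| ≤ A.size
  length_le : A.cand.length ≤ P.listLen

theorem abs_signHash (m : ℕ) {d : ℕ} (a : Fin d → Fin (2 ^ (m + 1))) (y : ℕ) :
    |signHash m a y| = 1 := by
  rw [signHash]; split_ifs <;> rfl

theorem abs_le_of_mem_candUpdate {H : Candidates P} {q : Fin P.u} {e B : ℤ}
    (hH : ∀ p ∈ H, |p.2| ≤ B) (he : |e| ≤ B + 1) : ∀ p ∈ candUpdate P H q e, |p.2| ≤ B + 1 := by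
  have hH' : ∀ p ∈ H, |p.2| ≤ B + 1 := fun p hp => (hH p hp).trans (by omega)
  rw [candUpdate]
  split_ifs
  · intro p hp
    obtain ⟨p', hp', rfl⟩ := List.mem_map.1 hp
    split_ifs
    · refine (abs_add_le _ _).trans ?_
      have := hH p' hp'
      simpa using this
    · exact hH' p' hp'
  · exact List.forall_mem_cons.2 ⟨he, hH'⟩
  · split
    · exact hH'
    · split_ifs
      · exact List.forall_mem_cons.2 ⟨he, fun p hp => hH' p (List.mem_of_mem_erase hp)⟩
      · exact hH'

theorem Bucket.Small.add {A : Bucket P} (h : A.Small) (ω : P.Seed) (q : Fin P.u) :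
    (Bucket.add ω q A).Small := by
  have hcs : ∀ r c, |csAdd P ω A.cs q r c| ≤ (A.size : ℤ) + 1 := by
    intro r c
    have h1 := h.cs r c
    rw [csAdd]
    split_ifs
    · refine (abs_add_le _ _).trans ?_
      rw [csSign, abs_signHash]
      omega
    · omega
  refine ⟨fun r c => ?_, fun r c => ?_, fun p hp => ?_, length_candUpdate_le h.length_le _ _⟩
  · simpa [Bucket.add] using hcs r c
  · have h1 := h.l2 r c
    simp only [Bucket.add, l2Add]
    refine (abs_add_le _ _).trans ?_
    rw [abs_signHash]
    push_cast
    omega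
  · simp only [Bucket.add]
    push_cast
    refine abs_le_of_mem_candUpdate h.cand ?_ p hp
    refine abs_median_le _ (by positivity) fun r => ?_
    rw [abs_mul, csSign, abs_signHash, one_mul]
    exact hcs r _

theorem bucketAt_small (ω : P.Seed) (x : ℕ → Fin P.u) (a t : ℕ) : (bucketAt ω x a t).Small := by
  have h0 : (Bucket.empty P).Small := by constructor <;> simp [Bucket.empty]
  rcases le_total t a with h | h
  · rwa [bucketAt_of_le ω x h]
  · exact bucketAt_induction ω x a (fun _ A => A.Small) h0 (fun t _ ih => ih.add ω (x t)) h

theorem length_bucketWords {A : Bucket P} (h : A.Small) :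
    (bucketWords P A).length ≤
      2 + P.rows * 2 ^ P.cellBits + 2 * P.listLen + P.rows * P.cols := by
  have h1 : (arrayWords (arrayWords fun z => [z]) A.cs).length = P.rows * (2 ^ P.cellBits * 1) :=
    length_arrayWords (c := arrayWords fun z => [z])
      (fun f => length_arrayWords (c := fun z : ℤ => [z]) (fun _ => rfl) f) _
  have h2 : (arrayWords (arrayWords fun z => [z]) A.l2).length = P.rows * (P.cols * 1) :=
    length_arrayWords (c := arrayWords fun z => [z])
      (fun f => length_arrayWords (c := fun z : ℤ => [z]) (fun _ => rfl) f) _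
  have h3 := length_listWords_le (c := fun p : Fin P.u × ℤ => [((p.1 : ℕ) : ℤ)] ++ [p.2])
    (L := 2) (l := A.cand) (fun _ _ => le_rfl)
  have h4 := h.length_le
  rw [bucketWords, List.length_append, List.length_append, List.length_append, h1, h2,
    mul_one, mul_one]
  simp only [List.length_singleton]
  omega

theorem length_seedWords (ω : P.Seed) :
    (seedWords P ω).length = 4 * P.rows + 4 * (P.rows * P.cols) := by
  have h1 : (arrayWords (fun p : (Fin 2 → P.Word) × (Fin 2 → P.Word) =>
      arrayWords (fun z : P.Word => [((z : ℕ) : ℤ)]) p.1 ++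
        arrayWords (fun z : P.Word => [((z : ℕ) : ℤ)]) p.2) ω.1).length =
      P.rows * (2 * 1 + 2 * 1) :=
    length_arrayWords (fun p => by
      rw [List.length_append, length_arrayWords (L := 1) (fun _ => rfl),
        length_arrayWords (L := 1) (fun _ => rfl)]) _
  have h2 : (arrayWords (arrayWords (arrayWords fun z : P.Word => [((z : ℕ) : ℤ)])) ω.2).length =
      P.rows * (P.cols * (4 * 1)) :=
    length_arrayWords (c := arrayWords (arrayWords fun z : P.Word => [((z : ℕ) : ℤ)]))
      (fun f => length_arrayWords (c := arrayWords fun z : P.Word => [((z : ℕ) : ℤ)])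
        (fun g => length_arrayWords (c := fun z : P.Word => [((z : ℕ) : ℤ)]) (fun _ => rfl) g) f) _
  rw [seedWords, List.length_append, h1, h2]
  ring

theorem length_run_le (ω : P.Seed) (x : ℕ → Fin P.u) (t : ℕ) :
    List.length ((freqAlgorithm P).run ω x t) ≤ P.maxBuckets := by
  cases t with
  | zero => exact Nat.zero_le _
  | succ t =>
    change (histStep P ω _ _).length ≤ _
    simp only [histStep, List.length_drop]
    omega

theorem length_memory_le (hP : P.Valid) (ω : P.Seed) (x : ℕ → Fin P.u) (t : ℕ) :
    ((freqAlgorithm P).memory ω x t).length ≤ 4 * P.rows + 4 * (P.rows * P.cols) +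
      (1 + P.maxBuckets *
        (2 + P.rows * 2 ^ P.cellBits + 2 * P.listLen + P.rows * P.cols)) := by
  have h1 : ((freqAlgorithm P).memory ω x t).length = (seedWords P ω).length +
      (listWords (bucketWords P) ((freqAlgorithm P).run ω x t)).length :=
    List.length_append
  have h2 := length_run_le ω x t
  obtain ⟨l, hl, -⟩ := exists_histInv (ω := ω) (x := x) hP.two_le_N (one_le_maxBuckets hP) t
  rw [h1, length_seedWords]
  refine Nat.add_le_add_left ((length_listWords_le fun A hA => length_bucketWords ?_).trans
    (Nat.add_le_add_left (Nat.mul_le_mul_right _ h2) _)) _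
  rw [hl] at hA
  obtain ⟨a, -, rfl⟩ := List.mem_map.1 hA
  exact bucketAt_small ω x a t

/-! ### Sizes in terms of the parameters -/

section Sizes

theorem log_N_ge (hP : P.Valid) : 1 / 2 ≤ Real.log P.N := by
  have hN : (2 : ℝ) ≤ P.N := by exact_mod_cast hP.two_le_N
  have := Real.log_le_log (by norm_num) hN
  linarith [Real.log_two_gt_d9]

theorem log_N_le_log_div (hP : P.Valid) : Real.log P.N ≤ Real.log (P.N / P.δ) := by
  have hN : (2 : ℝ) ≤ P.N := by exact_mod_cast hP.two_le_N
  refine Real.log_le_log (by linarith) ?_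
  rw [le_div_iff₀ hP.δ_pos]
  nlinarith [hP.δ_lt]

theorem one_le_inv_sq_ε (hP : P.Valid) : 1 ≤ 1 / P.ε ^ 2 := by
  have := hP.ε_pos
  rw [le_div_iff₀ (by positivity)]
  nlinarith [hP.ε_lt]

theorem one_le_inv_sq_γ (hP : P.Valid) : 1 ≤ 1 / P.γ ^ 2 := by
  have := hP.γ_pos
  rw [le_div_iff₀ (by positivity)]
  nlinarith [hP.γ_lt]

theorem rows_le (hP : P.Valid) : (P.rows : ℝ) ≤ 300000 * Real.log (P.N / P.δ) := by
  have hN : (2 : ℝ) ≤ P.N := by exact_mod_cast hP.two_le_N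
  have hδ := hP.δ_pos
  have h1 := log_N_ge hP
  have h2 := log_N_le_log_div hP
  have h3 : Real.log (P.N / (P.δ / 2)) = Real.log 2 + Real.log (P.N / P.δ) := by
    rw [← Real.log_mul (by norm_num) (by positivity)]
    congr 1
    field_simp
  have h4 : Real.log 2 ≤ Real.log P.N := Real.log_le_log (by norm_num) hN
  have h5 := Real.log_pos (show (1 : ℝ) < 2 by norm_num)
  rw [Params.rows, hP.κ_eq, h3]
  have := Nat.ceil_lt_add_one (show 0 ≤ 100000 * (Real.log 2 + Real.log (P.N / P.δ)) by linarith)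
  linarith

theorem cols_le (hP : P.Valid) : (P.cols : ℝ) ≤ 200000 * (1 / P.ε ^ 2) := by
  have h1 := one_le_inv_sq_ε hP
  have h2 : P.κ / P.ε ^ 2 = 100000 * (1 / P.ε ^ 2) := by rw [hP.κ_eq]; ring
  rw [Params.cols, h2]
  have := Nat.ceil_lt_add_one (show 0 ≤ 100000 * (1 / P.ε ^ 2) by linarith)
  linarith

theorem maxBuckets_le (hP : P.Valid) :
    (P.maxBuckets : ℝ) ≤ 200000 * (1 / P.ε ^ 2 * Real.log P.N) := by
  have h1 := one_le_inv_sq_ε hP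
  have h3 := log_N_ge hP
  have h2 : P.κ / P.ε ^ 2 * Real.log P.N = 100000 * (1 / P.ε ^ 2 * Real.log P.N) := by
    rw [hP.κ_eq]; ring
  have h4 : 1 / 2 ≤ 1 / P.ε ^ 2 * Real.log P.N := by nlinarith
  rw [Params.maxBuckets, h2]
  have := Nat.ceil_lt_add_one (show 0 ≤ 100000 * (1 / P.ε ^ 2 * Real.log P.N) by linarith)
  linarith

theorem two_pow_clog_le {k : ℕ} (hk : 1 ≤ k) : 2 ^ Nat.clog 2 k ≤ 2 * k := by
  rcases hk.eq_or_lt with rfl | h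
  · simp
  · have h1 := Nat.pow_pred_clog_lt_self Nat.one_lt_two h
    obtain ⟨j, hj⟩ := Nat.exists_eq_succ_of_ne_zero (Nat.clog_pos Nat.one_lt_two h).ne'
    rw [hj, Nat.pred_succ] at h1
    rw [hj, pow_succ']
    omega

theorem two_pow_cellBits_le (hP : P.Valid) :
    (2 : ℝ) ^ P.cellBits ≤ 10000 * (1 / P.γ ^ 2 * (1 / P.ε ^ 2)) := by
  have h1 := one_le_inv_sq_ε hP
  have h2 := one_le_inv_sq_γ hP
  have h3 : 256 / (P.γ ^ 2 * P.csEps ^ 2) = 4096 * (1 / P.γ ^ 2 * (1 / P.ε ^ 2)) := by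
    have := hP.γ_pos
    have := hP.ε_pos
    rw [Params.csEps]
    field_simp
    norm_num
  have h4 : 1 ≤ 1 / P.γ ^ 2 * (1 / P.ε ^ 2) := by nlinarith
  rw [Params.cellBits, h3]
  generalize 1 / P.γ ^ 2 * (1 / P.ε ^ 2) = z at h4
  have h5 := Nat.ceil_lt_add_one (show 0 ≤ 4096 * z by linarith)
  have h6 : (2 : ℝ) ^ Nat.clog 2 ⌈4096 * z⌉₊ ≤ 2 * ⌈4096 * z⌉₊ := by
    exact_mod_cast two_pow_clog_le (Nat.one_le_iff_ne_zero.2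
      (Nat.ceil_pos.2 (by linarith : 0 < 4096 * z)).ne')
  linarith

theorem listLen_le (hP : P.Valid) : (P.listLen : ℝ) ≤ 2 * (1 / P.γ ^ 2) := by
  have h2 := one_le_inv_sq_γ hP
  rw [Params.listLen]
  push_cast
  have := Nat.floor_le (show 0 ≤ 1 / P.γ ^ 2 by linarith)
  linarith

theorem freqAlgorithm_usesWords (hP : P.Valid) :
    (freqAlgorithm P).UsesWords (10 ^ 17 * (1 / (P.γ ^ 2 * P.ε ^ 4) * Real.log P.N *
      Real.log (P.N / P.δ) + 1 / P.ε ^ 4 * Real.log P.N * Real.log (1 / P.ε))) := by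
  intro ω x t
  have h0 : (((freqAlgorithm P).memory ω x t).length : ℝ) ≤ _ :=
    Nat.cast_le.2 (length_memory_le hP ω x t)
  refine h0.trans ?_
  push_cast
  have hε := hP.ε_pos
  have hγ := hP.γ_pos
  have hlog : 0 ≤ 1 / P.ε ^ 4 * Real.log P.N * Real.log (1 / P.ε) := by
    have : 0 ≤ Real.log (1 / P.ε) := Real.log_nonneg (by
      rw [le_div_iff₀ hε]; linarith [hP.ε_lt])
    have := log_N_ge hP
    positivity
  have hX : 1 / (P.γ ^ 2 * P.ε ^ 4) * Real.log P.N * Real.log (P.N / P.δ) =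
      1 / P.γ ^ 2 * (1 / P.ε ^ 2) ^ 2 * Real.log P.N * Real.log (P.N / P.δ) := by
    congr 2
    field_simp
  rw [hX]
  have h1 := one_le_inv_sq_ε hP
  have h2 := one_le_inv_sq_γ hP
  have h3 := log_N_ge hP
  have h4 := h3.trans (log_N_le_log_div hP)
  have b1 := rows_le hP
  have b2 := cols_le hP
  have b3 := maxBuckets_le hP
  have b4 := two_pow_cellBits_le hP
  have b5 := listLen_le hP
  generalize 1 / P.ε ^ 4 * Real.log P.N * Real.log (1 / P.ε) = Y at hlog
  generalize 1 / P.ε ^ 2 = e at *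
  generalize 1 / P.γ ^ 2 = g at *
  generalize Real.log P.N = v at *
  generalize Real.log (P.N / P.δ) = w at *
  have t1 : (P.rows : ℝ) * P.cols ≤ 300000 * w * (200000 * e) := by gcongr
  have t2 : (P.rows : ℝ) * 2 ^ P.cellBits ≤ 300000 * w * (10000 * (g * e)) := by gcongr
  have hw : 1 ≤ 2 * w := by linarith
  have hv : 1 ≤ 2 * v := by linarith
  have he2 : e ≤ e ^ 2 := by nlinarith
  have hge : 1 ≤ g * e := by nlinarith
  have hwge : w ≤ w * (g * e) := by nlinarith
  have hwe : w * e ≤ w * (g * e) := by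
    nlinarith [mul_pos (by linarith : 0 < w) (by linarith : 0 < e)]
  have hg : g ≤ 2 * (w * (g * e)) := by
    have : g ≤ g * e := by nlinarith
    nlinarith
  have h1w : 1 ≤ 2 * (w * (g * e)) := by linarith
  set s := w * (g * e) with hs
  have t3 : (2 + (P.rows : ℝ) * 2 ^ P.cellBits + 2 * P.listLen + P.rows * P.cols) ≤
      7 * 10 ^ 10 * s := by nlinarith
  have t4 : (P.maxBuckets : ℝ) *
      (2 + (P.rows : ℝ) * 2 ^ P.cellBits + 2 * P.listLen + P.rows * P.cols) ≤
      200000 * (e * v) * (7 * 10 ^ 10 * s) := by gcongr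
  have t5 : s ≤ 2 * (e * v * s) := by
    have : 1 ≤ 2 * (e * v) := by nlinarith
    nlinarith
  have hfin : g * e ^ 2 * v * w = e * v * s := by rw [hs]; ring
  rw [hfin]
  nlinarith

end Sizes

end Memory

section WordSize

variable {P : Params}

/-- A bound for all words, in terms of a number `b` that bounds the parameters. -/
theorem mem_memory_le (hP : P.Valid) {b : ℝ} (hb : 1 ≤ b) (hu : P.u ≤ b) (hN : 2 * (P.N : ℝ) ≤ b)
    (hγ : 1 / P.γ * (1 / P.ε) ≤ b) (ω : P.Seed) (x : ℕ → Fin P.u) (t : ℕ) :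
    ∀ w ∈ (freqAlgorithm P).memory ω x t, |(w : ℝ)| ≤ 200000 * b ^ 3 := by
  have hγ0 := hP.γ_pos
  have hε0 := hP.ε_pos
  have hb2 : b ^ 2 ≤ b ^ 3 := pow_le_pow_right₀ hb (by norm_num)
  have hb1 : b ≤ b ^ 2 := le_self_pow₀ hb (by norm_num)
  have hz : 1 / P.γ ^ 2 * (1 / P.ε ^ 2) ≤ b ^ 2 := by
    calc 1 / P.γ ^ 2 * (1 / P.ε ^ 2) = (1 / P.γ * (1 / P.ε)) ^ 2 := by
          rw [mul_pow, one_div_pow, one_div_pow]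
      _ ≤ b ^ 2 := by gcongr
  have hg1 := one_le_inv_sq_γ hP
  have he1 := one_le_inv_sq_ε hP
  have hg : 1 / P.γ ^ 2 ≤ b ^ 2 := by nlinarith
  have he : 1 / P.ε ^ 2 ≤ b ^ 2 := by nlinarith
  have hseed : ∀ z : P.Word, |(((z : ℕ) : ℤ) : ℝ)| ≤ 200000 * b ^ 3 := by
    intro z
    have hu1 : 1 ≤ P.u := Nat.one_le_iff_ne_zero.2 fun h0 => (Fin.cast h0 (x 0)).elim0
    have h1 : ((2 ^ Nat.clog 2 P.u : ℕ) : ℝ) ≤ 2 * P.u := by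
      exact_mod_cast two_pow_clog_le hu1
    have h2 := two_pow_cellBits_le hP
    have h3 : (2 : ℝ) ^ P.hashBits ≤ 10000 * b ^ 2 := by
      rw [Params.hashBits]
      rcases max_choice (Nat.clog 2 P.u) P.cellBits with h | h <;> rw [h]
      · push_cast at h1
        linarith
      · linarith
    have h4 : ((z : ℕ) : ℝ) ≤ (2 : ℝ) ^ (P.hashBits + 1) := by exact_mod_cast z.2.le
    have h5 : (2 : ℝ) ^ (P.hashBits + 1) = 2 ^ P.hashBits * 2 := pow_succ _ _
    rw [Int.cast_natCast, Nat.abs_cast]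
    linarith
  have hmax : (P.maxSize : ℝ) ≤ b ^ 2 := by
    rw [Params.maxSize]
    push_cast
    calc 4 * (P.N : ℝ) ^ 2 = (2 * (P.N : ℝ)) ^ 2 := by ring
      _ ≤ b ^ 2 := by gcongr
  intro w hw
  have hw : w ∈ seedWords P ω ∨ w ∈ listWords (bucketWords P) ((freqAlgorithm P).run ω x t) :=
    List.mem_append.1 hw
  rcases hw with hw | hw
  · simp only [seedWords, List.mem_append, mem_arrayWords, List.mem_singleton] at hw
    rcases hw with ⟨r, ⟨i, rfl⟩ | ⟨i, rfl⟩⟩ | ⟨r, c, i, rfl⟩ <;> exact hseed _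
  · rcases mem_listWords.1 hw with rfl | ⟨A, hA, hw⟩
    · have h1 : ((List.length ((freqAlgorithm P).run ω x t) : ℕ) : ℝ) ≤ P.maxBuckets :=
        Nat.cast_le.2 (length_run_le ω x t)
      have h2 := maxBuckets_le hP
      have h3 : Real.log P.N ≤ b := (Real.log_le_self (by positivity)).trans (by
        have : (0 : ℝ) ≤ P.N := by positivity
        linarith)
      have h4 : 1 / P.ε ^ 2 * Real.log P.N ≤ b ^ 2 * b := by
        have := log_N_ge hP
        gcongr
      rw [Int.cast_natCast, Nat.abs_cast]
      calc _ ≤ (P.maxBuckets : ℝ) := h1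
        _ ≤ 200000 * b ^ 3 := by nlinarith
    · obtain ⟨l, hl, hinv⟩ :=
        exists_histInv (ω := ω) (x := x) hP.two_le_N (one_le_maxBuckets hP) t
      rw [hl] at hA
      obtain ⟨a, ha, rfl⟩ := List.mem_map.1 hA
      have hsize : ((bucketAt ω x a t).size : ℝ) ≤ b ^ 2 := by
        refine le_trans (Nat.cast_le.2 ?_) hmax
        rw [bucketAt_size]
        exact hinv.size_le a ha
      have hsmall := bucketAt_small ω x a t
      have hle : ∀ z : ℤ, |z| ≤ (bucketAt ω x a t).size → |(z : ℝ)| ≤ 200000 * b ^ 3 := by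
        intro z hz
        have : |(z : ℝ)| ≤ (bucketAt ω x a t).size := by exact_mod_cast hz
        linarith
      simp only [bucketWords, List.mem_append, mem_arrayWords, mem_listWords,
        List.mem_singleton] at hw
      rcases hw with rfl | ⟨r, c, rfl⟩ | (rfl | ⟨p, hp, rfl | rfl⟩) | ⟨r, c, rfl⟩
      · exact hle _ (by simp)
      · exact hle _ (hsmall.cs r c)
      · have h1 : ((bucketAt ω x a t).cand.length : ℝ) ≤ P.listLen :=
          Nat.cast_le.2 hsmall.length_le
        have h2 := listLen_le hP
        rw [Int.cast_natCast, Nat.abs_cast]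
        linarith
      · have h1 : ((p.1 : ℕ) : ℝ) ≤ P.u := Nat.cast_le.2 p.1.2.le
        rw [Int.cast_natCast, Nat.abs_cast]
        linarith
      · exact hle _ (hsmall.cand p hp)
      · exact hle _ (hsmall.l2 r c)

theorem freqAlgorithm_wordsBoundedBy (hP : P.Valid) :
    (freqAlgorithm P).WordsBoundedBy ((2 * P.N * P.u / (P.γ * P.ε)) ^ 12) := by
  intro ω x t w hw
  have hγ := hP.γ_pos
  have hε := hP.ε_pos
  have hN : (2 : ℝ) ≤ P.N := by exact_mod_cast hP.two_le_N
  have hu : (1 : ℝ) ≤ P.u := by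
    exact_mod_cast Nat.one_le_iff_ne_zero.2 fun h0 => (Fin.cast h0 (x 0)).elim0
  set z := 1 / P.γ * (1 / P.ε) with hz
  have hz1 : 1 ≤ z := by
    have h1 : 1 ≤ 1 / P.γ := (one_le_div hγ).2 hP.γ_lt.le
    have h2 : 1 ≤ 1 / P.ε := (one_le_div hε).2 (by linarith [hP.ε_lt])
    exact one_le_mul_of_one_le_of_one_le h1 h2
  have hb : 2 * (P.N : ℝ) * P.u / (P.γ * P.ε) = 2 * P.N * P.u * z := by
    rw [hz]; field_simp
  rw [hb]
  set b := 2 * (P.N : ℝ) * P.u * z with hbdef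
  have hNu : 4 ≤ 2 * (P.N : ℝ) * P.u := by nlinarith
  have hb4 : 4 ≤ b := by nlinarith
  have h := mem_memory_le hP (b := b) (by linarith) (by nlinarith) (by nlinarith) (by nlinarith)
    ω x t w hw
  refine h.trans ?_
  have h9 : (200000 : ℝ) ≤ b ^ 9 := by
    calc (200000 : ℝ) ≤ 4 ^ 9 := by norm_num
      _ ≤ b ^ 9 := by gcongr
  calc 200000 * b ^ 3 ≤ b ^ 9 * b ^ 3 := by gcongr
    _ = b ^ 12 := by rw [← pow_add]

end WordSize

section Approximation

theorem StreamAlgorithm.UsesWords.mono {u : ℕ} {A : StreamAlgorithm u} {M M' : ℝ}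
    (h : A.UsesWords M) (hM : M ≤ M') : A.UsesWords M' := fun ω x n => (h ω x n).trans hM

theorem StreamAlgorithm.Separates.approximatesFrequent {u : ℕ} {A : StreamAlgorithm u} {N : ℕ}
    {γ ε δ hi lo : ℝ} (h : A.Separates N hi lo δ) (hhi : hi ≤ γ) (hlo : (1 - ε) * γ ≤ lo) :
    A.ApproximatesFrequent N γ ε δ := by
  intro x n hn
  refine (h x n hn).trans ?_
  have := A.seedFintype
  rw [StreamAlgorithm.prob, StreamAlgorithm.prob, ← pr_eq_card_div, ← pr_eq_card_div]
  have hW : 0 ≤ winL2 N x n := Real.sqrt_nonneg _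
  refine pr_mono fun ω hω => ⟨fun i hi' => hω.1 i ?_, fun i hi' => hω.2 i ?_⟩
  · exact (mul_le_mul_of_nonneg_right hhi hW).trans hi'.le
  · exact hi'.trans_le (mul_le_mul_of_nonneg_right hlo hW)

/-- The parameters with which the algorithm separates frequencies above `γ L₂` from those below
`(1 - ε) γ L₂`. -/
noncomputable def sharpParams (u N : ℕ) (γ ε δ : ℝ) : Params :=
  ⟨u, N, γ / (1 + 4 * (ε * γ / 16)), ε * γ / 16, δ, 100000⟩

variable {u N : ℕ} {γ ε δ : ℝ}

theorem sharpParams_valid (hN : 2 ≤ N) (hγ : 0 < γ) (hγ1 : γ < 1) (hε : 0 < ε) (hε1 : ε < 1)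
    (hδ : 0 < δ) (hδ1 : δ < 1) : (sharpParams u N γ ε δ).Valid := by
  have h1 : 0 < ε * γ := mul_pos hε hγ
  have h2 : ε * γ < 1 := by nlinarith
  refine ⟨hN, ?_, ?_, ?_, ?_, hδ, hδ1, rfl⟩ <;> simp only [sharpParams]
  · positivity
  · rw [div_lt_one (by positivity)]
    linarith
  · positivity
  · linarith

theorem sharpParams_inv_γ_le (hγ : 0 < γ) (hγ1 : γ < 1) (hε : 0 < ε) (hε1 : ε < 1) :
    1 / (sharpParams u N γ ε δ).γ ≤ 2 * (1 / γ) := by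
  have h2 : ε * γ < 1 := mul_lt_one_of_nonneg_of_lt_one_left hε.le hε1 hγ1.le
  simp only [sharpParams, one_div_div]
  rw [div_eq_mul_one_div]
  gcongr
  linarith

theorem sharpParams_inv_ε (hγ : 0 < γ) (hε : 0 < ε) :
    1 / (sharpParams u N γ ε δ).ε = 16 * (1 / ε * (1 / γ)) := by
  simp only [sharpParams]
  field_simp

theorem sharpParams_approximates (hN : 2 ≤ N) (hγ : 0 < γ) (hγ1 : γ < 1) (hε : 0 < ε) (hε1 : ε < 1)
    (hδ : 0 < δ) (hδ1 : δ < 1) :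
    (freqAlgorithm (sharpParams u N γ ε δ)).ApproximatesFrequent N γ ε δ := by
  have hP : (sharpParams u N γ ε δ).Valid := sharpParams_valid hN hγ hγ1 hε hε1 hδ hδ1
  refine (freqAlgorithm_separates hP).approximatesFrequent ?_ ?_
  · simp only [sharpParams]
    rw [mul_div_cancel₀]
    positivity
  · have h1 := hP.γ_pos
    have h2 : (1 - 4 / (sharpParams u N γ ε δ).γ * (sharpParams u N γ ε δ).ε) *
        (sharpParams u N γ ε δ).γ = (sharpParams u N γ ε δ).γ - 4 * (sharpParams u N γ ε δ).ε := by
      field_simp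
    rw [h2]
    simp only [sharpParams]
    have hεγ : 0 < ε * γ := mul_pos hε hγ
    have h3 : γ * (1 - 4 * (ε * γ / 16)) ≤ γ / (1 + 4 * (ε * γ / 16)) := by
      rw [le_div_iff₀ (by positivity)]
      nlinarith [mul_pos hγ (mul_pos hεγ hεγ)]
    nlinarith [mul_pos hεγ hγ]

open MvPolynomial in
/-- The memory bound, as a polynomial in `1 / ε`, `1 / γ`, `log N`, `log (1 / δ)`. -/
noncomputable def memoryPoly : MvPolynomial (Fin 4) ℝ :=
  C (10 ^ 17) * (C (4 * 16 ^ 4) * X 1 ^ 6 * X 0 ^ 4 * X 2 * (X 2 + X 3) +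
    C (16 ^ 5) * X 0 ^ 5 * X 1 ^ 5 * X 2)

theorem sharpParams_usesWords (hN : 2 ≤ N) (hγ : 0 < γ) (hγ1 : γ < 1) (hε : 0 < ε) (hε1 : ε < 1)
    (hδ : 0 < δ) (hδ1 : δ < 1) :
    (freqAlgorithm (sharpParams u N γ ε δ)).UsesWords
      (MvPolynomial.eval ![1 / ε, 1 / γ, Real.log N, Real.log (1 / δ)] memoryPoly) := by
  have hP : (sharpParams u N γ ε δ).Valid := sharpParams_valid hN hγ hγ1 hε hε1 hδ hδ1
  refine (freqAlgorithm_usesWords hP).mono ?_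
  have hG := sharpParams_inv_γ_le (u := u) (N := N) (δ := δ) hγ hγ1 hε hε1
  have hE := sharpParams_inv_ε (u := u) (N := N) (δ := δ) hγ hε
  have hγ' := hP.γ_pos
  have hε' := hP.ε_pos
  have hN0 : (0 : ℝ) < N := by positivity
  have hlogN : 0 ≤ Real.log N := Real.log_natCast_nonneg N
  have hlogδ : 0 ≤ Real.log (1 / δ) := Real.log_nonneg ((one_le_div hδ).2 hδ1.le)
  have hlog : Real.log (N / δ) = Real.log N + Real.log (1 / δ) := by
    rw [div_eq_mul_one_div, Real.log_mul hN0.ne' (by positivity)]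
  have hlogε : Real.log (1 / (sharpParams u N γ ε δ).ε) ≤ 16 * (1 / ε * (1 / γ)) :=
    (Real.log_le_self (by positivity)).trans hE.le
  have e1 : 1 / ((sharpParams u N γ ε δ).γ ^ 2 * (sharpParams u N γ ε δ).ε ^ 4) =
      (1 / (sharpParams u N γ ε δ).γ) ^ 2 * (16 * (1 / ε * (1 / γ))) ^ 4 := by
    rw [← hE, one_div_pow, one_div_pow, one_div_mul_one_div]
  have e2 : 1 / (sharpParams u N γ ε δ).ε ^ 4 = (16 * (1 / ε * (1 / γ))) ^ 4 := by
    rw [← hE, one_div_pow]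
  change 10 ^ 17 * (1 / ((sharpParams u N γ ε δ).γ ^ 2 * (sharpParams u N γ ε δ).ε ^ 4) *
    Real.log N * Real.log (N / δ) + 1 / (sharpParams u N γ ε δ).ε ^ 4 * Real.log N *
      Real.log (1 / (sharpParams u N γ ε δ).ε)) ≤ _
  rw [e1, e2, hlog]
  have hev : MvPolynomial.eval ![1 / ε, 1 / γ, Real.log N, Real.log (1 / δ)] memoryPoly =
      10 ^ 17 * (4 * 16 ^ 4 * (1 / γ) ^ 6 * (1 / ε) ^ 4 * Real.log N *
        (Real.log N + Real.log (1 / δ)) + 16 ^ 5 * (1 / ε) ^ 5 * (1 / γ) ^ 5 * Real.log N) := by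
    simp [memoryPoly]
  rw [hev]
  calc _ ≤ 10 ^ 17 * ((2 * (1 / γ)) ^ 2 * (16 * (1 / ε * (1 / γ))) ^ 4 * Real.log N *
        (Real.log N + Real.log (1 / δ)) + (16 * (1 / ε * (1 / γ))) ^ 4 * Real.log N *
          (16 * (1 / ε * (1 / γ)))) := by gcongr
    _ = _ := by ring

theorem sharpParams_wordsBoundedBy (hN : 2 ≤ N) (hγ : 0 < γ) (hγ1 : γ < 1) (hε : 0 < ε)
    (hε1 : ε < 1) (hδ : 0 < δ) (hδ1 : δ < 1) :
    (freqAlgorithm (sharpParams u N γ ε δ)).WordsBoundedBy ((2 * N * u / (γ * ε)) ^ 60) := by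
  have hP : (sharpParams u N γ ε δ).Valid := sharpParams_valid hN hγ hγ1 hε hε1 hδ hδ1
  intro ω x t w hw
  refine (freqAlgorithm_wordsBoundedBy hP ω x t w hw).trans ?_
  have hG := sharpParams_inv_γ_le (u := u) (N := N) (δ := δ) hγ hγ1 hε hε1
  have hE := sharpParams_inv_ε (u := u) (N := N) (δ := δ) hγ hε
  have hγ' := hP.γ_pos
  have hε' := hP.ε_pos
  have hN2 : (2 : ℝ) ≤ N := by exact_mod_cast hN
  have hu : (1 : ℝ) ≤ u := by
    exact_mod_cast Nat.one_le_iff_ne_zero.2 fun h0 => (Fin.cast h0 (x 0)).elim0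
  have e1 : 2 * ((sharpParams u N γ ε δ).N : ℝ) * ((sharpParams u N γ ε δ).u : ℝ) /
      ((sharpParams u N γ ε δ).γ * (sharpParams u N γ ε δ).ε) =
      2 * N * u * (1 / (sharpParams u N γ ε δ).γ * (1 / (sharpParams u N γ ε δ).ε)) := by
    rw [one_div_mul_one_div, div_eq_mul_one_div]
    rfl
  have e2 : 2 * (N : ℝ) * u / (γ * ε) = 2 * N * u * (1 / γ * (1 / ε)) := by
    rw [one_div_mul_one_div, div_eq_mul_one_div]
  rw [e1, e2, hE]
  have hg : 1 ≤ 1 / γ := (one_le_div hγ).2 hγ1.le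
  have he : 1 ≤ 1 / ε := (one_le_div hε).2 hε1.le
  generalize 1 / γ = g at *
  generalize 1 / ε = e at *
  have hNu : 4 ≤ 2 * (N : ℝ) * u := by nlinarith
  have hge : 1 ≤ g * e := one_le_mul_of_one_le_of_one_le hg he
  have hb4 : 4 ≤ 2 * (N : ℝ) * u * (g * e) := by nlinarith
  have hgb : g ≤ 2 * (N : ℝ) * u * (g * e) := by nlinarith
  set b := 2 * (N : ℝ) * u * (g * e) with hb
  have h1 : 2 * (N : ℝ) * u * (1 / (sharpParams u N γ ε δ).γ * (16 * (e * g))) ≤ b ^ 5 := by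
    calc 2 * (N : ℝ) * u * (1 / (sharpParams u N γ ε δ).γ * (16 * (e * g)))
        ≤ 2 * (N : ℝ) * u * (2 * g * (16 * (e * g))) := by gcongr
      _ = 32 * g * b := by rw [hb]; ring
      _ ≤ 4 ^ 3 * b * b := by
        gcongr
        norm_num
      _ ≤ b ^ 3 * b * b := by gcongr
      _ = b ^ 5 := by ring
  calc _ ≤ (b ^ 5) ^ 12 := by gcongr
    _ = b ^ 60 := by rw [← pow_mul]

end Approximation

end SlidingWindow

open SlidingWindow in
theorem mainTheorem1 :
    (∃ κ c₀ ε₀ C : ℝ, ∃ d : ℕ, 0 < κ ∧ 0 < c₀ ∧ 0 < ε₀ ∧ 0 < C ∧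
      ∀ (u N : ℕ) (γ ε δ : ℝ), 2 ≤ N → 0 < γ → γ < 1 → 0 < ε → ε < ε₀ →
        0 < δ → δ < 1 →
        (freqAlgorithm ⟨u, N, γ, ε, δ, κ⟩).Separates N
          ((1 + c₀ * ε) * γ) ((1 - c₀ / γ * ε) * γ) δ ∧
        (freqAlgorithm ⟨u, N, γ, ε, δ, κ⟩).UsesWords
          (C * (1 / (γ ^ 2 * ε ^ 4) * Real.log N * Real.log (N / δ)
            + 1 / ε ^ 4 * Real.log N * Real.log (1 / ε))) ∧
        (freqAlgorithm ⟨u, N, γ, ε, δ, κ⟩).WordsBoundedBy ((2 * N * u / (γ * ε)) ^ d)) ∧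
    (∃ (p : MvPolynomial (Fin 4) ℝ) (d : ℕ),
      ∀ (u N : ℕ) (γ ε δ : ℝ), 2 ≤ N → 0 < γ → γ < 1 → 0 < ε → ε < 1 →
        0 < δ → δ < 1 →
        ∃ A : StreamAlgorithm u,
          A.ApproximatesFrequent N γ ε δ ∧
          A.UsesWords (MvPolynomial.eval ![1 / ε, 1 / γ, Real.log N, Real.log (1 / δ)] p) ∧
          A.WordsBoundedBy ((2 * N * u / (γ * ε)) ^ d)) := by
  refine ⟨⟨100000, 4, 1 / 8, 10 ^ 17, 12, by norm_num, by norm_num, by norm_num, by norm_num, ?_⟩,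
    memoryPoly, 60, ?_⟩
  · intro u N γ ε δ hN hγ hγ1 hε hε1 hδ hδ1
    have hP : Params.Valid ⟨u, N, γ, ε, δ, 100000⟩ := ⟨hN, hγ, hγ1, hε, hε1, hδ, hδ1, rfl⟩
    exact ⟨freqAlgorithm_separates hP, freqAlgorithm_usesWords hP,
      freqAlgorithm_wordsBoundedBy hP⟩
  · intro u N γ ε δ hN hγ hγ1 hε hε1 hδ hδ1
    exact ⟨freqAlgorithm (sharpParams u N γ ε δ),
      sharpParams_approximates hN hγ hγ1 hε hε1 hδ hδ1,
      sharpParams_usesWords hN hγ hγ1 hε hε1 hδ hδ1,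
      sharpParams_wordsBoundedBy hN hγ hγ1 hε hε1 hδ hδ1⟩
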